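/- **Setting.** Let $\prec$ be a total order on $\mathbb Z^k$ that is invariant under translations. For $S\subset\mathbb Z^k$, $\mathbf t\in\mathbb Z^k$ and $c\ge 0$ put $S^+=\{\mathbf u\in S:\mathbf u\succ\mathbf 0\}$, $(S)_{-\mathbf t}=\{\mathbf s-\mathbf t:\mathbf s\in S\}$, $K_c=[-c,c]^k\cap\mathbb Z^k$ and $S^{(\mathbf t,c)}=((S)_{-\mathbf t}\cap K_c)^+$. Let $\Lambda_n\subset\mathbb Z^k$ be finite with $|\Lambda_n|\to\infty$ and satisfy *Condition* $(\mathcal D^\Lambda)$: there are finitely or countably many pairwise different sets $\mathcal D_1,\mathcal D_2,\dots\subset\{\mathbf t:\mathbf t\succ\mathbf 0\}$ such that, for all $j$ and $p$, the limit $\lambda_{j,p}=\lim_n|\{\mathbf t\in\Lambda_n:\Lambda_n^{(\mathbf t,p)}=\mathcal D_j\cap K_p\}|/|\Lambda_n|$ exists, $\lambda_{j,p}\to\lambda_j>0$ as $p\to\infty$, and $\sum_j\lambda_j=1$. Let $(\mathbf X_{\mathbf t})_{\mathbf t\in\mathbb Z^k}$ be an $\mathbb R^d$-valued stationary random field that is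 regularly varying with index $\alpha>0$ (every finite-dimensional vector of the field is regularly varying with index $\alpha$), and let $a_n$ satisfy $|\Lambda_n|\,\mathbb P(|\mathbf X_{\mathbf 0}|>a_n)\to1$. Its tail field is a random field $(\mathbf Y_{\mathbf t})$ such that $\mathbb P(|\mathbf Y_{\mathbf 0}|>y)=y^{-\alpha}$ for $y\ge1$ and, conditionally on $|\mathbf X_{\mathbf 0}|>x$, the field $x^{-1}\mathbf X$ converges to $\mathbf Y$ in finite-dimensional distributions as $x\to\infty$; put $Y=|\mathbf Y_{\mathbf 0}|$ and $\mathbf\Theta_{\mathbf t}=\mathbf Y_{\mathbf t}/|\mathbf Y_{\mathbf 0}|$. *Condition* $(\mathrm{AC}^\Lambda_\succeq)$: with $R_{l,\Lambda}=\big(\bigcup_{\mathbf t\in\Lambda}(\Lambda)_{-\mathbf t}\big)^+\setminus K_l$, there are integers $r_n\to\infty$ with $k_n=\lfloor|\Lambda_n|/|\Lambda_{r_n}|\rfloor\to\infty$ such that for every $x>0$ $$\lim_{l\to\infty}\limsup_{n\to\infty}\mathbb P\Big(\max_{\mathbf i\in R_{l,\Lambda_{r_n}}}|\mathbf X_{\mathbf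 i}|>a_nx\,\Big|\,|\mathbf X_{\mathbf 0}|>a_nx\Big)=0 .$$ Assume this condition and fix such $(r_n)$ and $(k_n)$. For $\tau\in(0,\infty)$ let $u_n(\tau)$ denote any sequence with $|\Lambda_n|\,\mathbb P(|\mathbf X_{\mathbf 0}|>u_n(\tau))\to\tau$. Suprema over the empty set are $0$. **Theorem.** (1) For all $\tau\in(0,\infty)$ sequences $u_n(\tau)$ exist, and for all of them the limit $$\theta_b^\Lambda=\lim_{n\to\infty}\frac{\mathbb P(\max_{\mathbf t\in\Lambda_{r_n}}|\mathbf X_{\mathbf t}|>u_n(\tau))}{|\Lambda_{r_n}|\,\mathbb P(|\mathbf X_{\mathbf 0}|>u_n(\tau))}$$ exists, does not depend on $\tau$ or on the sequence, and is positive. Moreover $\sup_{\mathbf t\in\mathcal D_j}|\mathbf\Theta_{\mathbf t}|<\infty$ a.s. for every $j$, and $$\theta_b^\Lambda=\sum_j\lambda_j\,\mathbb P\Big(Y\sup_{\mathbf t\in\mathcal D_j}|\mathbf\Theta_{\mathbf t}|\le1\Big)=\sum_j\lambda_j\,\mathbb E\Big[\sup_{\mathbf t\in\mathcal D_j\cup\{\mathbf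 0\}}|\mathbf\Theta_{\mathbf t}|^\alpha-\sup_{\mathbf t\in\mathcal D_j}|\mathbf\Theta_{\mathbf t}|^\alpha\Big].$$ (2) For $D\subset\{\mathbf t:\mathbf t\succ\mathbf 0\}$ put $\mathcal G(D)=\{\mathbf z\in D\cup\{\mathbf 0\}:((D)_{-\mathbf z})^+=D\}$ and $\mathcal L(D)=\mathcal G(D)\cup-\mathcal G(D)$; let $\mathcal L_j=\mathcal L(\mathcal D_j)$ and $\Xi_j^*=\bigcup_{\mathbf z\in\mathcal D_j\cup\{\mathbf 0\}}\big(\mathbf z+\mathcal L(((\mathcal D_j)_{-\mathbf z})^+)\big)$. Suppose that $\Xi_j^*$ is a lattice (a subgroup of $\mathbb Z^k$, of any rank) for every $j$. Then for every $j$, almost surely, $\sum_{\mathbf t\in\Xi_j^*}|\mathbf\Theta_{\mathbf t}|^\alpha<\infty$, and there is exactly one $\mathbf T_j^*\in\mathcal L_j$ with $$|\mathbf\Theta_{\mathbf T_j^*}|>\sup_{\mathbf s\in\mathcal L_j,\,\mathbf s\prec\mathbf T_j^*}|\mathbf\Theta_{\mathbf s}|\quad\text{and}\quad|\mathbf\Theta_{\mathbf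 T_j^*}|=\sup_{\mathbf s\in\mathcal L_j,\,\mathbf s\succeq\mathbf T_j^*}|\mathbf\Theta_{\mathbf s}|.$$ With $\mathbf Q_{\Xi_j^*,\mathbf t}=\mathbf\Theta_{\mathbf t}\big/\big(\sum_{\mathbf s\in\Xi_j^*}|\mathbf\Theta_{\mathbf s}|^\alpha\big)^{1/\alpha}$, $$\theta_b^\Lambda=\sum_j\lambda_j\,\mathbb E\Big[\sup_{\mathbf t\in\Xi_j^*}|\mathbf Q_{\Xi_j^*,\mathbf t}|^\alpha\Big]=\sum_j\lambda_j\,\mathbb E\bigg[\frac{\sup_{\mathbf t\in\Xi_j^*}|\mathbf\Theta_{\mathbf t}|^\alpha}{\sum_{\mathbf s\in\Xi_j^*}|\mathbf\Theta_{\mathbf s}|^\alpha}\bigg]=\sum_j\lambda_j\,\mathbb E\big[|\mathbf\Theta_{\mathbf 0}|^\alpha\mathbf 1(\mathbf T_j^*=\mathbf 0)\big].$$ (3) In case (1) or (2), if for every $x>0$ $$\mathbb P\Big(\max_{\mathbf t\in\Lambda_n}|\mathbf X_{\mathbf t}|\le a_nx\Big)-\mathbb P\Big(\max_{\mathbf t\in\Lambda_{r_n}}|\mathbf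 X_{\mathbf t}|\le a_nx\Big)^{k_n}\to0,\qquad n\to\infty,$$ then the $\Lambda$-extremal index $\theta_X^\Lambda$ exists and equals $\theta_b^\Lambda$; that is, $\theta_b^\Lambda\in[0,1]$, and for every $\tau\in(0,\infty)$ there is a sequence $u_n(\tau)$ as above with $\mathbb P(\max_{\mathbf t\in\Lambda_n}|\mathbf X_{\mathbf t}|\le u_n(\tau))\to e^{-\theta_b^\Lambda\tau}$. -/

import Mathlib

open MeasureTheory ProbabilityTheory Filter Topology
open scoped ENNReal BoundedContinuousFunction

namespace ExtremalField

/-- The index set `ℤᵏ`. -/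
abbrev Site (k : ℕ) : Type := Fin k → ℤ

/-- The state space `ℝᵈ` with its Euclidean norm. -/
abbrev Vec (d : ℕ) : Type := EuclideanSpace ℝ (Fin d)

section Sets

variable {k : ℕ}

/-- A total (strict) order `≺` on `ℤᵏ` that is invariant under translations. -/
structure InvariantOrder (prec : Site k → Site k → Prop) : Prop where
  irrefl : ∀ s, ¬ prec s s
  trans : ∀ s t u, prec s t → prec t u → prec s u
  total : ∀ s t, s ≠ t → prec s t ∨ prec t s
  add_right : ∀ s t u, prec s t → prec (s + u) (t + u)

/-- The hypercube `K_c = [-c, c]ᵏ ∩ ℤᵏ`. -/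
def cube (k c : ℕ) : Set (Site k) := {u | ∀ i, |u i| ≤ (c : ℤ)}

/-- `S⁺ = {u ∈ S : u ≻ 0}`. -/
def upperPart (prec : Site k → Site k → Prop) (S : Set (Site k)) : Set (Site k) :=
  {u | u ∈ S ∧ prec 0 u}

/-- The translate `(S)_{-t} = {s - t : s ∈ S}`. -/
def shiftBack (S : Set (Site k)) (t : Site k) : Set (Site k) := {u | u + t ∈ S}

/-- `S^{(t,c)} = ((S)_{-t} ∩ K_c)⁺`. -/
def localPattern (prec : Site k → Site k → Prop) (S : Set (Site k)) (t : Site k) (c : ℕ) :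
    Set (Site k) :=
  upperPart prec (shiftBack S t ∩ cube k c)

/-- The proportion of points `t` of `Λ` whose local pattern in `K_p` is that of `D`. -/
noncomputable def patternFrequency (prec : Site k → Site k → Prop) (Λ : Finset (Site k))
    (D : Set (Site k)) (p : ℕ) : ℝ :=
  ({t : Site k | t ∈ Λ ∧ localPattern prec (↑Λ) t p = D ∩ cube k p}.ncard : ℝ) / (Λ.card : ℝ)

/-- The condition on the index sets `Λ_n`, with asymptotic patterns `D_i` (finitely or countably
many, pairwise different, contained in `{t : t ≻ 0}`) and weights `lam i = λ_i`. -/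
structure PatternCondition {ι : Type*} (prec : Site k → Site k → Prop)
    (Λ : ℕ → Finset (Site k)) (D : ι → Set (Site k)) (lam : ι → ℝ) : Prop where
  subset_pos : ∀ i, ∀ t ∈ D i, prec 0 t
  injective : Function.Injective D
  exists_limits : ∃ lamp : ι → ℕ → ℝ,
    (∀ i p, Tendsto (fun n => patternFrequency prec (Λ n) (D i) p) atTop (𝓝 (lamp i p))) ∧
    ∀ i, Tendsto (lamp i) atTop (𝓝 (lam i))
  weight_pos : ∀ i, 0 < lam i
  hasSum_weight : HasSum lam 1

/-- `G(D) = {z ∈ D ∪ {0} : ((D)_{-z})⁺ = D}`. -/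
def shiftStabilizer (prec : Site k → Site k → Prop) (D : Set (Site k)) : Set (Site k) :=
  {z | z ∈ insert 0 D ∧ upperPart prec (shiftBack D z) = D}

/-- `L(D) = G(D) ∪ -G(D)`. -/
def latticeOf (prec : Site k → Site k → Prop) (D : Set (Site k)) : Set (Site k) :=
  {z | z ∈ shiftStabilizer prec D ∨ -z ∈ shiftStabilizer prec D}

/-- `Ξ*(D)`: the union, over `z ∈ D ∪ {0}`, of the translates by `z` of `L(((D)_{-z})⁺)`.
Points `z` with the same `((D)_{-z})⁺` give the same translate, so that one representative of
each is enough. -/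
def fullPattern (prec : Site k → Site k → Prop) (D : Set (Site k)) : Set (Site k) :=
  {x | ∃ z ∈ insert 0 D, x - z ∈ latticeOf prec (upperPart prec (shiftBack D z))}

/-- A lattice in `ℤᵏ`, of any rank: an additive subgroup. -/
def IsLattice (S : Set (Site k)) : Prop := ∃ H : AddSubgroup (Site k), (H : Set (Site k)) = S

/-- `R_{l,Λ} = (⋃_{t ∈ Λ} (Λ)_{-t})⁺ \ K_l`. -/
def farDifferences (prec : Site k → Site k → Prop) (l : ℕ) (Λ : Finset (Site k)) :
    Set (Site k) :=
  upperPart prec (⋃ t ∈ Λ, shiftBack (↑Λ) t) \ cube k l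

/-- `t` is the value of the anchor `T*` of the configuration `x` on the lattice `L`: the norm
`|x_t|` is greater than the supremum over the sites of `L` before `t`, and equal to the supremum
over the sites of `L` from `t` on. -/
def IsAnchor {d : ℕ} (prec : Site k → Site k → Prop) (L : Set (Site k)) (x : Site k → Vec d)
    (t : Site k) : Prop :=
  t ∈ L ∧ (⨆ s ∈ {s | s ∈ L ∧ prec s t}, ‖x s‖ₑ) < ‖x t‖ₑ ∧
    ‖x t‖ₑ = ⨆ s ∈ {s | s ∈ L ∧ (s = t ∨ prec t s)}, ‖x s‖ₑ

/-- `‖x‖_{A,α} = (∑_{t ∈ A} |x_t|^α)^{1/α}`. -/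
noncomputable def clusterNorm {d : ℕ} (A : Set (Site k)) (α : ℝ) (x : Site k → Vec d) : ℝ :=
  (∑' t : A, ‖x t‖ ^ α) ^ (1 / α)

/-- The spectral cluster configuration `Q_A = Θ / ‖Θ‖_{A,α}`. -/
noncomputable def spectralCluster {d : ℕ} (A : Set (Site k)) (α : ℝ) (x : Site k → Vec d) :
    Site k → Vec d :=
  fun t => (clusterNorm A α x)⁻¹ • x t

end Sets

section Fields

variable {k d : ℕ} {Ω : Type*} [MeasurableSpace Ω]

/-- Strict stationarity of a random field: its law is invariant under all translations. -/
def IsStationaryField (P : Measure Ω) (X : Site k → Ω → Vec d) : Prop :=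
  ∀ s : Site k, P.map (fun ω (t : Site k) => X (t + s) ω) = P.map (fun ω (t : Site k) => X t ω)

/-- A random vector `Z` in a normed space `V` is regularly varying with index `α`: there is a
nonzero measure `μ` on `V \ {0}`, finite away from the origin and homogeneous of order `-α`, such
that `P(x⁻¹ Z ∈ ·) / P(|Z| > x)` converges to `μ` as `x → ∞`, tested on the bounded continuous
functions that vanish near the origin. -/
def IsRegularlyVaryingVector {V : Type*} [NormedAddCommGroup V] [NormedSpace ℝ V]
    [MeasurableSpace V] (P : Measure Ω) (Z : Ω → V) (α : ℝ) : Prop :=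
  ∃ μ : Measure V, μ ≠ 0 ∧ μ {0} = 0 ∧ (∀ ε : ℝ, 0 < ε → μ {z | ε ≤ ‖z‖} < ⊤) ∧
    (∀ c : ℝ, 0 < c → ∀ s : Set V, MeasurableSet s →
      μ {z | c⁻¹ • z ∈ s} = ENNReal.ofReal (c ^ (-α)) * μ s) ∧
    ∀ f : V →ᵇ ℝ, (∃ ε : ℝ, 0 < ε ∧ ∀ z, ‖z‖ < ε → f z = 0) →
      Tendsto (fun x : ℝ => (∫ ω, f (x⁻¹ • Z ω) ∂P) / P.real {ω | x < ‖Z ω‖}) atTop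
        (𝓝 (∫ z, f z ∂μ))

/-- A random field is regularly varying with index `α` if all its finite-dimensional vectors
are. -/
def IsRegularlyVarying (P : Measure Ω) (X : Site k → Ω → Vec d) (α : ℝ) : Prop :=
  ∀ F : Finset (Site k), F.Nonempty →
    IsRegularlyVaryingVector P (fun ω (t : F) => X t ω) α

/-- `Y`, on its own probability space, is a tail field of `X`: `|Y_0|` has the Pareto law of index
`α` on `[1, ∞)`, and conditionally on `|X_0| > x` the field `x⁻¹ X` converges to `Y` in
finite-dimensional distributions as `x → ∞`. -/
structure IsTailField {Ω' : Type*} [MeasurableSpace Ω'] (P : Measure Ω)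
    (X : Site k → Ω → Vec d) (α : ℝ) (P' : Measure Ω') (Y : Site k → Ω' → Vec d) : Prop where
  measurable : ∀ t, Measurable (Y t)
  pareto : ∀ y : ℝ, 1 ≤ y → P'.real {ω | y < ‖Y 0 ω‖} = y ^ (-α)
  tendsto_fdd : ∀ (F : Finset (Site k)) (f : (F → Vec d) →ᵇ ℝ),
    Tendsto (fun x : ℝ => ∫ ω, f (fun t => x⁻¹ • X t ω) ∂(P[|{ω | x < ‖X 0 ω‖}])) atTop
      (𝓝 (∫ ω, f (fun t => Y t ω) ∂P'))

/-- The spectral field `Θ_t = Y_t / |Y_0|`, as a random configuration. -/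
noncomputable def spectralField {Ω' : Type*} (Y : Site k → Ω' → Vec d) (ω : Ω') :
    Site k → Vec d :=
  fun t => ‖Y 0 ω‖⁻¹ • Y t ω

/-- `|Λ_n| P(|X_0| > u_n) → τ`. -/
def IsLevel (P : Measure Ω) (X : Site k → Ω → Vec d) (Λ : ℕ → Finset (Site k)) (τ : ℝ)
    (u : ℕ → ℝ) : Prop :=
  Tendsto (fun n => ((Λ n).card : ℝ) * P.real {ω | u n < ‖X 0 ω‖}) atTop (𝓝 τ)

/-- `k_n = ⌊|Λ_n| / |Λ_{r_n}|⌋` (division of natural numbers). -/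
def blockCount (Λ : ℕ → Finset (Site k)) (r : ℕ → ℕ) (n : ℕ) : ℕ :=
  (Λ n).card / (Λ (r n)).card

/-- The anti-clustering condition along the integer sequence `r`. The event inside the probability
is `max_{i ∈ R_{l,Λ_{r_n}}} |X_i| > a_n x`. -/
structure AntiClustering (P : Measure Ω) (X : Site k → Ω → Vec d)
    (prec : Site k → Site k → Prop) (Λ : ℕ → Finset (Site k)) (a : ℕ → ℝ) (r : ℕ → ℕ) :
    Prop where
  tendsto_r : Tendsto r atTop atTop
  tendsto_blockCount : Tendsto (blockCount Λ r) atTop atTop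
  tendsto_prob : ∀ x : ℝ, 0 < x →
    Tendsto (fun l : ℕ => limsup (fun n : ℕ =>
        (P[|{ω | a n * x < ‖X 0 ω‖}])
          {ω | ∃ i ∈ farDifferences prec l (Λ (r n)), a n * x < ‖X i ω‖}) atTop)
      atTop (𝓝 (0 : ℝ≥0∞))

/-- The mixing condition
`P(max_{Λ_n} |X_t| ≤ a_n x) - P(max_{Λ_{r_n}} |X_t| ≤ a_n x)^{k_n} → 0` for all `x > 0`. -/
def MaxMixing (P : Measure Ω) (X : Site k → Ω → Vec d) (Λ : ℕ → Finset (Site k))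
    (a : ℕ → ℝ) (r : ℕ → ℕ) : Prop :=
  ∀ x : ℝ, 0 < x →
    Tendsto (fun n => P.real {ω | ∀ t ∈ Λ n, ‖X t ω‖ ≤ a n * x}
        - P.real {ω | ∀ t ∈ Λ (r n), ‖X t ω‖ ≤ a n * x} ^ blockCount Λ r n) atTop (𝓝 0)

/-- `P(max_{t ∈ Λ_{r_n}} |X_t| > u_n) / (|Λ_{r_n}| P(|X_0| > u_n))`. -/
noncomputable def blockRatio (P : Measure Ω) (X : Site k → Ω → Vec d)
    (Λ : ℕ → Finset (Site k)) (r : ℕ → ℕ) (u : ℕ → ℝ) (n : ℕ) : ℝ :=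
  P.real {ω | ∃ t ∈ Λ (r n), u n < ‖X t ω‖} /
    (((Λ (r n)).card : ℝ) * P.real {ω | u n < ‖X 0 ω‖})

/-- `θ` is the block extremal index: for every `τ ∈ (0, ∞)` there are levels `u_n(τ)`, and for
every choice of them the block ratios converge to `θ`. -/
def IsBlockExtremalIndex (P : Measure Ω) (X : Site k → Ω → Vec d) (Λ : ℕ → Finset (Site k))
    (r : ℕ → ℕ) (θ : ℝ) : Prop :=
  ∀ τ : ℝ, 0 < τ → (∃ u : ℕ → ℝ, IsLevel P X Λ τ u) ∧
    ∀ u : ℕ → ℝ, IsLevel P X Λ τ u → Tendsto (blockRatio P X Λ r u) atTop (𝓝 θ)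

/-- `θ` is the extremal index of `X` along `Λ`: `θ ∈ [0, 1]` and for every `τ ∈ (0, ∞)` there are
levels `u_n(τ)` with `P(max_{t ∈ Λ_n} |X_t| ≤ u_n(τ)) → exp(-θ τ)`. -/
def IsExtremalIndex (P : Measure Ω) (X : Site k → Ω → Vec d) (Λ : ℕ → Finset (Site k))
    (θ : ℝ) : Prop :=
  θ ∈ Set.Icc (0 : ℝ) 1 ∧ ∀ τ : ℝ, 0 < τ → ∃ u : ℕ → ℝ, IsLevel P X Λ τ u ∧
    Tendsto (fun n => P.real {ω | ∀ t ∈ Λ n, ‖X t ω‖ ≤ u n}) atTop (𝓝 (Real.exp (-θ * τ)))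

end Fields

end ExtremalField

open ExtremalField

/-!
Decompose the event that a large block exceeds a high level according to the last site at which it
does so. By stationarity each site contributes the probability that the origin exceeds the level
while its later neighbours in the block do not; anti-clustering makes only bounded windows matter,
and in these the block looks like the patterns `D_j`, with asymptotic frequencies `λ_j`. Regular
variation turns each contribution into the probability that the tail field does not exceed `1` on
`D_j`, whence the weighted sum. Positivity: by anti-clustering, at least half of the expected number
of exceedances comes from sites with no later exceedance outside a fixed cube `K_l`, and all such
sites of a block lie in the translate of `K_l` to the first of them, so there are at most `|K_l|`.

The expectation of the difference of suprema comes from integrating out the radius `|Y_0|`, which is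
Pareto and independent of `Θ`. When the pattern is the upper part of a lattice, the time-change
formula of the tail field is a mass transport principle on that lattice: sending mass from the last
exceedance to the anchor identifies the probability that `0` is the last exceedance with the
probability that `0` is the anchor, and sending mass from the anchor to each site in proportion to
`|Y_t|^α` identifies the latter with the expected ratio of supremum and sum.

Under the mixing condition the maximum over `Λ_n` behaves like that of `k_n` independent blocks, and
`(1 - θ τ / k_n) ^ k_n` tends to `exp (-θ τ)`.
-/

namespace ExtremalField

/-! ### Regularly varying vectors -/

section RegularVariation

/-- The piecewise linear cutoff that is `0` up to `a` and `1` from `b` on, a continuous function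
between the indicators of `(b, ∞)` and `(a, ∞)`. -/
noncomputable def ramp (a b r : ℝ) : ℝ := max 0 (min 1 ((r - a) / (b - a)))

lemma ramp_nonneg (a b r : ℝ) : 0 ≤ ramp a b r := le_max_left _ _

lemma ramp_le_one (a b r : ℝ) : ramp a b r ≤ 1 := max_le zero_le_one (min_le_left _ _)

lemma norm_ramp_le_one (a b r : ℝ) : ‖ramp a b r‖ ≤ 1 :=
  (Real.norm_of_nonneg (ramp_nonneg a b r)).trans_le (ramp_le_one a b r)

lemma continuous_ramp (a b : ℝ) : Continuous (ramp a b) := by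
  unfold ramp
  fun_prop

lemma ramp_of_le {a b r : ℝ} (hab : a < b) (h : r ≤ a) : ramp a b r = 0 :=
  max_eq_left ((min_le_right _ _).trans
    (div_nonpos_of_nonpos_of_nonneg (sub_nonpos.2 h) (sub_pos.2 hab).le))

lemma ramp_of_ge {a b r : ℝ} (hab : a < b) (h : b ≤ r) : ramp a b r = 1 := by
  have : 1 ≤ (r - a) / (b - a) := (one_le_div (sub_pos.2 hab)).2 (by linarith)
  simp [ramp, this]

lemma indicator_le_ramp {a b : ℝ} (hab : a < b) (r : ℝ) :
    (Set.Ioi b).indicator 1 r ≤ ramp a b r := by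
  by_cases h : b < r
  · simp [h, ramp_of_ge hab h.le]
  · simp [h, ramp_nonneg]

lemma ramp_le_indicator {a b : ℝ} (hab : a < b) (r : ℝ) :
    ramp a b r ≤ (Set.Ioi a).indicator 1 r := by
  by_cases h : a < r
  · simp [h, ramp_le_one]
  · simp [h, ramp_of_le hab (not_lt.1 h)]

section RampIntegral

variable {W : Type*} [MeasurableSpace W] {μ : Measure W} {g : W → ℝ} {a b : ℝ}

lemma integrable_indicator_Ioi (hg : Measurable g) (hfin : μ {w | a < g w} ≠ ⊤) :
    Integrable ({w | a < g w}.indicator (1 : W → ℝ)) μ :=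
  (integrable_indicator_iff (measurableSet_lt measurable_const hg)).2
    (integrableOn_const (by simpa using hfin))

lemma integrable_ramp (hg : Measurable g) (hab : a < b) (hfin : μ {w | a < g w} ≠ ⊤) :
    Integrable (fun w => ramp a b (g w)) μ := by
  refine (integrable_indicator_Ioi hg hfin).mono'
    ((continuous_ramp a b).measurable.comp hg).aestronglyMeasurable (.of_forall fun w => ?_)
  rw [Real.norm_of_nonneg (ramp_nonneg _ _ _)]
  exact ramp_le_indicator hab (g w)

lemma measureReal_le_integral_ramp (hg : Measurable g) (hab : a < b)
    (hfin : μ {w | a < g w} ≠ ⊤) : μ.real {w | b < g w} ≤ ∫ w, ramp a b (g w) ∂μ := by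
  have hfin' : μ {w | b < g w} ≠ ⊤ :=
    ne_top_of_le_ne_top hfin (measure_mono fun w hw => hab.trans hw)
  rw [← integral_indicator_one (measurableSet_lt measurable_const hg)]
  exact integral_mono (integrable_indicator_Ioi hg hfin') (integrable_ramp hg hab hfin)
    fun w => indicator_le_ramp hab (g w)

lemma integral_ramp_le_measureReal (hg : Measurable g) (hab : a < b)
    (hfin : μ {w | a < g w} ≠ ⊤) : ∫ w, ramp a b (g w) ∂μ ≤ μ.real {w | a < g w} := by
  rw [← integral_indicator_one (measurableSet_lt measurable_const hg)]
  exact integral_mono (integrable_ramp hg hab hfin) (integrable_indicator_Ioi hg hfin)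
    fun w => ramp_le_indicator hab (g w)

end RampIntegral

lemma tendsto_of_interlacing {ι : Type*} {l : Filter ι} {F : ι → ℝ → ℝ} {I : ι → ℝ → ℝ → ℝ}
    {T : ℝ → ℝ} {J : ℝ → ℝ → ℝ} {c₀ c : ℝ} (hc : c₀ < c) (hT : ContinuousAt T c)
    (hI : ∀ a b, c₀ < a → a < b → Tendsto (fun i => I i a b) l (𝓝 (J a b)))
    (hF : ∀ᶠ i in l, ∀ a b, c₀ < a → a < b → F i b ≤ I i a b ∧ I i a b ≤ F i a)
    (hJ : ∀ a b, c₀ < a → a < b → T b ≤ J a b ∧ J a b ≤ T a) :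
    Tendsto (fun i => F i c) l (𝓝 (T c)) := by
  refine tendsto_order.2 ⟨fun y hy => ?_, fun y hy => ?_⟩
  · obtain ⟨b, hyb, hcb⟩ := (((hT.tendsto.mono_left nhdsWithin_le_nhds).eventually_const_lt
      hy).and (self_mem_nhdsWithin (s := Set.Ioi c))).exists
    filter_upwards [hF, (hI c b hc hcb).eventually_const_lt (hyb.trans_le (hJ c b hc hcb).1)]
      with i hi hyi
    exact hyi.trans_le (hi c b hc hcb).2
  · obtain ⟨a, ⟨hay, hac⟩, ha⟩ := (((((hT.tendsto.mono_left nhdsWithin_le_nhds).eventually_lt_const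
      hy).and (self_mem_nhdsWithin (s := Set.Iio c)))).and
      (mem_nhdsWithin_of_mem_nhds (lt_mem_nhds hc))).exists
    have hac : a < c := hac
    have ha : c₀ < a := ha
    filter_upwards [hF, (hI a c ha hac).eventually_lt_const ((hJ a c ha hac).2.trans_lt hay)]
      with i hi hyi
    exact (hi a c ha hac).1.trans_lt hyi

variable {V : Type*} [NormedAddCommGroup V] [NormedSpace ℝ V] {g : V → ℝ}

lemma exists_lt_of_homogeneous (hg : Continuous g)
    (hhom : ∀ c : ℝ, 0 < c → ∀ z, g (c • z) = c * g z) {a : ℝ} (ha : 0 < a) :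
    ∃ ε : ℝ, 0 < ε ∧ ∀ z, ‖z‖ < ε → g z < a := by
  have h0 : g 0 = 0 := by
    have := hhom 2 two_pos 0
    rw [smul_zero] at this
    linarith
  have hev : ∀ᶠ z in 𝓝 0, g z < a := hg.continuousAt.eventually_lt_const (h0.trans_lt ha)
  simpa only [Metric.eventually_nhds_iff, dist_zero_right] using hev

lemma lt_smul_inv_iff_of_homogeneous (hhom : ∀ c : ℝ, 0 < c → ∀ z, g (c • z) = c * g z)
    {x : ℝ} (hx : 0 < x) (a : ℝ) (z : V) : a < g (x⁻¹ • z) ↔ a * x < g z := by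
  rw [hhom _ (inv_pos.2 hx), inv_mul_eq_div, lt_div_iff₀ hx]

variable [MeasurableSpace V]
  {Ω : Type*} [MeasurableSpace Ω] {P : Measure Ω} {Z : Ω → V} {α : ℝ} {μ : Measure V}

/-- `μ` is a limit measure of the regularly varying vector `Z`: the properties required of the
measure in `IsRegularlyVaryingVector`. -/
structure IsTailMeasure (P : Measure Ω) (Z : Ω → V) (α : ℝ) (μ : Measure V) : Prop where
  ne_zero : μ ≠ 0
  singleton_zero : μ {0} = 0
  lt_top : ∀ ε : ℝ, 0 < ε → μ {z | ε ≤ ‖z‖} < ⊤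
  scale : ∀ c : ℝ, 0 < c → ∀ s : Set V, MeasurableSet s →
    μ {z | c⁻¹ • z ∈ s} = ENNReal.ofReal (c ^ (-α)) * μ s
  tendsto : ∀ f : V →ᵇ ℝ, (∃ ε : ℝ, 0 < ε ∧ ∀ z, ‖z‖ < ε → f z = 0) →
    Tendsto (fun x : ℝ => (∫ ω, f (x⁻¹ • Z ω) ∂P) / P.real {ω | x < ‖Z ω‖}) atTop
      (𝓝 (∫ z, f z ∂μ))

lemma IsRegularlyVaryingVector.exists_isTailMeasure (h : IsRegularlyVaryingVector P Z α) :
    ∃ μ, IsTailMeasure P Z α μ :=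
  let ⟨μ, h₁, h₂, h₃, h₄, h₅⟩ := h
  ⟨μ, h₁, h₂, h₃, h₄, h₅⟩

section Homogeneous

lemma IsTailMeasure.measure_ne_top_of_homogeneous (h : IsTailMeasure P Z α μ) (hg : Continuous g)
    (hhom : ∀ c : ℝ, 0 < c → ∀ z, g (c • z) = c * g z) {a : ℝ} (ha : 0 < a) :
    μ {z | a < g z} ≠ ⊤ := by
  obtain ⟨ε, hε, hlt⟩ := exists_lt_of_homogeneous hg hhom ha
  refine ne_top_of_le_ne_top (h.lt_top ε hε).ne (measure_mono fun z hz => ?_)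
  exact not_lt.1 fun hzε => (hlt z hzε).not_gt hz

lemma IsTailMeasure.tendsto_integral_ramp (h : IsTailMeasure P Z α μ) (hg : Continuous g)
    (hhom : ∀ c : ℝ, 0 < c → ∀ z, g (c • z) = c * g z) {a b : ℝ} (ha : 0 < a) (hab : a < b) :
    Tendsto (fun x : ℝ => (∫ ω, ramp a b (g (x⁻¹ • Z ω)) ∂P) / P.real {ω | x < ‖Z ω‖}) atTop
      (𝓝 (∫ z, ramp a b (g z) ∂μ)) := by
  obtain ⟨ε, hε, hlt⟩ := exists_lt_of_homogeneous hg hhom ha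
  exact h.tendsto (.ofNormedAddCommGroup (fun z => ramp a b (g z))
    ((continuous_ramp a b).comp hg) 1 fun z => norm_ramp_le_one a b (g z))
    ⟨ε, hε, fun z hz => ramp_of_le hab (hlt z hz).le⟩

variable [BorelSpace V]

lemma IsTailMeasure.measureReal_of_homogeneous (h : IsTailMeasure P Z α μ) (hg : Continuous g)
    (hhom : ∀ c : ℝ, 0 < c → ∀ z, g (c • z) = c * g z) {c : ℝ} (hc : 0 < c) :
    μ.real {z | c < g z} = c ^ (-α) * μ.real {z | 1 < g z} := by
  have hset : {z | c⁻¹ • z ∈ {z | 1 < g z}} = {z | c < g z} := by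
    ext z
    simp only [Set.mem_ofPred_eq, lt_smul_inv_iff_of_homogeneous hhom hc, one_mul]
  have hscale := h.scale c hc {z | 1 < g z} (measurableSet_lt measurable_const hg.measurable)
  rw [hset] at hscale
  rw [measureReal_def, hscale, ENNReal.toReal_mul, ENNReal.toReal_ofReal (by positivity),
    measureReal_def]

lemma IsTailMeasure.tendsto_tail_ratio [IsFiniteMeasure P] (h : IsTailMeasure P Z α μ)
    (hZ : Measurable Z) (hg : Continuous g)
    (hhom : ∀ c : ℝ, 0 < c → ∀ z, g (c • z) = c * g z) {c : ℝ} (hc : 0 < c) :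
    Tendsto (fun x : ℝ => P.real {ω | c * x < g (Z ω)} / P.real {ω | x < ‖Z ω‖}) atTop
      (𝓝 (c ^ (-α) * μ.real {z | 1 < g z})) := by
  refine tendsto_of_interlacing (T := fun c => c ^ (-α) * μ.real {z | 1 < g z})
    (F := fun x c => P.real {ω | c * x < g (Z ω)} / P.real {ω | x < ‖Z ω‖}) hc
    ((Real.continuousAt_rpow_const _ _ (Or.inl hc.ne')).mul continuousAt_const)
    (fun a b ha hab => h.tendsto_integral_ramp hg hhom ha hab) ?_ fun a b ha hab => ?_
  · filter_upwards [eventually_gt_atTop 0] with x hx a b _ hab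
    have hgx : Measurable fun ω => g (x⁻¹ • Z ω) := hg.measurable.comp (hZ.const_smul _)
    simp only [← lt_smul_inv_iff_of_homogeneous hhom hx]
    exact ⟨div_le_div_of_nonneg_right (measureReal_le_integral_ramp hgx hab (measure_ne_top _ _))
        measureReal_nonneg,
      div_le_div_of_nonneg_right (integral_ramp_le_measureReal hgx hab (measure_ne_top _ _))
        measureReal_nonneg⟩
  · have hfin := h.measure_ne_top_of_homogeneous hg hhom ha
    rw [← h.measureReal_of_homogeneous hg hhom ha,
      ← h.measureReal_of_homogeneous hg hhom (ha.trans hab)]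
    exact ⟨measureReal_le_integral_ramp hg.measurable hab hfin,
      integral_ramp_le_measureReal hg.measurable hab hfin⟩

lemma IsTailMeasure.measureReal_one_lt_norm_pos (h : IsTailMeasure P Z α μ) :
    0 < μ.real {z | 1 < ‖z‖} := by
  have hhom : ∀ c : ℝ, 0 < c → ∀ z : V, ‖c • z‖ = c * ‖z‖ := fun c hc z => by
    rw [norm_smul, Real.norm_of_nonneg hc.le]
  refine measureReal_nonneg.lt_of_ne fun h1 => h.ne_zero (Measure.measure_univ_eq_zero.1 ?_)
  have hnull : ∀ n : ℕ, μ {z | 1 / ((n : ℝ) + 1) < ‖z‖} = 0 := fun n => by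
    have hn : (0 : ℝ) < 1 / ((n : ℝ) + 1) := by positivity
    rw [← measureReal_eq_zero_iff (h.measure_ne_top_of_homogeneous continuous_norm hhom hn),
      h.measureReal_of_homogeneous continuous_norm hhom hn, ← h1, mul_zero]
  refine measure_mono_null (fun z _ => ?_)
    (measure_union_null h.singleton_zero (measure_iUnion_null hnull))
  rcases eq_or_ne z 0 with hz | hz
  · exact Or.inl hz
  · exact Or.inr (Set.mem_iUnion.2 (exists_nat_one_div_lt (norm_pos_iff.2 hz)))

end Homogeneous

variable [BorelSpace V] [IsFiniteMeasure P]

lemma IsRegularlyVaryingVector.tail_pos (h : IsRegularlyVaryingVector P Z α) (hZ : Measurable Z)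
    (x : ℝ) : 0 < P.real {ω | x < ‖Z ω‖} := by
  obtain ⟨μ, hμ⟩ := h.exists_isTailMeasure
  have hlim := hμ.tendsto_tail_ratio hZ continuous_norm
    (fun c hc z => by rw [norm_smul, Real.norm_of_nonneg hc.le]) one_pos
  simp only [Real.one_rpow, one_mul] at hlim
  obtain ⟨y, hy, hxy⟩ := ((hlim.eventually_const_lt hμ.measureReal_one_lt_norm_pos).and
    (eventually_ge_atTop x)).exists
  have hy0 : P.real {ω | y < ‖Z ω‖} ≠ 0 := fun h0 => by simp [h0] at hy
  exact (measureReal_nonneg.lt_of_ne' hy0).trans_le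
    (measureReal_mono fun ω (hω : y < _) => hxy.trans_lt hω)

lemma IsRegularlyVaryingVector.exists_tendsto_tail_ratio (h : IsRegularlyVaryingVector P Z α)
    (hZ : Measurable Z) {g : V → ℝ} (hg : Continuous g)
    (hhom : ∀ c : ℝ, 0 < c → ∀ z, g (c • z) = c * g z) :
    ∃ m : ℝ, ∀ c : ℝ, 0 < c →
      Tendsto (fun x : ℝ => P.real {ω | c * x < g (Z ω)} / P.real {ω | x < ‖Z ω‖}) atTop
        (𝓝 (c ^ (-α) * m)) :=
  let ⟨μ, hμ⟩ := h.exists_isTailMeasure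
  ⟨μ.real {z | 1 < g z}, fun _ hc => hμ.tendsto_tail_ratio hZ hg hhom hc⟩

end RegularVariation

/-! ### Translation invariant orders -/

section Order

variable {k : ℕ} {prec : Site k → Site k → Prop}

lemma InvariantOrder.asymm (h : InvariantOrder prec) {s t : Site k} (hst : prec s t) :
    ¬ prec t s := fun hts => h.irrefl _ (h.trans _ _ _ hst hts)

lemma InvariantOrder.flip (h : InvariantOrder prec) : InvariantOrder fun s t => prec t s where
  irrefl := h.irrefl
  trans _ _ _ hst htu := h.trans _ _ _ htu hst
  total _ _ hst := h.total _ _ hst.symm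
  add_right _ _ _ hst := h.add_right _ _ _ hst

lemma InvariantOrder.add_lt_add_iff_right (h : InvariantOrder prec) {s t : Site k} (u : Site k) :
    prec (s + u) (t + u) ↔ prec s t :=
  ⟨fun hst => by simpa using h.add_right _ _ (-u) hst, h.add_right _ _ u⟩

lemma InvariantOrder.add_lt_iff (h : InvariantOrder prec) {s t u : Site k} :
    prec (s + t) u ↔ prec s (u - t) := by
  rw [← h.add_lt_add_iff_right (s := s) t, sub_add_cancel]

lemma InvariantOrder.lt_add_iff (h : InvariantOrder prec) {s t u : Site k} :
    prec u (s + t) ↔ prec (u - t) s := by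
  rw [← h.add_lt_add_iff_right (t := s) t, sub_add_cancel]

lemma InvariantOrder.sub_pos (h : InvariantOrder prec) {s t : Site k} :
    prec 0 (t - s) ↔ prec s t := by
  rw [← h.add_lt_iff, zero_add]

lemma InvariantOrder.neg_pos (h : InvariantOrder prec) {s : Site k} :
    prec 0 (-s) ↔ prec s 0 := by
  rw [← h.sub_pos (s := s), zero_sub]

lemma InvariantOrder.add_pos (h : InvariantOrder prec) {s t : Site k} (hs : prec 0 s)
    (ht : prec 0 t) : prec 0 (s + t) :=
  h.trans _ _ _ ht (by simpa using h.add_right _ _ t hs)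

lemma InvariantOrder.exists_first (h : InvariantOrder prec) {S : Set (Site k)} (hf : S.Finite)
    (hne : S.Nonempty) : ∃ t ∈ S, ∀ s ∈ S, s = t ∨ prec t s := by
  have : IsStrictOrder (Site k) prec := { irrefl := h.irrefl, trans := h.trans }
  have := hne.to_subtype
  obtain ⟨t, -, ht⟩ := (hf.wellFoundedOn (r := prec)).has_min Set.univ Set.univ_nonempty
  refine ⟨t, t.2, fun s hs => or_iff_not_imp_left.2 fun hst => ?_⟩
  exact (h.total _ _ hst).resolve_left (ht ⟨s, hs⟩ trivial)

lemma InvariantOrder.exists_last (h : InvariantOrder prec) {S : Set (Site k)} (hf : S.Finite)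
    (hne : S.Nonempty) : ∃ t ∈ S, ∀ s ∈ S, s = t ∨ prec s t := h.flip.exists_first hf hne

lemma cube_finite (k c : ℕ) : (cube k c).Finite :=
  (Set.finite_Icc (fun _ : Fin k => -(c : ℤ)) fun _ => (c : ℤ)).subset fun _ hu =>
    ⟨fun i => (abs_le.1 (hu i)).1, fun i => (abs_le.1 (hu i)).2⟩

lemma zero_mem_cube (k c : ℕ) : (0 : Site k) ∈ cube k c := fun i => by simp

lemma cube_mono {k c c' : ℕ} (h : c ≤ c') : cube k c ⊆ cube k c' := fun _ hu i =>
  (hu i).trans (by exact_mod_cast h)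

lemma eventually_mem_cube (u : Site k) : ∀ᶠ p in atTop, u ∈ cube k p := by
  refine eventually_all.2 fun i => ?_
  filter_upwards [eventually_ge_atTop (u i).natAbs] with p hp
  rw [Int.abs_eq_natAbs]
  exact_mod_cast hp

end Order

/-! ### Last exceedances -/

section LastExceedance

variable {k d : ℕ} {prec : Site k → Site k → Prop} {L : Set (Site k)} {u : ℝ}
  {x : Site k → Vec d} {s t : Site k}

/-- `t` is the last site of `L` at which the configuration `x` exceeds the level `u`. -/
def IsLastExceedance (prec : Site k → Site k → Prop) (L : Set (Site k)) (u : ℝ)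
    (x : Site k → Vec d) (t : Site k) : Prop :=
  t ∈ L ∧ u < ‖x t‖ ∧ ∀ s ∈ L, prec t s → ‖x s‖ ≤ u

lemma IsLastExceedance.unique (hprec : InvariantOrder prec) (hs : IsLastExceedance prec L u x s)
    (ht : IsLastExceedance prec L u x t) : s = t := by
  by_contra hne
  rcases hprec.total s t hne with hlt | hlt
  · exact ht.2.1.not_ge (hs.2.2 t ht.1 hlt)
  · exact hs.2.1.not_ge (ht.2.2 s hs.1 hlt)

lemma exists_isLastExceedance (hprec : InvariantOrder prec)
    (hfin : {t | t ∈ L ∧ u < ‖x t‖}.Finite) (hne : ∃ t ∈ L, u < ‖x t‖) :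
    ∃ t, IsLastExceedance prec L u x t := by
  obtain ⟨t, ⟨ht, hut⟩, hlast⟩ := hprec.exists_last hfin hne
  refine ⟨t, ht, hut, fun s hs hts => not_lt.1 fun hus => ?_⟩
  rcases hlast s ⟨hs, hus⟩ with rfl | hst
  · exact hprec.irrefl _ hts
  · exact hprec.asymm hts hst

lemma isLastExceedance_iff_forall_upperPart (hprec : InvariantOrder prec) (ht : t ∈ L) :
    IsLastExceedance prec L u x t ↔
      u < ‖x t‖ ∧ ∀ s ∈ upperPart prec (shiftBack L t), ‖x (s + t)‖ ≤ u := by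
  refine (and_iff_right ht).trans
    (and_congr_right fun _ => ⟨fun h s hs => ?_, fun h s hs hts => ?_⟩)
  · exact h _ hs.1 (hprec.lt_add_iff.2 (by simpa using hs.2))
  · simpa using h (s - t) ⟨by simpa [shiftBack] using hs, hprec.sub_pos.2 hts⟩

lemma ncard_nearly_last_exceedances_le (hprec : InvariantOrder prec) (L : Finset (Site k)) (l : ℕ)
    (u : ℝ) (x : Site k → Vec d) :
    {t | t ∈ L ∧ u < ‖x t‖ ∧
      ∀ s ∈ upperPart prec (shiftBack L t) \ cube k l, ‖x (s + t)‖ ≤ u}.ncard ≤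
      (cube k l).ncard := by
  set S := {t | t ∈ L ∧ u < ‖x t‖ ∧
    ∀ s ∈ upperPart prec (shiftBack L t) \ cube k l, ‖x (s + t)‖ ≤ u}
  rcases S.eq_empty_or_nonempty with hS | hS
  · simp [hS]
  obtain ⟨t₀, ht₀, hfirst⟩ :=
    hprec.exists_first (L.finite_toSet.subset fun t (ht : t ∈ S) => ht.1) hS
  refine Set.ncard_le_ncard_of_injOn (· - t₀) (fun t ht => ?_)
    (fun _ _ _ _ h => sub_left_inj.1 h) (cube_finite k l)
  rcases hfirst t ht with rfl | hlt
  · simpa using zero_mem_cube k l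
  by_contra hfar
  refine ht.2.1.not_ge ?_
  simpa using ht₀.2.2 (t - t₀) ⟨⟨by simpa [shiftBack] using ht.1, hprec.sub_pos.2 hlt⟩, hfar⟩

lemma lt_norm_restrict_iff {W : Type*} {X : Site k → W → Vec d} {F : Finset (Site k)} {w : W}
    (hu : 0 ≤ u) : u < ‖fun t : F => X t w‖ ↔ ∃ t ∈ F, u < ‖X t w‖ := by
  rw [← not_le, pi_norm_le_iff_of_nonneg hu]
  simp

end LastExceedance

/-! ### Exceedance probabilities of a stationary field -/

section Exceedance

variable {k d : ℕ} {Ω : Type*} [MeasurableSpace Ω] {P : Measure Ω} {X : Site k → Ω → Vec d}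
  {α : ℝ} {A B : Set (Site k)}

/-- `P(|X_0| > x)`. -/
noncomputable def tailProb (P : Measure Ω) (X : Site k → Ω → Vec d) (x : ℝ) : ℝ :=
  P.real {ω | x < ‖X 0 ω‖}

/-- `P(|X_0| > x, max_A |X| ≤ x)`. -/
noncomputable def quietProb (P : Measure Ω) (X : Site k → Ω → Vec d) (A : Set (Site k)) (x : ℝ) :
    ℝ :=
  P.real {ω | x < ‖X 0 ω‖ ∧ ∀ s ∈ A, ‖X s ω‖ ≤ x}

/-- `P(|X_0| > x, max_A |X| > x)`. -/
noncomputable def loudProb (P : Measure Ω) (X : Site k → Ω → Vec d) (A : Set (Site k)) (x : ℝ) :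
    ℝ :=
  P.real {ω | x < ‖X 0 ω‖ ∧ ∃ s ∈ A, x < ‖X s ω‖}

lemma measurableSet_tail (hXm : ∀ t, Measurable (X t)) (t : Site k) (x : ℝ) :
    MeasurableSet {ω | x < ‖X t ω‖} := measurableSet_lt measurable_const (hXm t).norm

lemma measurableSet_quiet (hXm : ∀ t, Measurable (X t)) (A : Set (Site k)) (x : ℝ) :
    MeasurableSet {ω | ∀ s ∈ A, ‖X s ω‖ ≤ x} := by
  simp only [Set.ofPred_forall]
  exact .iInter fun s => .iInter fun _ => measurableSet_le (hXm s).norm measurable_const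

lemma measurableSet_loud (hXm : ∀ t, Measurable (X t)) (A : Set (Site k)) (x : ℝ) :
    MeasurableSet {ω | ∃ s ∈ A, x < ‖X s ω‖} := by
  simp only [← exists_prop, Set.ofPred_exists]
  exact .iUnion fun s => .iUnion fun _ => measurableSet_tail hXm s x

lemma IsStationaryField.measureReal_shift (hXs : IsStationaryField P X)
    (hXm : ∀ t, Measurable (X t)) {S : Set (Site k → Vec d)} (hS : MeasurableSet S) (s : Site k) :
    P.real {ω | (fun t => X (t + s) ω) ∈ S} = P.real {ω | (fun t => X t ω) ∈ S} := by
  have h := congrArg (fun μ => μ.real S) (hXs s)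
  rwa [map_measureReal_apply (measurable_pi_lambda _ fun t => hXm _) hS,
    map_measureReal_apply (measurable_pi_lambda _ hXm) hS] at h

lemma IsStationaryField.measureReal_tail_eq (hXs : IsStationaryField P X)
    (hXm : ∀ t, Measurable (X t)) (t : Site k) (x : ℝ) :
    P.real {ω | x < ‖X t ω‖} = tailProb P X x := by
  simpa [tailProb] using hXs.measureReal_shift hXm (measurableSet_tail measurable_pi_apply 0 x) t

lemma IsStationaryField.measureReal_quiet_eq (hXs : IsStationaryField P X)
    (hXm : ∀ t, Measurable (X t)) (A : Set (Site k)) (t : Site k) (x : ℝ) :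
    P.real {ω | x < ‖X t ω‖ ∧ ∀ s ∈ A, ‖X (s + t) ω‖ ≤ x} = quietProb P X A x := by
  simpa [quietProb] using hXs.measureReal_shift hXm
    ((measurableSet_tail measurable_pi_apply 0 x).inter
      (measurableSet_quiet measurable_pi_apply A x)) t

lemma quietProb_nonneg (A : Set (Site k)) (x : ℝ) : 0 ≤ quietProb P X A x := measureReal_nonneg

lemma quietProb_empty (x : ℝ) : quietProb P X ∅ x = tailProb P X x := by
  simp [quietProb, tailProb]

section FiniteMeasure

variable [IsFiniteMeasure P]

lemma tailProb_antitone : Antitone (tailProb P X) := fun _ _ hxy =>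
  measureReal_mono fun _ hω => lt_of_le_of_lt hxy hω.out

lemma loudProb_antitone (A : Set (Site k)) : Antitone (loudProb P X A) := fun _ _ hxy =>
  measureReal_mono fun _ hω => ⟨hxy.trans_lt hω.1, hω.2.imp fun _ hs => ⟨hs.1, hxy.trans_lt hs.2⟩⟩

lemma quietProb_anti (h : A ⊆ B) (x : ℝ) : quietProb P X B x ≤ quietProb P X A x :=
  measureReal_mono fun _ hω => ⟨hω.1, fun s hs => hω.2 s (h hs)⟩

lemma quietProb_le_tailProb (A : Set (Site k)) (x : ℝ) : quietProb P X A x ≤ tailProb P X x :=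
  measureReal_mono fun _ hω => hω.1

lemma loudProb_mono (h : A ⊆ B) (x : ℝ) : loudProb P X A x ≤ loudProb P X B x :=
  measureReal_mono fun _ hω => ⟨hω.1, hω.2.imp fun _ hs => ⟨h hs.1, hs.2⟩⟩

lemma quietProb_add_loudProb (hXm : ∀ t, Measurable (X t)) (A : Set (Site k)) (x : ℝ) :
    quietProb P X A x + loudProb P X A x = tailProb P X x := by
  have hloud : {ω | x < ‖X 0 ω‖ ∧ ∃ s ∈ A, x < ‖X s ω‖} =
      {ω | x < ‖X 0 ω‖} \ {ω | ∀ s ∈ A, ‖X s ω‖ ≤ x} := by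
    ext ω
    simp
  rw [loudProb, hloud]
  exact measureReal_inter_add_sdiff (measurableSet_quiet hXm A x)

lemma quietProb_le_add_loudProb {A' : Set (Site k)} (h : A' ⊆ A ∪ B) (x : ℝ) :
    quietProb P X A x ≤ quietProb P X A' x + loudProb P X B x := by
  refine (measureReal_mono (fun ω hω => ?_)).trans (measureReal_union_le _ _)
  by_cases hB : ∃ s ∈ B, x < ‖X s ω‖
  · exact Or.inr ⟨hω.1, hB⟩
  · push Not at hB
    exact Or.inl ⟨hω.1, fun s hs => (h hs).elim (hω.2 s) (hB s)⟩

end FiniteMeasure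

variable [IsFiniteMeasure P]

lemma tailProb_pos (hXm : ∀ t, Measurable (X t)) (hXrv : IsRegularlyVarying P X α) (x : ℝ) :
    0 < tailProb P X x := by
  refine ((hXrv {0} (Finset.singleton_nonempty _)).tail_pos
    (measurable_pi_lambda _ fun t => hXm _) (max x 0)).trans_le (measureReal_mono fun ω hω => ?_)
  obtain ⟨t, ht, hxt⟩ := (lt_norm_restrict_iff (le_max_right x 0)).1 hω.out
  rw [Finset.mem_singleton.1 ht] at hxt
  exact (le_max_left x 0).trans_lt hxt

lemma exists_tendsto_tailProb_div (hXm : ∀ t, Measurable (X t)) (hXs : IsStationaryField P X)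
    (hXrv : IsRegularlyVarying P X α) {F : Finset (Site k)} (h0 : 0 ∈ F) :
    ∃ m : ℝ, 0 < m ∧ ∀ c : ℝ, 0 < c → Tendsto (fun x : ℝ => tailProb P X (c * x) /
      P.real {ω | x < ‖fun t : F => X t ω‖}) atTop (𝓝 (c ^ (-α) * m)) := by
  have hXF : Measurable fun ω (t : F) => X t ω := measurable_pi_lambda _ fun t => hXm _
  have hF := hXrv F ⟨0, h0⟩
  obtain ⟨m, hm⟩ := hF.exists_tendsto_tail_ratio hXF (g := fun z => ‖z ⟨0, h0⟩‖) (by fun_prop)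
    fun c hc z => by simp [norm_smul, abs_of_pos hc]
  refine ⟨m, ?_, hm⟩
  have hcard : (0 : ℝ) < F.card := by exact_mod_cast Finset.card_pos.2 ⟨0, h0⟩
  have hlim : Tendsto (fun x : ℝ => P.real {ω | x < ‖X 0 ω‖} /
      P.real {ω | x < ‖fun t : F => X t ω‖}) atTop (𝓝 m) := by simpa using hm 1 one_pos
  refine (one_div_pos.2 hcard).trans_le (ge_of_tendsto hlim ?_)
  filter_upwards [eventually_ge_atTop 0] with x hx
  have hunion : {ω | x < ‖fun t : F => X t ω‖} = ⋃ t ∈ F, {ω | x < ‖X t ω‖} := by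
    ext ω
    simp only [lt_norm_restrict_iff hx, Set.mem_iUnion, Set.mem_ofPred_eq, exists_prop]
  rw [div_le_div_iff₀ hcard (hF.tail_pos hXF x), one_mul, hunion]
  exact (measureReal_biUnion_finset_le _ _).trans_eq
    (by simp only [hXs.measureReal_tail_eq hXm, Finset.sum_const, nsmul_eq_mul, mul_comm])

lemma tendsto_tailProb_ratio (hXm : ∀ t, Measurable (X t)) (hXs : IsStationaryField P X)
    (hXrv : IsRegularlyVarying P X α) {c : ℝ} (hc : 0 < c) :
    Tendsto (fun x : ℝ => tailProb P X (c * x) / tailProb P X x) atTop (𝓝 (c ^ (-α))) := by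
  obtain ⟨m, hm0, hm⟩ :=
    exists_tendsto_tailProb_div hXm hXs hXrv (F := {0}) (Finset.mem_singleton_self _)
  have h := (hm c hc).div (hm 1 one_pos) (by simpa using hm0.ne')
  simp only [Real.one_rpow, one_mul, mul_div_cancel_right₀ _ hm0.ne'] at h
  refine h.congr fun x => div_div_div_cancel_right₀ ?_ _ _
  exact ((hXrv {0} (Finset.singleton_nonempty _)).tail_pos
    (measurable_pi_lambda _ fun t => hXm _) x).ne'

lemma exists_tendsto_loudProb (hXm : ∀ t, Measurable (X t)) (hXs : IsStationaryField P X)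
    (hXrv : IsRegularlyVarying P X α) (A : Finset (Site k)) :
    ∃ π : ℝ, Tendsto (fun x : ℝ => loudProb P X A x / tailProb P X x) atTop (𝓝 π) := by
  classical
  set F : Finset (Site k) := insert 0 A
  have h0 : 0 ∈ F := Finset.mem_insert_self _ _
  have hAF : ∀ t ∈ A, t ∈ F := fun t ht => Finset.mem_insert_of_mem ht
  have hXF : Measurable fun ω (t : F) => X t ω := measurable_pi_lambda _ fun t => hXm _
  have hF := hXrv F ⟨0, h0⟩
  obtain ⟨m₀, hm₀, hlim₀⟩ := exists_tendsto_tailProb_div hXm hXs hXrv h0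
  obtain ⟨m, hm⟩ := hF.exists_tendsto_tail_ratio hXF
    (g := fun z => min ‖z ⟨0, h0⟩‖ ‖fun t : A => z ⟨t, hAF t t.2⟩‖) (by fun_prop)
    fun c hc z => by
      rw [mul_min_of_nonneg _ _ hc.le, ← norm_smul_of_nonneg hc.le, ← norm_smul_of_nonneg hc.le]
      rfl
  have h := (hm 1 one_pos).div (hlim₀ 1 one_pos) (by simpa using hm₀.ne')
  refine ⟨_, h.congr' ?_⟩
  filter_upwards [eventually_ge_atTop 0] with x hx
  have hpos := (hF.tail_pos hXF x).ne'
  simp only [Pi.div_apply, one_mul, lt_min_iff, lt_norm_restrict_iff hx] at hpos ⊢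
  exact div_div_div_cancel_right₀ hpos _ _

lemma exists_tendsto_quietProb (hXm : ∀ t, Measurable (X t)) (hXs : IsStationaryField P X)
    (hXrv : IsRegularlyVarying P X α) (hA : A.Finite) :
    ∃ π : ℝ, Tendsto (fun x : ℝ => quietProb P X A x / tailProb P X x) atTop (𝓝 π) := by
  lift A to Finset (Site k) using hA
  obtain ⟨π, hπ⟩ := exists_tendsto_loudProb hXm hXs hXrv A
  refine ⟨1 - π, (hπ.const_sub 1).congr fun x => ?_⟩
  rw [eq_div_iff (tailProb_pos hXm hXrv x).ne', sub_mul, one_mul,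
    div_mul_cancel₀ _ (tailProb_pos hXm hXrv x).ne', ← quietProb_add_loudProb hXm (↑A),
    add_sub_cancel_right]

end Exceedance

/-! ### Exceedances in a block -/

section Block

lemma sum_measureReal_le_mul {W ι : Type*} [MeasurableSpace W] {μ : Measure W} [IsFiniteMeasure μ]
    {s : Finset ι} {G : ι → Set W} {E : Set W} {N : ℕ} (hG : ∀ i ∈ s, MeasurableSet (G i))
    (hE : MeasurableSet E) (hsub : ∀ i ∈ s, G i ⊆ E)
    (hN : ∀ w, {i | i ∈ s ∧ w ∈ G i}.ncard ≤ N) : ∑ i ∈ s, μ.real (G i) ≤ N * μ.real E := by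
  classical
  have hint : ∀ {S : Set W}, MeasurableSet S → Integrable (S.indicator (1 : W → ℝ)) μ :=
    fun hS => (integrable_const 1).indicator hS
  have hcount : ∀ w, ∑ i ∈ s, (G i).indicator (1 : W → ℝ) w ≤ N * E.indicator (1 : W → ℝ) w := by
    intro w
    by_cases hw : w ∈ E
    · simp only [Set.indicator_apply, Pi.one_apply, hw, if_true, mul_one, Finset.sum_boole]
      rw [← Set.ncard_coe_finset, Finset.coe_filter]
      exact_mod_cast hN w
    · have : ∀ i ∈ s, (G i).indicator (1 : W → ℝ) w = 0 := fun i hi =>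
        Set.indicator_of_notMem (fun h => hw (hsub i hi h)) _
      simp [Finset.sum_eq_zero this, hw]
  calc ∑ i ∈ s, μ.real (G i) = ∫ w, ∑ i ∈ s, (G i).indicator (1 : W → ℝ) w ∂μ := by
        rw [integral_finsetSum _ fun i hi => hint (hG i hi)]
        exact Finset.sum_congr rfl fun i hi => (integral_indicator_one (hG i hi)).symm
    _ ≤ ∫ w, N * E.indicator (1 : W → ℝ) w ∂μ :=
        integral_mono (integrable_finsetSum _ fun i hi => hint (hG i hi))
          ((hint hE).const_mul _) hcount
    _ = N * μ.real E := by rw [integral_const_mul, integral_indicator_one hE]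

variable {k d : ℕ} {Ω : Type*} [MeasurableSpace Ω] {P : Measure Ω} [IsFiniteMeasure P]
  {X : Site k → Ω → Vec d} {prec : Site k → Site k → Prop}

lemma measureReal_exists_exceedance_eq_sum (hprec : InvariantOrder prec)
    (hXm : ∀ t, Measurable (X t)) (hXs : IsStationaryField P X) (L : Finset (Site k)) (x : ℝ) :
    P.real {ω | ∃ t ∈ L, x < ‖X t ω‖} =
      ∑ t ∈ L, quietProb P X (upperPart prec (shiftBack L t)) x := by
  have hlast : ∀ t ∈ L, {ω | IsLastExceedance prec L x (fun s => X s ω) t} =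
      {ω | x < ‖X t ω‖ ∧ ∀ s ∈ upperPart prec (shiftBack L t), ‖X (s + t) ω‖ ≤ x} :=
    fun t ht => Set.ext fun ω =>
      isLastExceedance_iff_forall_upperPart (x := fun s => X s ω) hprec (Finset.mem_coe.2 ht)
  have hset : {ω | ∃ t ∈ L, x < ‖X t ω‖} =
      ⋃ t ∈ L, {ω | IsLastExceedance prec L x (fun s => X s ω) t} := by
    ext ω
    simp only [Set.mem_iUnion, exists_prop]
    refine ⟨fun h => ?_, fun ⟨t, ht, h⟩ => ⟨t, ht, h.2.1⟩⟩
    obtain ⟨t, ht⟩ := exists_isLastExceedance (x := fun s => X s ω) hprec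
      (L.finite_toSet.subset fun s hs => hs.1) h
    exact ⟨t, ht.1, ht⟩
  rw [hset, measureReal_biUnion_finset]
  · exact Finset.sum_congr rfl fun t ht => by rw [hlast t ht, hXs.measureReal_quiet_eq hXm]
  · exact fun t _ t' _ hne => Set.disjoint_left.2 fun ω hω hω' => hne (hω.out.unique hprec hω')
  · intro t ht
    rw [hlast t ht]
    exact (measurableSet_tail hXm t x).inter (measurableSet_quiet (fun s => hXm (s + t)) _ x)

lemma upperPart_diff_cube_subset_farDifferences {L : Finset (Site k)} {t : Site k} (ht : t ∈ L)
    (l : ℕ) : upperPart prec (shiftBack L t) \ cube k l ⊆ farDifferences prec l L := fun _ hi =>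
  ⟨⟨Set.mem_iUnion₂.2 ⟨t, ht, hi.1.1⟩, hi.1.2⟩, hi.2⟩

lemma localPattern_subset_upperPart (L : Set (Site k)) (t : Site k) (p : ℕ) :
    localPattern prec L t p ⊆ upperPart prec (shiftBack L t) := fun _ hs => ⟨hs.1.1, hs.2⟩

lemma upperPart_subset_localPattern_union {L : Finset (Site k)} {t : Site k} (ht : t ∈ L) (p : ℕ) :
    upperPart prec (shiftBack L t) ⊆ localPattern prec L t p ∪ farDifferences prec p L := by
  intro s hs
  by_cases hc : s ∈ cube k p
  · exact Or.inl ⟨⟨hs.1, hc⟩, hs.2⟩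
  · exact Or.inr (upperPart_diff_cube_subset_farDifferences ht p ⟨hs, hc⟩)

lemma card_mul_tailProb_le (hprec : InvariantOrder prec) (hXm : ∀ t, Measurable (X t))
    (hXs : IsStationaryField P X) (L : Finset (Site k)) (l : ℕ) (x : ℝ) {ε : ℝ}
    (hfar : loudProb P X (farDifferences prec l L) x ≤ ε * tailProb P X x) :
    L.card * ((1 - ε) * tailProb P X x) ≤
      (cube k l).ncard * P.real {ω | ∃ t ∈ L, x < ‖X t ω‖} := by
  have hquiet : ∀ t ∈ L, (1 - ε) * tailProb P X x ≤
      quietProb P X (upperPart prec (shiftBack L t) \ cube k l) x := fun t ht => by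
    have := quietProb_le_add_loudProb (P := P) (X := X) (A := ∅) (Set.subset_union_of_subset_right
      (upperPart_diff_cube_subset_farDifferences (prec := prec) ht l) _) x
    rw [quietProb_empty] at this
    linarith
  calc (L.card : ℝ) * ((1 - ε) * tailProb P X x) = ∑ t ∈ L, (1 - ε) * tailProb P X x := by simp
    _ ≤ ∑ t ∈ L, quietProb P X (upperPart prec (shiftBack L t) \ cube k l) x :=
      Finset.sum_le_sum hquiet
    _ = ∑ t ∈ L, P.real {ω | x < ‖X t ω‖ ∧
        ∀ s ∈ upperPart prec (shiftBack L t) \ cube k l, ‖X (s + t) ω‖ ≤ x} := by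
      simp only [hXs.measureReal_quiet_eq hXm]
    _ ≤ (cube k l).ncard * P.real {ω | ∃ t ∈ L, x < ‖X t ω‖} :=
      sum_measureReal_le_mul
        (fun t _ => (measurableSet_tail hXm t x).inter
          (measurableSet_quiet (fun s => hXm (s + t)) _ x))
        (measurableSet_loud hXm (↑L) x) (fun t ht ω hω => ⟨t, ht, hω.1⟩)
        fun ω => ncard_nearly_last_exceedances_le hprec L l x fun t => X t ω

end Block

/-! ### Normalizing levels -/

section Levels

variable {k d : ℕ} {Ω : Type*} [MeasurableSpace Ω] {P : Measure Ω}
  {X : Site k → Ω → Vec d} {α τ : ℝ} {prec : Site k → Site k → Prop} {Λ : ℕ → Finset (Site k)}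
  {a u : ℕ → ℝ}

lemma IsLevel.tendsto_tailProb_div (hΛ : Tendsto (fun n => (Λ n).card) atTop atTop) {σ : ℝ}
    {v : ℕ → ℝ} (hv : IsLevel P X Λ σ v) (hu : IsLevel P X Λ τ u) (hτ : 0 < τ) :
    Tendsto (fun n => tailProb P X (v n) / tailProb P X (u n)) atTop (𝓝 (σ / τ)) := by
  refine (hv.div hu hτ.ne').congr' ?_
  filter_upwards [hΛ.eventually_gt_atTop 0] with n hn
  exact mul_div_mul_left _ _ (by exact_mod_cast hn.ne')

variable [IsFiniteMeasure P]

lemma IsLevel.tendsto_atTop (hXm : ∀ t, Measurable (X t)) (hXrv : IsRegularlyVarying P X α)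
    (hΛ : Tendsto (fun n => (Λ n).card) atTop atTop) (hu : IsLevel P X Λ τ u) :
    Tendsto u atTop atTop := by
  have hN : Tendsto (fun n => ((Λ n).card : ℝ)) atTop atTop := tendsto_natCast_atTop_atTop.comp hΛ
  have htail : Tendsto (fun n => tailProb P X (u n)) atTop (𝓝 0) := by
    have h := hu.mul hN.inv_tendsto_atTop
    rw [mul_zero] at h
    refine h.congr' ?_
    filter_upwards [hN.eventually_gt_atTop 0] with n hn
    rw [Pi.inv_apply, mul_comm, inv_mul_cancel_left₀ hn.ne', tailProb]
  refine Filter.tendsto_atTop.2 fun M => ?_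
  filter_upwards [htail.eventually_lt_const (tailProb_pos hXm hXrv M)] with n hn
  exact (tailProb_antitone.reflect_lt hn).le

lemma IsLevel.mul_const (hXm : ∀ t, Measurable (X t)) (hXs : IsStationaryField P X)
    (hXrv : IsRegularlyVarying P X α) (hΛ : Tendsto (fun n => (Λ n).card) atTop atTop)
    (hu : IsLevel P X Λ τ u) {c : ℝ} (hc : 0 < c) :
    IsLevel P X Λ (τ * c ^ (-α)) fun n => u n * c := by
  refine (hu.mul ((tendsto_tailProb_ratio hXm hXs hXrv hc).comp
    (hu.tendsto_atTop hXm hXrv hΛ))).congr fun n => ?_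
  have hT := (tailProb_pos hXm hXrv (u n)).ne'
  simp only [Function.comp_apply, tailProb, mul_comm c] at hT ⊢
  rw [mul_assoc, mul_div_cancel₀ _ hT]

lemma exists_isLevel (hXm : ∀ t, Measurable (X t)) (hXs : IsStationaryField P X)
    (hXrv : IsRegularlyVarying P X α) (hα : 0 < α)
    (hΛ : Tendsto (fun n => (Λ n).card) atTop atTop) (ha : IsLevel P X Λ 1 a) (hτ : 0 < τ) :
    ∃ c : ℝ, 0 < c ∧ IsLevel P X Λ τ fun n => a n * c := by
  refine ⟨τ ^ (-α⁻¹), by positivity, ?_⟩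
  have h := ha.mul_const hXm hXs hXrv hΛ (c := τ ^ (-α⁻¹)) (by positivity)
  rwa [one_mul, ← Real.rpow_mul hτ.le, neg_mul_neg, inv_mul_cancel₀ hα.ne', Real.rpow_one] at h

lemma AntiClustering.eventually_loudProb_mul_const_le (hXm : ∀ t, Measurable (X t))
    (hXrv : IsRegularlyVarying P X α) {r : ℕ → ℕ} (hAC : AntiClustering P X prec Λ a r) {c ε : ℝ}
    (hc : 0 < c) (hε : 0 < ε) :
    ∀ᶠ l in atTop, ∀ᶠ n in atTop,
      loudProb P X (farDifferences prec l (Λ (r n))) (a n * c) ≤ ε * tailProb P X (a n * c) := by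
  filter_upwards [(hAC.tendsto_prob c hc).eventually_lt_const (ENNReal.ofReal_pos.2 hε)] with l hl
  filter_upwards [Filter.eventually_lt_of_limsup_lt hl] with n hn
  rw [cond_apply (measurableSet_tail hXm 0 _)] at hn
  have h := (ENNReal.toReal_lt_toReal hn.ne_top ENNReal.ofReal_ne_top).2 hn
  rw [ENNReal.toReal_mul, ENNReal.toReal_inv, ENNReal.toReal_ofReal hε.le] at h
  rw [mul_comm ε]
  exact ((inv_mul_lt_iff₀ (tailProb_pos hXm hXrv (a n * c))).1 h).le

/-- The anti-clustering condition only concerns the multiples of `a`. A level of intensity `τ` lies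
eventually above the multiple of `a` of intensity `2 τ`, whose tail is only about twice as heavy. -/
lemma AntiClustering.eventually_loudProb_le (hXm : ∀ t, Measurable (X t))
    (hXs : IsStationaryField P X) (hXrv : IsRegularlyVarying P X α) (hα : 0 < α)
    (hΛ : Tendsto (fun n => (Λ n).card) atTop atTop) (ha : IsLevel P X Λ 1 a) {r : ℕ → ℕ}
    (hAC : AntiClustering P X prec Λ a r) (hτ : 0 < τ) (hu : IsLevel P X Λ τ u) {ε : ℝ}
    (hε : 0 < ε) :
    ∀ᶠ l in atTop, ∀ᶠ n in atTop,
      loudProb P X (farDifferences prec l (Λ (r n))) (u n) ≤ ε * tailProb P X (u n) := by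
  obtain ⟨c, hc, hac⟩ := exists_isLevel hXm hXs hXrv hα hΛ ha (τ := 2 * τ) (by positivity)
  have hratio := hac.tendsto_tailProb_div hΛ hu hτ
  rw [mul_div_cancel_right₀ _ hτ.ne'] at hratio
  filter_upwards [hAC.eventually_loudProb_mul_const_le hXm hXrv hc
    (show 0 < ε / 3 by positivity)] with l hl
  filter_upwards [hl, hratio.eventually_const_lt one_lt_two,
    hratio.eventually_lt_const (show (2 : ℝ) < 3 by norm_num)] with n hfar hgt hlt
  have hT := tailProb_pos hXm hXrv (u n)
  rw [one_lt_div hT] at hgt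
  rw [div_lt_iff₀ hT] at hlt
  calc loudProb P X (farDifferences prec l (Λ (r n))) (u n)
      ≤ loudProb P X (farDifferences prec l (Λ (r n))) (a n * c) :=
        loudProb_antitone _ (tailProb_antitone.reflect_lt hgt).le
    _ ≤ ε / 3 * tailProb P X (a n * c) := hfar
    _ ≤ ε / 3 * (3 * tailProb P X (u n)) := by gcongr
    _ = ε * tailProb P X (u n) := by ring

end Levels

/-! ### Pattern frequencies and the block extremal index -/

section Patterns

variable {k : ℕ} {prec : Site k → Site k → Prop} {ι : Type*} {D : ι → Set (Site k)}

open Classical in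
/-- The sites of `L` whose local pattern in `K_p` is that of `A`. -/
noncomputable def patternSites (prec : Site k → Site k → Prop) (L : Finset (Site k))
    (A : Set (Site k)) (p : ℕ) : Finset (Site k) :=
  {t ∈ L | localPattern prec L t p = A ∩ cube k p}

lemma mem_patternSites {L : Finset (Site k)} {A : Set (Site k)} {p : ℕ} {t : Site k} :
    t ∈ patternSites prec L A p ↔ t ∈ L ∧ localPattern prec L t p = A ∩ cube k p := by
  simp [patternSites]

lemma card_patternSites {L : Finset (Site k)} (hL : 0 < L.card) (A : Set (Site k)) (p : ℕ) :
    ((patternSites prec L A p).card : ℝ) = L.card * patternFrequency prec L A p := by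
  rw [patternFrequency, mul_div_cancel₀ _ (by exact_mod_cast hL.ne'), ← Set.ncard_coe_finset,
    patternSites, Finset.coe_filter]

open Classical in
lemma sum_biUnion_patternSites {L : Finset (Site k)} (hL : 0 < L.card) {J : Finset ι} {p : ℕ}
    (hinj : Set.InjOn (fun j => D j ∩ cube k p) J) (g : Set (Site k) → ℝ) :
    ∑ t ∈ J.biUnion fun j => patternSites prec L (D j) p, g (localPattern prec L t p) =
      L.card * ∑ j ∈ J, patternFrequency prec L (D j) p * g (D j ∩ cube k p) := by
  rw [Finset.sum_biUnion, Finset.mul_sum]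
  · refine Finset.sum_congr rfl fun j _ => ?_
    rw [← mul_assoc, ← card_patternSites hL, ← nsmul_eq_mul]
    exact Finset.sum_eq_card_nsmul fun t ht => by rw [(mem_patternSites.1 ht).2]
  · refine fun i hi j hj hij => Finset.disjoint_left.2 fun t hti htj => hij (hinj hi hj ?_)
    exact (mem_patternSites.1 hti).2.symm.trans (mem_patternSites.1 htj).2

lemma biUnion_patternSites_subset [DecidableEq (Site k)] (L : Finset (Site k)) (J : Finset ι)
    (p : ℕ) : (J.biUnion fun j => patternSites prec L (D j) p) ⊆ L :=
  Finset.biUnion_subset.2 fun _ _ _ ht => (mem_patternSites.1 ht).1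

lemma sum_patternFrequency_mul_le {L : Finset (Site k)} (hL : 0 < L.card) {J : Finset ι} {p : ℕ}
    (hinj : Set.InjOn (fun j => D j ∩ cube k p) J) {g : Set (Site k) → ℝ} (hg : ∀ A, 0 ≤ g A) :
    L.card * ∑ j ∈ J, patternFrequency prec L (D j) p * g (D j ∩ cube k p) ≤
      ∑ t ∈ L, g (localPattern prec L t p) := by
  classical
  rw [← sum_biUnion_patternSites hL hinj]
  exact Finset.sum_le_sum_of_subset_of_nonneg (biUnion_patternSites_subset L J p) fun _ _ _ => hg _

lemma sum_localPattern_le {L : Finset (Site k)} (hL : 0 < L.card) {J : Finset ι} {p : ℕ}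
    (hinj : Set.InjOn (fun j => D j ∩ cube k p) J) {g : Set (Site k) → ℝ} (hg : ∀ A, g A ≤ 1) :
    ∑ t ∈ L, g (localPattern prec L t p) ≤
      L.card * (∑ j ∈ J, patternFrequency prec L (D j) p * g (D j ∩ cube k p) +
        (1 - ∑ j ∈ J, patternFrequency prec L (D j) p)) := by
  have h := sum_patternFrequency_mul_le (prec := prec) hL hinj (g := fun A => 1 - g A) fun A =>
    sub_nonneg.2 (hg A)
  simp only [mul_sub, mul_one, Finset.sum_sub_distrib, Finset.sum_const, nsmul_eq_mul] at h
  linarith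

lemma eventually_injOn_inter_cube (hD : Function.Injective D) (J : Finset ι) :
    ∀ᶠ p in atTop, Set.InjOn (fun j => D j ∩ cube k p) J := by
  simp only [Set.InjOn, Finset.mem_coe]
  refine (eventually_all_finset J).2 fun i _ => (eventually_all_finset J).2 fun j _ => ?_
  by_cases hij : i = j
  · exact .of_forall fun _ _ => hij
  · obtain ⟨u, hu⟩ : ∃ u, ¬ (u ∈ D i ↔ u ∈ D j) := by
      by_contra! hcon
      exact hij (hD (Set.ext hcon))
    filter_upwards [eventually_mem_cube u] with p hp heq
    exact absurd (by simpa [hp] using Set.ext_iff.1 heq u) hu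

lemma exists_finset_eventually_partial_average {lam π : ι → ℝ} {lamp ρp : ι → ℕ → ℝ} {θ ε : ℝ}
    (hlam : HasSum lam 1) (hnonneg : ∀ j, 0 ≤ lam j * π j) (hθ : HasSum (fun j => lam j * π j) θ)
    (hlamp : ∀ j, Tendsto (lamp j) atTop (𝓝 (lam j)))
    (hρp : ∀ j, Tendsto (ρp j) atTop (𝓝 (π j))) (hε : 0 < ε) :
    ∃ J : Finset ι, ∀ᶠ p in atTop, θ - ε < ∑ j ∈ J, lamp j p * ρp j p ∧
      ∑ j ∈ J, lamp j p * ρp j p + (1 - ∑ j ∈ J, lamp j p) < θ + ε := by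
  obtain ⟨J, hJlam, hJθ⟩ := ((hlam.eventually_const_lt (show 1 - ε < 1 by linarith)).and
    (hθ.eventually_const_lt (show θ - ε < θ by linarith))).exists
  have hJle : ∑ j ∈ J, lam j * π j ≤ θ := sum_le_hasSum J (fun j _ => hnonneg j) hθ
  have hlow : Tendsto (fun p => ∑ j ∈ J, lamp j p * ρp j p) atTop (𝓝 (∑ j ∈ J, lam j * π j)) :=
    tendsto_finsetSum _ fun j _ => (hlamp j).mul (hρp j)
  have hupp := hlow.add ((tendsto_finsetSum J fun j _ => hlamp j).const_sub 1)
  exact ⟨J, (hlow.eventually_const_lt hJθ).and (hupp.eventually_lt_const (by linarith))⟩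

end Patterns

section Index

variable {k d : ℕ} {Ω : Type*} [MeasurableSpace Ω] {P : Measure Ω} [IsFiniteMeasure P]
  {X : Site k → Ω → Vec d} {α : ℝ} {prec : Site k → Site k → Prop} {Λ : ℕ → Finset (Site k)}
  {a : ℕ → ℝ} {r : ℕ → ℕ} {ι : Type*} {D : ι → Set (Site k)} {lam π : ι → ℝ} {θ : ℝ}

lemma quietRatio_nonneg (hXm : ∀ t, Measurable (X t)) (hXrv : IsRegularlyVarying P X α)
    (A : Set (Site k)) (x : ℝ) : 0 ≤ quietProb P X A x / tailProb P X x :=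
  div_nonneg (quietProb_nonneg A x) (tailProb_pos hXm hXrv x).le

lemma quietRatio_le_one (hXm : ∀ t, Measurable (X t)) (hXrv : IsRegularlyVarying P X α)
    (A : Set (Site k)) (x : ℝ) : quietProb P X A x / tailProb P X x ≤ 1 :=
  div_le_one_of_le₀ (quietProb_le_tailProb A x) (tailProb_pos hXm hXrv x).le

lemma measureReal_exceedance_div_le (hprec : InvariantOrder prec) (hXm : ∀ t, Measurable (X t))
    (hXs : IsStationaryField P X) (hXrv : IsRegularlyVarying P X α) {L : Finset (Site k)}
    (hL : 0 < L.card) {J : Finset ι} {p : ℕ} (hinj : Set.InjOn (fun j => D j ∩ cube k p) J)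
    (x : ℝ) :
    P.real {ω | ∃ t ∈ L, x < ‖X t ω‖} / (L.card * tailProb P X x) ≤
      ∑ j ∈ J, patternFrequency prec L (D j) p *
        (quietProb P X (D j ∩ cube k p) x / tailProb P X x) +
          (1 - ∑ j ∈ J, patternFrequency prec L (D j) p) := by
  have hT := tailProb_pos hXm hXrv x
  have hN : (0 : ℝ) < L.card := by exact_mod_cast hL
  rw [measureReal_exists_exceedance_eq_sum hprec hXm hXs, mul_comm (L.card : ℝ), ← div_div,
    Finset.sum_div, div_le_iff₀ hN, mul_comm _ (L.card : ℝ)]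
  refine le_trans (Finset.sum_le_sum fun t _ => ?_) (sum_localPattern_le hL hinj
    fun A => quietRatio_le_one hXm hXrv A x)
  gcongr
  exact quietProb_anti (localPattern_subset_upperPart _ t p) x

lemma le_measureReal_exceedance_div (hprec : InvariantOrder prec) (hXm : ∀ t, Measurable (X t))
    (hXs : IsStationaryField P X) (hXrv : IsRegularlyVarying P X α) {L : Finset (Site k)}
    (hL : 0 < L.card) {J : Finset ι} {p : ℕ} (hinj : Set.InjOn (fun j => D j ∩ cube k p) J)
    {x ε : ℝ} (hfar : loudProb P X (farDifferences prec p L) x ≤ ε * tailProb P X x) :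
    ∑ j ∈ J, patternFrequency prec L (D j) p *
        (quietProb P X (D j ∩ cube k p) x / tailProb P X x) - ε ≤
      P.real {ω | ∃ t ∈ L, x < ‖X t ω‖} / (L.card * tailProb P X x) := by
  have hT := tailProb_pos hXm hXrv x
  have hN : (0 : ℝ) < L.card := by exact_mod_cast hL
  rw [measureReal_exists_exceedance_eq_sum hprec hXm hXs, mul_comm (L.card : ℝ), ← div_div,
    Finset.sum_div, le_div_iff₀ hN, sub_mul, sub_le_iff_le_add, mul_comm _ (L.card : ℝ)]
  refine (sum_patternFrequency_mul_le hL hinj fun A => quietRatio_nonneg hXm hXrv A x).trans ?_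
  calc ∑ t ∈ L, quietProb P X (localPattern prec L t p) x / tailProb P X x
      ≤ ∑ t ∈ L, (quietProb P X (upperPart prec (shiftBack L t)) x / tailProb P X x + ε) := by
        refine Finset.sum_le_sum fun t ht => ?_
        rw [div_add' _ _ _ hT.ne']
        gcongr
        exact (quietProb_le_add_loudProb (upperPart_subset_localPattern_union ht p) x).trans
          (by gcongr)
    _ = ∑ t ∈ L, quietProb P X (upperPart prec (shiftBack L t)) x / tailProb P X x +
        ε * L.card := by
      rw [Finset.sum_add_distrib, Finset.sum_const, nsmul_eq_mul, mul_comm ε]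

lemma exists_tendsto_inter_cube (hXm : ∀ t, Measurable (X t)) (hXrv : IsRegularlyVarying P X α)
    {ρ : Set (Site k) → ℝ} (hρ : ∀ A : Set (Site k), A.Finite →
      Tendsto (fun x : ℝ => quietProb P X A x / tailProb P X x) atTop (𝓝 (ρ A)))
    (A : Set (Site k)) :
    ∃ π : ℝ, 0 ≤ π ∧ π ≤ 1 ∧ Tendsto (fun p => ρ (A ∩ cube k p)) atTop (𝓝 π) := by
  have hfin : ∀ p, (A ∩ cube k p).Finite := fun p => (cube_finite k p).inter_of_right _
  have hnonneg : ∀ p, 0 ≤ ρ (A ∩ cube k p) := fun p =>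
    ge_of_tendsto' (hρ _ (hfin p)) (quietRatio_nonneg hXm hXrv _)
  have hle_one : ∀ p, ρ (A ∩ cube k p) ≤ 1 := fun p =>
    le_of_tendsto' (hρ _ (hfin p)) (quietRatio_le_one hXm hXrv _)
  have hanti : Antitone fun p => ρ (A ∩ cube k p) := fun p q hpq =>
    le_of_tendsto_of_tendsto' (hρ _ (hfin q)) (hρ _ (hfin p)) fun x =>
      div_le_div_of_nonneg_right
        (quietProb_anti (Set.inter_subset_inter_right _ (cube_mono hpq)) x)
        (tailProb_pos hXm hXrv x).le
  have hlim := tendsto_atTop_ciInf hanti ⟨0, Set.forall_mem_range.2 hnonneg⟩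
  exact ⟨_, ge_of_tendsto' hlim hnonneg, le_of_tendsto' hlim hle_one, hlim⟩

lemma tendsto_blockRatio (hXm : ∀ t, Measurable (X t)) (hα : 0 < α)
    (hXs : IsStationaryField P X) (hXrv : IsRegularlyVarying P X α) (hprec : InvariantOrder prec)
    (hΛ : Tendsto (fun n => (Λ n).card) atTop atTop) (hD : PatternCondition prec Λ D lam)
    (ha : IsLevel P X Λ 1 a) (hAC : AntiClustering P X prec Λ a r)
    {ρ : Set (Site k) → ℝ} (hρ : ∀ A : Set (Site k), A.Finite →
      Tendsto (fun x : ℝ => quietProb P X A x / tailProb P X x) atTop (𝓝 (ρ A)))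
    (hπ0 : ∀ j, 0 ≤ π j) (hπ : ∀ j, Tendsto (fun p => ρ (D j ∩ cube k p)) atTop (𝓝 (π j)))
    (hθ : HasSum (fun j => lam j * π j) θ) {τ : ℝ} (hτ : 0 < τ) {u : ℕ → ℝ}
    (hu : IsLevel P X Λ τ u) : Tendsto (blockRatio P X Λ r u) atTop (𝓝 θ) := by
  obtain ⟨lamp, hlamp, hlam⟩ := hD.exists_limits
  have hN : Tendsto (fun n => (Λ (r n)).card) atTop atTop := hΛ.comp hAC.tendsto_r
  refine Metric.tendsto_nhds.2 fun ε hε => ?_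
  obtain ⟨J, hJ⟩ := exists_finset_eventually_partial_average hD.hasSum_weight
    (fun j => mul_nonneg (hD.weight_pos j).le (hπ0 j)) hθ hlam hπ (half_pos hε)
  obtain ⟨p, ⟨⟨hlow, hupp⟩, hinj⟩, hfar⟩ := ((hJ.and
    (eventually_injOn_inter_cube hD.injective J)).and (hAC.eventually_loudProb_le hXm hXs hXrv hα hΛ
      ha hτ hu (half_pos hε))).exists
  have hfreq : ∀ j, Tendsto (fun n => patternFrequency prec (Λ (r n)) (D j) p) atTop
      (𝓝 (lamp j p)) := fun j => (hlamp j p).comp hAC.tendsto_r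
  have hsum : Tendsto (fun n => ∑ j ∈ J, patternFrequency prec (Λ (r n)) (D j) p *
      (quietProb P X (D j ∩ cube k p) (u n) / tailProb P X (u n))) atTop
      (𝓝 (∑ j ∈ J, lamp j p * ρ (D j ∩ cube k p))) :=
    tendsto_finsetSum _ fun j _ => (hfreq j).mul
      ((hρ _ ((cube_finite k p).inter_of_right _)).comp (hu.tendsto_atTop hXm hXrv hΛ))
  have hsum' := hsum.add ((tendsto_finsetSum J fun j _ => hfreq j).const_sub 1)
  filter_upwards [hfar, hN.eventually_gt_atTop 0, hsum.eventually_const_lt hlow,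
    hsum'.eventually_lt_const hupp] with n hn hpos h₁ h₂
  have hle := measureReal_exceedance_div_le hprec hXm hXs hXrv hpos hinj (u n)
  have hge := le_measureReal_exceedance_div hprec hXm hXs hXrv hpos hinj hn
  simp only [blockRatio, Real.dist_eq, abs_sub_lt_iff, tailProb] at hle hge h₁ h₂ ⊢
  constructor <;> linarith

lemma blockRatio_limit_pos (hXm : ∀ t, Measurable (X t)) (hα : 0 < α)
    (hXs : IsStationaryField P X) (hXrv : IsRegularlyVarying P X α) (hprec : InvariantOrder prec)
    (hΛ : Tendsto (fun n => (Λ n).card) atTop atTop)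
    (ha : IsLevel P X Λ 1 a) (hAC : AntiClustering P X prec Λ a r)
    (hlim : Tendsto (blockRatio P X Λ r a) atTop (𝓝 θ)) : 0 < θ := by
  obtain ⟨l, hl⟩ := (hAC.eventually_loudProb_le hXm hXs hXrv hα hΛ ha one_pos ha
    (show (0 : ℝ) < 1 / 2 by norm_num)).exists
  have hc : (0 : ℝ) < (cube k l).ncard := by
    exact_mod_cast (Set.ncard_pos (cube_finite k l)).2 ⟨0, zero_mem_cube k l⟩
  refine (show (0 : ℝ) < 1 / 2 / (cube k l).ncard by positivity).trans_le (ge_of_tendsto hlim ?_)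
  filter_upwards [hl, (hΛ.comp hAC.tendsto_r).eventually_gt_atTop 0] with n hn hcard
  have hpos : (0 : ℝ) < (Λ (r n)).card * tailProb P X (a n) :=
    mul_pos (by exact_mod_cast hcard) (tailProb_pos hXm hXrv (a n))
  have h := card_mul_tailProb_le hprec hXm hXs (Λ (r n)) l (a n) hn
  change _ ≤ _ / (((Λ (r n)).card : ℝ) * tailProb P X (a n))
  rw [div_le_div_iff₀ hc hpos]
  linarith

lemma exists_blockExtremalIndex (hXm : ∀ t, Measurable (X t)) (hα : 0 < α)
    (hXs : IsStationaryField P X) (hXrv : IsRegularlyVarying P X α) (hprec : InvariantOrder prec)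
    (hΛ : Tendsto (fun n => (Λ n).card) atTop atTop) (hD : PatternCondition prec Λ D lam)
    (ha : IsLevel P X Λ 1 a) (hAC : AntiClustering P X prec Λ a r)
    {ρ : Set (Site k) → ℝ} (hρ : ∀ A : Set (Site k), A.Finite →
      Tendsto (fun x : ℝ => quietProb P X A x / tailProb P X x) atTop (𝓝 (ρ A))) :
    ∃ (π : ι → ℝ) (θ : ℝ), (∀ j, Tendsto (fun p => ρ (D j ∩ cube k p)) atTop (𝓝 (π j))) ∧
      HasSum (fun j => lam j * π j) θ ∧ 0 < θ ∧ θ ≤ 1 ∧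
      ∀ τ : ℝ, 0 < τ → ∀ u : ℕ → ℝ, IsLevel P X Λ τ u →
        Tendsto (blockRatio P X Λ r u) atTop (𝓝 θ) := by
  choose π hπ0 hπ1 hπ using fun j => exists_tendsto_inter_cube hXm hXrv hρ (D j)
  have hle : ∀ j, lam j * π j ≤ lam j := fun j =>
    mul_le_of_le_one_right (hD.weight_pos j).le (hπ1 j)
  obtain ⟨θ, hθ⟩ : Summable fun j => lam j * π j :=
    .of_nonneg_of_le (fun j => mul_nonneg (hD.weight_pos j).le (hπ0 j)) hle
      hD.hasSum_weight.summable
  have hlim : ∀ τ : ℝ, 0 < τ → ∀ u : ℕ → ℝ, IsLevel P X Λ τ u →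
      Tendsto (blockRatio P X Λ r u) atTop (𝓝 θ) := fun τ hτ u hu =>
    tendsto_blockRatio hXm hα hXs hXrv hprec hΛ hD ha hAC hρ hπ0 hπ hθ hτ hu
  exact ⟨π, θ, hπ, hθ, blockRatio_limit_pos hXm hα hXs hXrv hprec hΛ ha hAC (hlim 1 one_pos a ha),
    hasSum_le hle hθ hD.hasSum_weight, hlim⟩

end Index

/-! ### Mixing and the extremal index -/

section Mixing

lemma tendsto_one_sub_pow_exp {κ : ℕ → ℕ} {m : ℕ → ℝ} {t : ℝ} (hκ : Tendsto κ atTop atTop)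
    (hm : ∀ n, m n ∈ Set.Icc (0 : ℝ) 1) (hlim : Tendsto (fun n => κ n * m n) atTop (𝓝 t)) :
    Tendsto (fun n => (1 - m n) ^ κ n) atTop (𝓝 (Real.exp (-t))) := by
  have ht : 0 ≤ t := ge_of_tendsto' hlim fun n => mul_nonneg (Nat.cast_nonneg _) (hm n).1
  have hκ' : Tendsto (fun n => (κ n : ℝ)) atTop atTop := tendsto_natCast_atTop_atTop.comp hκ
  have hexp : Tendsto (fun n => (1 + -t / κ n) ^ κ n) atTop (𝓝 (Real.exp (-t))) :=
    (Real.tendsto_one_add_div_pow_exp (-t)).comp hκ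
  refine hexp.congr_dist (squeeze_zero' (.of_forall fun _ => dist_nonneg) ?_
    (tendsto_iff_dist_tendsto_zero.1 hlim))
  filter_upwards [hκ'.eventually_gt_atTop 0, hκ'.eventually_ge_atTop t] with n hpos hge
  have hbase : |1 + -t / κ n| ≤ 1 := by
    have := div_le_one_of_le₀ hge hpos.le
    have := div_nonneg ht hpos.le
    rw [neg_div, abs_le]
    constructor <;> linarith
  have hbase' : |1 - m n| ≤ 1 := abs_le.2 ⟨by linarith [(hm n).2], by linarith [(hm n).1]⟩
  calc |(1 + -t / κ n) ^ κ n - (1 - m n) ^ κ n|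
      ≤ |(1 + -t / κ n) - (1 - m n)| * κ n * max |1 + -t / κ n| |1 - m n| ^ (κ n - 1) :=
        abs_pow_sub_pow_le _ _ _
    _ ≤ |(1 + -t / κ n) - (1 - m n)| * κ n * 1 := by
        gcongr
        exact pow_le_one₀ ((abs_nonneg _).trans (le_max_left _ _)) (max_le hbase hbase')
    _ = |κ n * m n - t| := by
        rw [mul_one, ← abs_of_pos hpos, ← abs_mul, abs_of_pos hpos]
        congr 1
        field_simp
        ring

lemma tendsto_natDiv_mul_div {N M : ℕ → ℕ} (hk : Tendsto (fun n => N n / M n) atTop atTop) :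
    Tendsto (fun n => ((N n / M n : ℕ) : ℝ) * M n / N n) atTop (𝓝 1) := by
  have hk' : Tendsto (fun n => (N n : ℝ) / M n) atTop atTop :=
    tendsto_atTop_mono (fun _ => Nat.cast_div_le) (tendsto_natCast_atTop_atTop.comp hk)
  refine (tendsto_nat_floor_div_atTop.comp hk').congr fun n => ?_
  rw [Function.comp_apply, Nat.floor_div_eq_div, div_div_eq_mul_div]

variable {k d : ℕ} {Ω : Type*} [MeasurableSpace Ω] {P : Measure Ω} [IsProbabilityMeasure P]
  {X : Site k → Ω → Vec d} {α : ℝ} {Λ : ℕ → Finset (Site k)} {r : ℕ → ℕ} {θ τ : ℝ} {u a : ℕ → ℝ}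

lemma tendsto_blockCount_mul_measureReal (hXm : ∀ t, Measurable (X t))
    (hXrv : IsRegularlyVarying P X α) (hΛ : Tendsto (fun n => (Λ n).card) atTop atTop)
    (hr : Tendsto r atTop atTop) (hk : Tendsto (blockCount Λ r) atTop atTop)
    (hu : IsLevel P X Λ τ u) (hθ : Tendsto (blockRatio P X Λ r u) atTop (𝓝 θ)) :
    Tendsto (fun n => (blockCount Λ r n : ℝ) * P.real {ω | ∃ t ∈ Λ (r n), u n < ‖X t ω‖}) atTop
      (𝓝 (θ * τ)) := by
  have h := ((tendsto_natDiv_mul_div hk).mul hu).mul hθ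
  rw [one_mul, mul_comm τ] at h
  refine h.congr' ?_
  filter_upwards [(hΛ.comp hr).eventually_gt_atTop 0, hΛ.eventually_gt_atTop 0] with n hM hN
  have hT : P.real {ω | u n < ‖X 0 ω‖} ≠ 0 := (tailProb_pos hXm hXrv (u n)).ne'
  have hN' : ((Λ n).card : ℝ) ≠ 0 := by exact_mod_cast hN.ne'
  have hM' : ((Λ (r n)).card : ℝ) ≠ 0 := by exact_mod_cast hM.ne'
  simp only [blockRatio, blockCount]
  field_simp

lemma measureReal_forall_le_eq_one_sub (hXm : ∀ t, Measurable (X t)) (L : Finset (Site k))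
    (x : ℝ) :
    P.real {ω | ∀ t ∈ L, ‖X t ω‖ ≤ x} = 1 - P.real {ω | ∃ t ∈ L, x < ‖X t ω‖} := by
  refine Eq.trans ?_ (probReal_compl_eq_one_sub (measurableSet_loud hXm (↑L) x))
  congr 1
  ext ω
  simp

lemma MaxMixing.isExtremalIndex (hXm : ∀ t, Measurable (X t)) (hα : 0 < α)
    (hXs : IsStationaryField P X) (hXrv : IsRegularlyVarying P X α)
    (hΛ : Tendsto (fun n => (Λ n).card) atTop atTop) (ha : IsLevel P X Λ 1 a)
    (hr : Tendsto r atTop atTop) (hk : Tendsto (blockCount Λ r) atTop atTop)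
    (hmix : MaxMixing P X Λ a r) (hθmem : θ ∈ Set.Icc (0 : ℝ) 1)
    (hθ : ∀ τ : ℝ, 0 < τ → ∀ u : ℕ → ℝ, IsLevel P X Λ τ u →
      Tendsto (blockRatio P X Λ r u) atTop (𝓝 θ)) : IsExtremalIndex P X Λ θ := by
  refine ⟨hθmem, fun τ hτ => ?_⟩
  obtain ⟨c, hc, hu⟩ := exists_isLevel hXm hXs hXrv hα hΛ ha hτ
  refine ⟨_, hu, ?_⟩
  have hpow := tendsto_one_sub_pow_exp hk (fun n => ⟨measureReal_nonneg, measureReal_le_one⟩)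
    (tendsto_blockCount_mul_measureReal hXm hXrv hΛ hr hk hu (hθ τ hτ _ hu))
  simpa [← measureReal_forall_le_eq_one_sub hXm] using (hmix c hc).add hpow

end Mixing

/-! ### The law of the tail field -/

section MeasureExtensionality

/-- The cutoffs come from approximating the indicator of the complement of `U` from above. -/
lemma restrict_eq_of_forall_integral_eq {E : Type*} [TopologicalSpace E] [MeasurableSpace E]
    [BorelSpace E] [HasOuterApproxClosed E] {μ ν : Measure E} [IsFiniteMeasure μ]
    [IsFiniteMeasure ν] {U : Set E} (hU : IsOpen U)
    (h : ∀ g : E →ᵇ ℝ, (∀ z ∉ U, g z = 0) → ∫ z, g z ∂μ = ∫ z, g z ∂ν) :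
    μ.restrict U = ν.restrict U := by
  refine ext_of_forall_integral_eq_of_IsFiniteMeasure fun f => ?_
  let w : ℕ → E → ℝ := fun n z => 1 - hU.isClosed_compl.apprSeq n z
  have hw : ∀ n z, ‖w n z‖ ≤ 1 := fun n z => by
    have hle : (hU.isClosed_compl.apprSeq n z : ℝ) ≤ 1 :=
      HasOuterApproxClosed.apprSeq_apply_le_one _ n z
    exact abs_le.2 ⟨by linarith, sub_le_self _ NNReal.zero_le_coe⟩
  have hwlim : ∀ z, Tendsto (fun n => w n z) atTop (𝓝 (U.indicator 1 z)) := fun z => by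
    have hlim := (NNReal.tendsto_coe.2 (tendsto_pi_nhds.1
      (HasOuterApproxClosed.tendsto_apprSeq hU.isClosed_compl) z)).const_sub 1
    convert hlim using 2
    by_cases hz : z ∈ U <;> simp [hz]
  have hbd : ∀ n z, ‖w n z * f z‖ ≤ ‖f‖ := fun n z => by
    rw [norm_mul]
    exact (mul_le_of_le_one_left (norm_nonneg _) (hw n z)).trans (f.norm_coe_le_norm z)
  have hcont : ∀ n, Continuous fun z => w n z * f z := fun n => by fun_prop
  have hlim : ∀ (κ : Measure E) [IsFiniteMeasure κ],
      Tendsto (fun n => ∫ z, w n z * f z ∂κ) atTop (𝓝 (∫ z in U, f z ∂κ)) := fun κ _ => by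
    rw [← integral_indicator hU.measurableSet]
    refine tendsto_integral_of_dominated_convergence (fun _ => ‖f‖)
      (fun n => (hcont n).measurable.aestronglyMeasurable) (integrable_const _)
      (fun n => .of_forall (hbd n)) (.of_forall fun z => ?_)
    convert (hwlim z).mul_const (f z) using 2
    by_cases hz : z ∈ U <;> simp [hz]
  refine tendsto_nhds_unique (hlim μ) ((hlim ν).congr fun n => (h
    (BoundedContinuousFunction.ofNormedAddCommGroup _ (hcont n) ‖f‖ (hbd n)) fun z hz => ?_).symm)
  simp [w, HasOuterApproxClosed.apprSeq_apply_eq_one hU.isClosed_compl n hz]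

lemma ext_of_map_restrict {ι : Type*} {E : ι → Type*} [∀ i, MeasurableSpace (E i)]
    {μ ν : Measure (∀ i, E i)} [IsFiniteMeasure ν] (F₀ : Finset ι)
    (h : ∀ F : Finset ι, F₀ ⊆ F → μ.map F.restrict = ν.map F.restrict) : μ = ν := by
  classical
  refine IsProjectiveLimit.unique (P := fun I : Finset ι => ν.map I.restrict) (fun I => ?_)
    fun I => rfl
  have hI := congrArg (fun κ => κ.map (Finset.restrict₂ (Finset.subset_union_right (s₁ := F₀))))
    (h (F₀ ∪ I) Finset.subset_union_left)
  simpa only [Measure.map_map (Finset.measurable_restrict₂ _) (Finset.measurable_restrict _),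
    Finset.restrict₂_comp_restrict] using hI

end MeasureExtensionality

section TailLawDefinition

variable {k d : ℕ}

/-- The configuration `x` translated by `t`. -/
def shiftConf (t : Site k) (x : Site k → Vec d) : Site k → Vec d := fun s => x (s - t)

lemma measurable_smul_shiftConf (y : ℝ) (t : Site k) :
    Measurable fun x : Site k → Vec d => y • shiftConf t x :=
  measurable_pi_lambda _ fun _ => (measurable_pi_apply _).const_smul y

lemma measurable_norm_site (t : Site k) : Measurable fun x : Site k → Vec d => ‖x t‖ :=
  (measurable_pi_apply t).norm

lemma measurable_enorm_site (t : Site k) : Measurable fun x : Site k → Vec d => ‖x t‖ₑ :=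
  (measurable_pi_apply t).enorm

lemma measurableSet_confQuiet (A : Set (Site k)) (y : ℝ) :
    MeasurableSet {x : Site k → Vec d | ∀ s ∈ A, ‖x s‖ ≤ y} :=
  measurableSet_quiet (X := fun s (z : Site k → Vec d) => z s) measurable_pi_apply A y

/-- The law of a tail field: a probability measure on configurations with Pareto distributed norm
at the origin that satisfies the time change formula. -/
structure IsTailLaw (α : ℝ) (M : Measure (Site k → Vec d)) : Prop where
  prob : IsProbabilityMeasure M
  pareto : ∀ y : ℝ, 1 ≤ y → M {x | y < ‖x 0‖} = ENNReal.ofReal (y ^ (-α))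
  change : ∀ (t : Site k) (y : ℝ), 0 < y →
    M.restrict {x | 1 < ‖x 0‖ ∧ y < ‖x t‖} = ENNReal.ofReal (y ^ (-α)) •
      (M.map fun x => y • shiftConf t x).restrict {x | 1 < ‖x 0‖ ∧ y < ‖x t‖}

/-- The law of a random field. -/
noncomputable def fieldLaw {Ω' : Type*} [MeasurableSpace Ω'] (P' : Measure Ω')
    (Y : Site k → Ω' → Vec d) : Measure (Site k → Vec d) := P'.map fun ω t => Y t ω

end TailLawDefinition

section TailField

variable {k d : ℕ} {Ω : Type*} [MeasurableSpace Ω] {P : Measure Ω} {X : Site k → Ω → Vec d}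
  {α : ℝ} {Ω' : Type*} [MeasurableSpace Ω'] {P' : Measure Ω'} {Y : Site k → Ω' → Vec d}

lemma IsStationaryField.integral_shift (hXm : ∀ t, Measurable (X t)) (hXs : IsStationaryField P X)
    (t : Site k) {G : (Site k → Vec d) → ℝ} (hG : Measurable G) :
    ∫ ω, G (fun s => X (s - t) ω) ∂P = ∫ ω, G (fun s => X s ω) ∂P := by
  have h := congrArg (fun μ => ∫ z, G z ∂μ) (hXs (-t))
  rwa [integral_map (measurable_pi_lambda _ fun _ => hXm _).aemeasurable hG.aestronglyMeasurable,
    integral_map (measurable_pi_lambda _ hXm).aemeasurable hG.aestronglyMeasurable] at h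

/-- The conditional expectations in the definition of the tail field are ratios with denominator
`P(|X_0| > x)` as soon as the test function itself forces an exceedance at the origin. -/
lemma IsTailField.tendsto_integral_div (hY : IsTailField P X α P' Y)
    {F : Finset (Site k)} (h0 : 0 ∈ F) (g : (F → Vec d) →ᵇ ℝ)
    (hg : ∀ z, ‖z ⟨0, h0⟩‖ ≤ 1 → g z = 0) :
    Tendsto (fun x : ℝ => (∫ ω, g (fun t => x⁻¹ • X t ω) ∂P) / tailProb P X x) atTop
      (𝓝 (∫ ω, g (fun t => Y t ω) ∂P')) := by
  refine (hY.tendsto_fdd F g).congr' ?_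
  filter_upwards [eventually_gt_atTop 0] with x hx
  rw [ProbabilityTheory.cond, integral_smul_measure,
    setIntegral_eq_integral_of_forall_compl_eq_zero, smul_eq_mul, ENNReal.toReal_inv,
    inv_mul_eq_div]
  · rfl
  · intro ω hω
    refine hg _ ?_
    rw [norm_smul, norm_inv, Real.norm_of_nonneg hx.le, inv_mul_le_one₀ hx]
    exact not_lt.1 hω

lemma IsTailField.integral_time_change [IsFiniteMeasure P] (hY : IsTailField P X α P' Y)
    (hXm : ∀ t, Measurable (X t)) (hXs : IsStationaryField P X)
    (hXrv : IsRegularlyVarying P X α) {F : Finset (Site k)} (h0 : 0 ∈ F) {t : Site k} (ht : t ∈ F)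
    {y : ℝ} (hy : 0 < y) (g : (F → Vec d) →ᵇ ℝ)
    (hg : ∀ z, ‖z ⟨0, h0⟩‖ ≤ 1 → g z = 0) (hgt : ∀ z, ‖z ⟨t, ht⟩‖ ≤ y → g z = 0) :
    ∫ ω, g (fun s => Y s ω) ∂P' = y ^ (-α) * ∫ ω, g (fun s => y • Y (s - t) ω) ∂P' := by
  classical
  have hmem : ∀ s : F, (s : Site k) - t ∈ F.image (· - t) := fun s =>
    Finset.mem_image_of_mem _ s.2
  have h0' : 0 ∈ F.image (· - t) := by simpa using hmem ⟨t, ht⟩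
  have hcont : Continuous fun (z : F.image (· - t) → Vec d) (s : F) => y • z ⟨s - t, hmem s⟩ := by
    fun_prop
  have hshift : Tendsto (fun x : ℝ => (∫ ω, g (fun s => y • x⁻¹ • X (s - t) ω) ∂P) /
      tailProb P X x) atTop (𝓝 (∫ ω, g (fun s => y • Y (s - t) ω) ∂P')) := by
    refine hY.tendsto_integral_div h0' (g.compContinuous ⟨_, hcont⟩) fun z hz => hgt _ ?_
    have hz' : ‖z ⟨t - t, hmem ⟨t, ht⟩⟩‖ ≤ 1 := by simpa only [sub_self] using hz
    change ‖y • z ⟨t - t, hmem ⟨t, ht⟩⟩‖ ≤ y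
    rw [norm_smul, Real.norm_of_nonneg hy.le]
    exact mul_le_of_le_one_right hy.le hz'
  refine tendsto_nhds_unique ((hY.tendsto_integral_div h0 g hg).congr fun x => ?_)
    ((tendsto_tailProb_ratio hXm hXs hXrv hy).mul (hshift.comp (tendsto_id.const_mul_atTop hy)))
  have hG : Measurable fun z : Site k → Vec d => g fun s : F => x⁻¹ • z s :=
    g.continuous.measurable.comp
      (measurable_pi_lambda _ fun s => (measurable_pi_apply (s : Site k)).const_smul x⁻¹)
  simp only [Function.comp_apply, id, smul_smul, mul_inv, mul_inv_cancel_left₀ hy.ne']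
  rw [div_mul_div_comm, mul_comm (tailProb P X x),
    mul_div_mul_left _ _ (tailProb_pos hXm hXrv (y * x)).ne', ← hXs.integral_shift hXm t hG]

lemma IsTailField.isProbabilityMeasure_fieldLaw [IsProbabilityMeasure P']
    (hY : IsTailField P X α P' Y) : IsProbabilityMeasure (fieldLaw P' Y) :=
  Measure.isProbabilityMeasure_map (measurable_pi_lambda _ hY.measurable).aemeasurable

lemma IsTailField.map_restrict_time_change [IsFiniteMeasure P] [IsProbabilityMeasure P']
    (hY : IsTailField P X α P' Y) (hXm : ∀ t, Measurable (X t)) (hXs : IsStationaryField P X)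
    (hXrv : IsRegularlyVarying P X α) {F : Finset (Site k)} (h0 : 0 ∈ F) {t : Site k} (ht : t ∈ F)
    {y : ℝ} (hy : 0 < y) :
    ((fieldLaw P' Y).map F.restrict).restrict {z | 1 < ‖z ⟨0, h0⟩‖ ∧ y < ‖z ⟨t, ht⟩‖} =
      (ENNReal.ofReal (y ^ (-α)) • ((fieldLaw P' Y).map fun x => y • shiftConf t x).map
        F.restrict).restrict {z | 1 < ‖z ⟨0, h0⟩‖ ∧ y < ‖z ⟨t, ht⟩‖} := by
  have hYm : Measurable fun ω t => Y t ω := measurable_pi_lambda _ hY.measurable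
  have hshift := measurable_smul_shiftConf (d := d) y t
  have hres := Finset.measurable_restrict (X := fun _ : Site k => Vec d) F
  have := hY.isProbabilityMeasure_fieldLaw
  have := Measure.smul_finite (((fieldLaw P' Y).map fun x => y • shiftConf t x).map F.restrict)
    (ENNReal.ofReal_ne_top (r := y ^ (-α)))
  have hU : IsOpen {z : F → Vec d | 1 < ‖z ⟨0, h0⟩‖ ∧ y < ‖z ⟨t, ht⟩‖} :=
    (isOpen_lt continuous_const (continuous_apply _).norm).and
      (isOpen_lt continuous_const (continuous_apply _).norm)
  refine restrict_eq_of_forall_integral_eq hU fun g hg => ?_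
  have hgm := g.continuous.stronglyMeasurable
  rw [integral_smul_measure, ENNReal.toReal_ofReal (by positivity), smul_eq_mul, fieldLaw,
    Measure.map_map hres hYm, Measure.map_map hshift hYm, Measure.map_map hres (hshift.comp hYm),
    integral_map (hres.comp hYm).aemeasurable hgm.aestronglyMeasurable,
    integral_map (hres.comp (hshift.comp hYm)).aemeasurable hgm.aestronglyMeasurable]
  exact hY.integral_time_change hXm hXs hXrv h0 ht hy g
    (fun z hz => hg z fun hzU => hz.not_gt hzU.1) fun z hz => hg z fun hzU => hz.not_gt hzU.2

theorem IsTailField.isTailLaw [IsFiniteMeasure P] [IsProbabilityMeasure P']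
    (hY : IsTailField P X α P' Y) (hXm : ∀ t, Measurable (X t)) (hXs : IsStationaryField P X)
    (hXrv : IsRegularlyVarying P X α) : IsTailLaw α (fieldLaw P' Y) := by
  classical
  have hprob := hY.isProbabilityMeasure_fieldLaw
  refine ⟨hprob, fun y hy => ?_, fun t y hy => ?_⟩
  · rw [fieldLaw, Measure.map_apply (measurable_pi_lambda _ hY.measurable)
      (measurableSet_lt measurable_const (measurable_norm_site 0)), ← hY.pareto y hy,
      ofReal_measureReal]
    rfl
  · have := Measure.isProbabilityMeasure_map (μ := fieldLaw P' Y)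
      (measurable_smul_shiftConf (d := d) y t).aemeasurable
    have := Measure.smul_finite (((fieldLaw P' Y).map fun x => y • shiftConf t x).restrict
      {x | 1 < ‖x 0‖ ∧ y < ‖x t‖}) (ENNReal.ofReal_ne_top (r := y ^ (-α)))
    refine ext_of_map_restrict {0, t} fun F hF => ?_
    have h0 : 0 ∈ F := hF (by simp)
    have ht : t ∈ F := hF (by simp)
    have hU : MeasurableSet {z : F → Vec d | 1 < ‖z ⟨0, h0⟩‖ ∧ y < ‖z ⟨t, ht⟩‖} :=
      (measurableSet_lt measurable_const (measurable_pi_apply _).norm).inter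
        (measurableSet_lt measurable_const (measurable_pi_apply _).norm)
    have hres := Finset.measurable_restrict (X := fun _ : Site k => Vec d) F
    have h := hY.map_restrict_time_change hXm hXs hXrv h0 ht hy
    rw [Measure.restrict_smul, Measure.restrict_map hres hU, Measure.restrict_map hres hU,
      ← Measure.map_smul] at h
    exact h

lemma IsTailField.tendsto_cond_measureReal [IsFiniteMeasure P] [IsProbabilityMeasure P']
    (hY : IsTailField P X α P' Y) (hXm : ∀ t, Measurable (X t)) (hXrv : IsRegularlyVarying P X α)
    {F : Finset (Site k)} {B : Set (F → Vec d)} (hB : MeasurableSet B)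
    (hnull : P'.map (fun ω (t : F) => Y t ω) (frontier B) = 0) :
    Tendsto (fun x => P[|{ω | x < ‖X 0 ω‖}].real {ω | (fun t : F => x⁻¹ • X t ω) ∈ B}) atTop
      (𝓝 (P'.real {ω | (fun t : F => Y t ω) ∈ B})) := by
  have hYF : Measurable fun ω (t : F) => Y t ω := measurable_pi_lambda _ fun t => hY.measurable t
  have hXF : ∀ x : ℝ, Measurable fun ω (t : F) => x⁻¹ • X t ω := fun x =>
    measurable_pi_lambda _ fun t => (hXm t).const_smul x⁻¹
  have hcond : ∀ x, IsProbabilityMeasure (P[|{ω | x < ‖X 0 ω‖}]) := fun x =>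
    cond_isProbabilityMeasure ((measureReal_ne_zero_iff).1 (tailProb_pos hXm hXrv x).ne')
  let μ : ProbabilityMeasure (F → Vec d) :=
    ⟨P'.map fun ω t => Y t ω, Measure.isProbabilityMeasure_map hYF.aemeasurable⟩
  let μs : ℝ → ProbabilityMeasure (F → Vec d) := fun x =>
    ⟨P[|{ω | x < ‖X 0 ω‖}].map fun ω t => x⁻¹ • X t ω,
      Measure.isProbabilityMeasure_map (hXF x).aemeasurable⟩
  have hlim : Tendsto μs atTop (𝓝 μ) := by
    refine ProbabilityMeasure.tendsto_iff_forall_integral_tendsto.2 fun f => ?_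
    have hf := f.continuous.stronglyMeasurable
    simpa only [μ, μs, ProbabilityMeasure.coe_mk, integral_map hYF.aemeasurable
      hf.aestronglyMeasurable, integral_map (hXF _).aemeasurable hf.aestronglyMeasurable]
      using hY.tendsto_fdd F f
  have h := (ENNReal.tendsto_toReal (measure_ne_top _ _)).comp
    (ProbabilityMeasure.tendsto_measure_of_null_frontier_of_tendsto' hlim hnull)
  simp only [μ, μs, ProbabilityMeasure.coe_mk, Function.comp_def, Measure.map_apply hYF hB,
    Measure.map_apply (hXF _) hB] at h
  exact h

lemma frontier_closedBall_subset_iUnion {ι E : Type*} [Fintype ι] [SeminormedAddCommGroup E]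
    {r : ℝ} (hr : 0 < r) :
    frontier (Metric.closedBall (0 : ι → E) r) ⊆ ⋃ i, {z | ‖z i‖ = r} := by
  refine Metric.frontier_closedBall_subset_sphere.trans fun z hz => ?_
  rw [mem_sphere_zero_iff_norm] at hz
  by_contra hcon
  simp only [Set.mem_iUnion, Set.mem_ofPred_eq, not_exists] at hcon
  exact ((pi_norm_lt_iff hr).2 fun i => (hz ▸ norm_le_pi_norm z i).lt_of_ne (hcon i)).ne hz

lemma IsTailField.tendsto_quietProb [IsFiniteMeasure P] [IsProbabilityMeasure P']
    (hY : IsTailField P X α P' Y) (hXm : ∀ t, Measurable (X t)) (hXrv : IsRegularlyVarying P X α)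
    (hnull : ∀ t, fieldLaw P' Y {x | ‖x t‖ = 1} = 0) {A : Set (Site k)} (hA : A.Finite) :
    Tendsto (fun x => quietProb P X A x / tailProb P X x) atTop
      (𝓝 ((fieldLaw P' Y).real {x | ∀ s ∈ A, ‖x s‖ ≤ 1})) := by
  lift A to Finset (Site k) using hA
  have hYm : Measurable fun ω t => Y t ω := measurable_pi_lambda _ hY.measurable
  have hfrontier : P'.map (fun ω (t : A) => Y t ω) (frontier (Metric.closedBall 0 1)) = 0 := by
    refine measure_mono_null (frontier_closedBall_subset_iUnion one_pos)
      (measure_iUnion_null fun t => ?_)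
    have h := hnull t
    rw [fieldLaw, Measure.map_apply hYm
      (measurableSet_eq_fun (measurable_norm_site _) measurable_const)] at h
    have hYA : Measurable fun ω (t : A) => Y t ω := measurable_pi_lambda _ fun t => hY.measurable t
    rwa [Measure.map_apply hYA
      (measurableSet_eq_fun (measurable_pi_apply t).norm measurable_const)]
  have h := hY.tendsto_cond_measureReal hXm hXrv measurableSet_closedBall hfrontier
  rw [fieldLaw, map_measureReal_apply hYm (measurableSet_confQuiet _ _)]
  convert h.congr' ?_ using 3
  · ext ω
    simp [pi_norm_le_iff_of_nonneg]
  · filter_upwards [eventually_gt_atTop 0] with x hx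
    rw [measureReal_def, cond_apply (measurableSet_tail hXm 0 x), ENNReal.toReal_mul,
      ENNReal.toReal_inv, inv_mul_eq_div]
    refine congrArg (· / _) (congrArg P.real (Set.ext fun ω => ?_))
    simp only [Set.mem_inter_iff, Set.mem_ofPred_eq, mem_closedBall_zero_iff,
      pi_norm_le_iff_of_nonneg zero_le_one, norm_smul, norm_inv, Real.norm_of_nonneg hx.le,
      inv_mul_le_one₀ hx, Subtype.forall, Finset.mem_coe]

end TailField

lemma indicator_congr_point {α β M : Type*} [Zero M] {S : Set α} {S' : Set β} {f : α → M}
    {g : β → M} {w : α} {w' : β} (hiff : w ∈ S ↔ w' ∈ S') (hfg : f w = g w') :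
    S.indicator f w = S'.indicator g w' := by
  classical
  rw [Set.indicator_apply, Set.indicator_apply, hfg]
  exact if_congr hiff rfl rfl

section TailLaw

variable {k d : ℕ} {α : ℝ} {M : Measure (Site k → Vec d)}

lemma measurableSet_norm_gt (t : Site k) (y : ℝ) :
    MeasurableSet {x : Site k → Vec d | y < ‖x t‖} :=
  measurableSet_lt measurable_const (measurable_norm_site t)

lemma IsTailLaw.ae_one_lt (h : IsTailLaw α M) : ∀ᵐ x ∂M, 1 < ‖x 0‖ := by
  have := h.prob
  exact (mem_ae_iff_prob_eq_one (measurableSet_norm_gt 0 1)).2 (by simp [h.pareto 1 le_rfl])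

lemma IsTailLaw.setLIntegral_change (h : IsTailLaw α M) {F : (Site k → Vec d) → ℝ≥0∞}
    (hF : Measurable F) (t : Site k) {y : ℝ} (hy : 0 < y) :
    ∫⁻ x in {x | y < ‖x t‖}, F x ∂M = ENNReal.ofReal (y ^ (-α)) *
      ∫⁻ x in {x | 1 < ‖y • x (-t)‖}, F (y • shiftConf t x) ∂M := by
  have hS : MeasurableSet {x : Site k → Vec d | 1 < ‖x 0‖ ∧ y < ‖x t‖} :=
    (measurableSet_norm_gt 0 1).inter (measurableSet_norm_gt t y)
  have horigin : {x | y < ‖x t‖} =ᵐ[M] {x | 1 < ‖x 0‖ ∧ y < ‖x t‖} := by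
    filter_upwards [h.ae_one_lt] with x hx
    exact propext ⟨fun hxt => ⟨hx, hxt⟩, And.right⟩
  rw [setLIntegral_congr horigin, h.change t y hy, lintegral_smul_measure, smul_eq_mul,
    setLIntegral_map hS hF (measurable_smul_shiftConf y t)]
  refine congrArg _ (setLIntegral_congr ?_)
  filter_upwards [h.ae_one_lt] with x hx
  have hxy : y < ‖y • x (t - t)‖ := by
    rw [sub_self, norm_smul, Real.norm_of_nonneg hy.le]
    exact lt_mul_of_one_lt_right hy hx
  change (1 < ‖y • x (0 - t)‖ ∧ y < ‖y • x (t - t)‖) = (1 < ‖y • x (-t)‖)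
  rw [zero_sub, eq_true hxy, and_true]

lemma IsTailLaw.measure_change (h : IsTailLaw α M) {E : Set (Site k → Vec d)}
    (hE : MeasurableSet E) (t : Site k) {y : ℝ} (hy : 0 < y) :
    M (E ∩ {x | y < ‖x t‖}) = ENNReal.ofReal (y ^ (-α)) *
      M ((fun x => y • shiftConf t x) ⁻¹' E ∩ {x | 1 < ‖y • x (-t)‖}) := by
  have hE' := measurable_smul_shiftConf y t hE
  have hchange := h.setLIntegral_change (measurable_one.indicator hE) t hy
  rw [lintegral_indicator_one hE, Measure.restrict_apply hE] at hchange
  rw [hchange, ← Measure.restrict_apply hE', ← lintegral_indicator_one hE']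
  rfl

lemma IsTailLaw.setLIntegral_shift (h : IsTailLaw α M) {F : (Site k → Vec d) → ℝ≥0∞}
    (hF : Measurable F) (t : Site k) :
    ∫⁻ x in {x | 1 < ‖x t‖}, F x ∂M = ∫⁻ x in {x | 1 < ‖x (-t)‖}, F (shiftConf t x) ∂M := by
  simpa using h.setLIntegral_change hF t one_pos

lemma IsTailLaw.measure_shift (h : IsTailLaw α M) {E : Set (Site k → Vec d)}
    (hE : MeasurableSet E) (t : Site k) :
    M (E ∩ {x | 1 < ‖x t‖}) = M (shiftConf t ⁻¹' E ∩ {x | 1 < ‖x (-t)‖}) := by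
  simpa using h.measure_change hE t one_pos

lemma IsTailLaw.ae_shift (h : IsTailLaw α M) {p : (Site k → Vec d) → Prop} (hp : ∀ᵐ x ∂M, p x)
    (t : Site k) : ∀ᵐ x ∂M, 1 < ‖x (-t)‖ → p (shiftConf t x) := by
  obtain ⟨s, hs, hsm, hs0⟩ := exists_measurable_superset_of_null (ae_iff.1 hp)
  have hshift := h.measure_shift hsm t
  rw [measure_mono_null Set.inter_subset_left hs0] at hshift
  refine ae_iff.2 (measure_mono_null (fun x hx => ?_) hshift.symm)
  obtain ⟨hx1, hxp⟩ := Classical.not_imp.1 hx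
  exact ⟨hs hxp, hx1⟩

lemma IsTailLaw.measure_scale (h : IsTailLaw α M) {E : Set (Site k → Vec d)}
    (hE : MeasurableSet E) {y : ℝ} (hy : 1 ≤ y) :
    M (E ∩ {x | y < ‖x 0‖}) = ENNReal.ofReal (y ^ (-α)) * M ((fun x => y • x) ⁻¹' E) := by
  have hy0 : 0 < y := one_pos.trans_le hy
  have hscaled : ∀ᵐ x ∂M, 1 < ‖y • x 0‖ := by
    filter_upwards [h.ae_one_lt] with x hx
    rw [norm_smul, Real.norm_of_nonneg hy0.le]
    exact one_lt_mul_of_le_of_lt hy hx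
  have hzero : ∀ x : Site k → Vec d, shiftConf 0 x = x := fun x =>
    funext fun s => congrArg x (sub_zero s)
  rw [h.measure_change hE 0 hy0]
  simp only [hzero, neg_zero]
  refine congrArg _ (measure_congr ?_)
  filter_upwards [hscaled] with x hx
  exact propext ⟨And.left, fun hxE => ⟨hxE, hx⟩⟩

lemma IsTailLaw.ae_scale (h : IsTailLaw α M) {p : (Site k → Vec d) → Prop} (hp : ∀ᵐ x ∂M, p x)
    {y : ℝ} (hy : 1 ≤ y) : ∀ᵐ x ∂M, p (y • x) := by
  obtain ⟨s, hs, hsm, hs0⟩ := exists_measurable_superset_of_null (ae_iff.1 hp)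
  have hscale := h.measure_scale hsm hy
  have hpos : 0 < y ^ (-α) := Real.rpow_pos_of_pos (one_pos.trans_le hy) _
  rw [measure_mono_null Set.inter_subset_left hs0] at hscale
  exact ae_iff.2 (measure_mono_null (Set.preimage_mono hs)
    ((mul_eq_zero.1 hscale.symm).resolve_left (ENNReal.ofReal_pos.2 hpos).ne'))

lemma IsTailLaw.measure_norm_zero_eq (h : IsTailLaw α M) {c : ℝ} (hc : 1 < c) :
    M {x | ‖x 0‖ = c} = 0 := by
  have := h.prob
  have htail : ∀ y : ℝ, 1 ≤ y → M.real {x | y < ‖x 0‖} = y ^ (-α) := fun y hy => by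
    rw [measureReal_def, h.pareto y hy, ENNReal.toReal_ofReal (by positivity)]
  have hbound : ∀ y ∈ Set.Ioo 1 c, M.real {x | ‖x 0‖ = c} ≤ y ^ (-α) - c ^ (-α) := by
    intro y hy
    rw [← htail y hy.1.le, ← htail c hc.le, le_sub_iff_add_le, ← measureReal_union
      (Set.disjoint_left.2 fun x hx hx' => (hx.out ▸ hx'.out).false) (measurableSet_norm_gt 0 c)]
    exact measureReal_mono (Set.union_subset (fun x hx => hy.2.trans_eq hx.out.symm)
      fun x hx => hy.2.trans hx)
  have hlim : Tendsto (fun y : ℝ => y ^ (-α) - c ^ (-α)) (𝓝[<] c) (𝓝 0) := by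
    have hcont : ContinuousAt (fun y : ℝ => y ^ (-α) - c ^ (-α)) c :=
      (Real.continuousAt_rpow_const c (-α) (Or.inl (by linarith))).sub continuousAt_const
    simpa using hcont.tendsto.mono_left (nhdsWithin_le_nhds (s := Set.Iio c))
  have hle : M.real {x | ‖x 0‖ = c} ≤ 0 :=
    ge_of_tendsto hlim (mem_of_superset (Ioo_mem_nhdsLT hc) hbound)
  exact (measureReal_eq_zero_iff).1 (hle.antisymm measureReal_nonneg)

lemma IsTailLaw.measure_norm_eq (h : IsTailLaw α M) (t : Site k) {c : ℝ} (hc : 0 < c) :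
    M {x | ‖x t‖ = c} = 0 := by
  have hE : MeasurableSet {x : Site k → Vec d | ‖x t‖ = c} :=
    measurableSet_eq_fun (measurable_norm_site t) measurable_const
  have hsub : {x : Site k → Vec d | ‖x t‖ = c} ⊆ {x | c / 2 < ‖x t‖} := fun x hx =>
    (half_lt_self hc).trans_eq hx.out.symm
  rw [← Set.inter_eq_left.2 hsub, h.measure_change hE t (half_pos hc)]
  refine mul_eq_zero_of_right _
    (measure_mono_null (fun x hx => ?_) (h.measure_norm_zero_eq one_lt_two))
  have hx : ‖(c / 2) • x (t - t)‖ = c := hx.1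
  rw [sub_self, norm_smul, Real.norm_of_nonneg (half_pos hc).le] at hx
  exact mul_left_cancel₀ (half_pos hc).ne' (by linarith)

/-- The direction `x / |x_0|` of a configuration. -/
noncomputable def direction (x : Site k → Vec d) : Site k → Vec d := ‖x 0‖⁻¹ • x

lemma measurable_direction : Measurable (direction : (Site k → Vec d) → _) :=
  measurable_pi_lambda _ fun t =>
    (measurable_norm_site 0).inv.smul (measurable_pi_apply t)

lemma direction_smul {c : ℝ} (hc : 0 < c) (x : Site k → Vec d) :
    direction (c • x) = direction x := by
  simp only [direction, Pi.smul_apply, norm_smul, Real.norm_of_nonneg hc.le, smul_smul, mul_inv]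
  rw [mul_comm c⁻¹, inv_mul_cancel_right₀ hc.ne']

lemma IsTailLaw.measure_norm_gt_inter_direction (h : IsTailLaw α M) (y : ℝ)
    {A : Set (Site k → Vec d)} (hA : MeasurableSet A) :
    M ({x | y < ‖x 0‖} ∩ direction ⁻¹' A) = M {x | y < ‖x 0‖} * M (direction ⁻¹' A) := by
  have := h.prob
  rcases le_or_gt 1 y with hy | hy
  · have hinv : (fun x : Site k → Vec d => y • x) ⁻¹' (direction ⁻¹' A) = direction ⁻¹' A := by
      ext x
      simp only [Set.mem_preimage, direction_smul (one_pos.trans_le hy)]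
    rw [Set.inter_comm, h.measure_scale (measurable_direction hA) hy, hinv, h.pareto y hy]
  · have hae : ∀ᵐ x ∂M, y < ‖x 0‖ := h.ae_one_lt.mono fun x hx => hy.trans hx
    rw [(mem_ae_iff_prob_eq_one (measurableSet_norm_gt 0 y)).1 hae, one_mul, Set.inter_comm]
    exact measure_inter_conull (ae_iff.1 hae)

lemma IsTailLaw.indepFun (h : IsTailLaw α M) :
    IndepFun (fun x : Site k → Vec d => ‖x 0‖) direction M := by
  have := h.prob
  rw [IndepFun_iff_Indep]
  refine IndepSets.indep (p1 := Set.preimage (fun x : Site k → Vec d => ‖x 0‖) '' Set.range Set.Ioi)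
    (p2 := {s | MeasurableSet[MeasurableSpace.comap direction inferInstance] s})
    (measurable_norm_site 0).comap_le measurable_direction.comap_le
    (isPiSystem_Ioi.comap fun x : Site k → Vec d => ‖x 0‖)
    (@MeasurableSpace.isPiSystem_measurableSet _ (MeasurableSpace.comap direction inferInstance))
    ?_ (@MeasurableSpace.generateFrom_measurableSet _
      (MeasurableSpace.comap direction inferInstance)).symm ?_
  · rw [← MeasurableSpace.comap_generateFrom, ← borel_eq_generateFrom_Ioi,
      BorelSpace.measurable_eq (α := ℝ)]
  · rw [IndepSets_iff]
    rintro _ _ ⟨_, ⟨y, rfl⟩, rfl⟩ ⟨A, hA, rfl⟩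
    exact h.measure_norm_gt_inter_direction y hA

lemma IsTailLaw.lintegral_norm_direction (h : IsTailLaw α M)
    {G : ℝ × (Site k → Vec d) → ℝ≥0∞} (hG : Measurable G) :
    ∫⁻ x, G (‖x 0‖, direction x) ∂M = ∫⁻ z, ∫⁻ x, G (‖x 0‖, direction z) ∂M ∂M := by
  have := h.prob
  have hR : Measurable fun x : Site k → Vec d => ‖x 0‖ := measurable_norm_site 0
  have hV : Measurable (direction : (Site k → Vec d) → _) := measurable_direction
  have := Measure.isProbabilityMeasure_map (μ := M) hR.aemeasurable
  have := Measure.isProbabilityMeasure_map (μ := M) hV.aemeasurable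
  rw [← lintegral_map hG (hR.prodMk hV),
    (indepFun_iff_map_prod_eq_prod_map_map hR.aemeasurable hV.aemeasurable).1 h.indepFun,
    lintegral_prod_symm _ hG.aemeasurable, lintegral_map hG.lintegral_prod_left' hV]
  exact lintegral_congr fun z =>
    lintegral_map (f := fun r => G (r, direction z)) (hG.comp measurable_prodMk_right) hR

lemma IsTailLaw.measure_mul_gt (h : IsTailLaw α M) (hα : 0 < α) (v : ℝ≥0∞) :
    M {x | 1 < ‖x 0‖ₑ * v} = min 1 (v ^ α) := by
  have := h.prob
  rcases le_or_gt 1 v with hv | hv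
  · rw [min_eq_left (ENNReal.one_le_rpow hv hα), ← mem_ae_iff_prob_eq_one
      (measurableSet_lt measurable_const ((measurable_enorm_site 0).mul_const v))]
    filter_upwards [h.ae_one_lt] with x hx
    rw [← ofReal_norm]
    exact (ENNReal.one_lt_ofReal.2 hx).trans_le (le_mul_of_one_le_right' hv)
  lift v to NNReal using hv.ne_top
  rcases eq_or_ne v 0 with rfl | hv0
  · simp [hα]
  have hvpos : (0 : ℝ) < v := by positivity
  have hv1 : (v : ℝ) < 1 := by exact_mod_cast hv
  have hset : {x : Site k → Vec d | 1 < ‖x 0‖ₑ * v} = {x | (v : ℝ)⁻¹ < ‖x 0‖} := by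
    ext x
    rw [Set.mem_ofPred_eq, Set.mem_ofPred_eq, ← ofReal_norm, ← ENNReal.ofReal_coe_nnreal,
      ← ENNReal.ofReal_mul (norm_nonneg _), ENNReal.one_lt_ofReal, inv_lt_iff_one_lt_mul₀ hvpos]
  rw [hset, h.pareto _ (one_le_inv_iff₀.2 ⟨hvpos, hv1.le⟩),
    min_eq_right (ENNReal.rpow_le_one hv.le hα.le), ← ENNReal.ofReal_coe_nnreal,
    ENNReal.ofReal_rpow_of_pos hvpos, Real.inv_rpow hvpos.le, Real.rpow_neg hvpos.le, inv_inv]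

lemma norm_smul_direction {x : Site k → Vec d} (hx : 0 < ‖x 0‖) : ‖x 0‖ • direction x = x :=
  smul_inv_smul₀ hx.ne' x

lemma IsTailLaw.setLIntegral_homogeneous (h : IsTailLaw α M) (hα : 0 < α)
    {F V : (Site k → Vec d) → ℝ≥0∞} (hF : Measurable F) (hV : Measurable V)
    (hFh : ∀ c : ℝ, 0 < c → ∀ x, F (c • x) = F x)
    (hVh : ∀ c : ℝ, 0 < c → ∀ x, V (c • x) = ENNReal.ofReal c * V x) :
    ∫⁻ x in {x | 1 < V x}, F x ∂M = ∫⁻ x, F x * min 1 (V (direction x) ^ α) ∂M := by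
  let G : ℝ × (Site k → Vec d) → ℝ≥0∞ :=
    {p | 1 < ‖p.1‖ₑ * V p.2}.indicator fun p => F p.2
  have hG : Measurable G := (hF.comp measurable_snd).indicator
    (measurableSet_lt measurable_const (measurable_fst.enorm.mul (hV.comp measurable_snd)))
  have hFdir : ∀ᵐ x ∂M, F (direction x) = F x := by
    filter_upwards [h.ae_one_lt] with x hx
    exact hFh _ (inv_pos.2 (one_pos.trans hx)) x
  calc ∫⁻ x in {x | 1 < V x}, F x ∂M = ∫⁻ x, G (‖x 0‖, direction x) ∂M := by
        rw [← lintegral_indicator (measurableSet_lt measurable_const hV)]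
        refine lintegral_congr_ae ?_
        filter_upwards [h.ae_one_lt, hFdir] with x hx hxF
        have hx0 : 0 < ‖x 0‖ := one_pos.trans hx
        have hxV : ‖‖x 0‖‖ₑ * V (direction x) = V x := by
          rw [Real.enorm_of_nonneg hx0.le, ← hVh _ hx0, norm_smul_direction hx0]
        refine indicator_congr_point ?_ hxF.symm
        change 1 < V x ↔ 1 < ‖‖x 0‖‖ₑ * V (direction x)
        rw [hxV]
    _ = ∫⁻ z, ∫⁻ x, G (‖x 0‖, direction z) ∂M ∂M := h.lintegral_norm_direction hG
    _ = ∫⁻ x, F x * min 1 (V (direction x) ^ α) ∂M := by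
        refine lintegral_congr_ae (hFdir.mono fun z hz => ?_)
        change ∫⁻ x, {x : Site k → Vec d | 1 < ‖‖x 0‖‖ₑ * V (direction z)}.indicator
          (fun _ => F (direction z)) x ∂M = _
        simp only [enorm_norm]
        rw [lintegral_indicator_const (measurableSet_lt measurable_const
          ((measurable_enorm_site 0).mul_const _)), h.measure_mul_gt hα, hz]

end TailLaw

/-! ### Anchors -/

section Exceedances

variable {k d : ℕ} {prec : Site k → Site k → Prop}

lemma isLastExceedance_shiftConf (hprec : InvariantOrder prec) {H : AddSubgroup (Site k)}
    {t : Site k} (ht : t ∈ H) (u : ℝ) (s : Site k) (x : Site k → Vec d) :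
    IsLastExceedance prec H u (shiftConf t x) s ↔ IsLastExceedance prec H u x (s - t) := by
  refine and_congr ?_ (and_congr Iff.rfl ⟨fun h v hv hpv => ?_, fun h v hv hpv => ?_⟩)
  · exact ⟨fun hs => H.sub_mem hs ht, fun hs => by simpa using H.add_mem hs ht⟩
  · simpa [shiftConf] using h (v + t) (H.add_mem hv ht) (hprec.lt_add_iff.2 hpv)
  · exact h (v - t) (H.sub_mem hv ht) (hprec.lt_add_iff.1 (by simpa using hpv))

lemma measurableSet_isLastExceedance (L : Set (Site k)) (u : ℝ) (t : Site k) :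
    MeasurableSet {x : Site k → Vec d | IsLastExceedance prec L u x t} := by
  convert (MeasurableSet.const (t ∈ L)).inter ((measurableSet_norm_gt (d := d) t u).inter
    (measurableSet_confQuiet {s | s ∈ L ∧ prec t s} u)) using 1
  ext x
  simp [IsLastExceedance]

end Exceedances

section Suprema

variable {k d : ℕ}

lemma biSup_lt_of_finite {ι : Type*} {f : ι → ℝ≥0∞} {S : Set ι} {b c : ℝ≥0∞}
    (hfin : {s | s ∈ S ∧ c < f s}.Finite) (hcb : c < b) (hS : ∀ s ∈ S, f s < b) :
    ⨆ s ∈ S, f s < b := by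
  have hle : ⨆ s ∈ S, f s ≤ c ⊔ hfin.toFinset.sup f := by
    refine iSup₂_le fun s hs => ?_
    rcases le_or_gt (f s) c with h | h
    · exact h.trans le_sup_left
    · exact le_sup_of_le_right (Finset.le_sup (hfin.mem_toFinset.2 ⟨hs, h⟩))
  refine hle.trans_lt (max_lt hcb ((Finset.sup_lt_iff (bot_le.trans_lt hcb)).2 fun s hs => ?_))
  exact hS s (hfin.mem_toFinset.1 hs).1

lemma iSup_enorm_shiftConf (S : Set (Site k)) (t : Site k) (x : Site k → Vec d) :
    ⨆ s ∈ S, ‖shiftConf t x s‖ₑ = ⨆ s ∈ shiftBack S t, ‖x s‖ₑ := by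
  refine le_antisymm (iSup₂_le fun s hs => ?_) (iSup₂_le fun s hs => ?_)
  · exact le_iSup₂_of_le (s - t) (by simpa [shiftBack] using hs) le_rfl
  · exact le_iSup₂_of_le (s + t) hs (by simp [shiftConf])

lemma iSup_enorm_smul (S : Set (Site k)) (c : ℝ) (x : Site k → Vec d) :
    ⨆ s ∈ S, ‖(c • x) s‖ₑ = ‖c‖ₑ * ⨆ s ∈ S, ‖x s‖ₑ := by
  simp only [Pi.smul_apply, enorm_smul, ENNReal.mul_iSup]

lemma measurable_biSup_enorm (S : Set (Site k)) :
    Measurable fun x : Site k → Vec d => ⨆ s ∈ S, ‖x s‖ₑ :=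
  Measurable.biSup S S.to_countable fun s _ => measurable_enorm_site s

end Suprema

section Anchor

variable {k d : ℕ} {prec : Site k → Site k → Prop} {L : Set (Site k)} {x : Site k → Vec d}
  {s t : Site k}

lemma isAnchor_shiftConf (hprec : InvariantOrder prec) {H : AddSubgroup (Site k)}
    (ht : t ∈ H) (s : Site k) (x : Site k → Vec d) :
    IsAnchor prec H (shiftConf t x) s ↔ IsAnchor prec H x (s - t) := by
  have hmem : ∀ v, v + t ∈ H ↔ v ∈ H := fun v => H.add_mem_cancel_right ht
  have hbefore : shiftBack {v | v ∈ (H : Set (Site k)) ∧ prec v s} t =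
      {v | v ∈ (H : Set (Site k)) ∧ prec v (s - t)} :=
    Set.ext fun v => and_congr (hmem v) hprec.add_lt_iff
  have hfrom : shiftBack {v | v ∈ (H : Set (Site k)) ∧ (v = s ∨ prec s v)} t =
      {v | v ∈ (H : Set (Site k)) ∧ (v = s - t ∨ prec (s - t) v)} :=
    Set.ext fun v => and_congr (hmem v) (or_congr eq_sub_iff_add_eq.symm hprec.lt_add_iff)
  rw [IsAnchor, IsAnchor, iSup_enorm_shiftConf, iSup_enorm_shiftConf, hbefore, hfrom]
  refine and_congr ?_ Iff.rfl
  rw [SetLike.mem_coe, SetLike.mem_coe, ← hmem (s - t), sub_add_cancel]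

lemma isAnchor_smul {c : ℝ} (hc : 0 < c) (L : Set (Site k)) (t : Site k) (x : Site k → Vec d) :
    IsAnchor prec L (c • x) t ↔ IsAnchor prec L x t := by
  have hc0 : ‖c‖ₑ ≠ 0 := by simpa using hc.ne'
  rw [IsAnchor, IsAnchor, iSup_enorm_smul, iSup_enorm_smul, Pi.smul_apply, enorm_smul,
    ENNReal.mul_lt_mul_iff_right hc0 enorm_ne_top, ENNReal.mul_right_inj hc0 enorm_ne_top]

lemma measurableSet_isAnchor (L : Set (Site k)) (t : Site k) :
    MeasurableSet {x : Site k → Vec d | IsAnchor prec L x t} :=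
  (MeasurableSet.const (t ∈ L)).inter
    ((measurableSet_lt (measurable_biSup_enorm _) (measurable_enorm_site t)).inter
      (measurableSet_eq_fun (measurable_enorm_site t) (measurable_biSup_enorm _)))

lemma IsAnchor.enorm_lt_of_lt (ht : IsAnchor prec L x t) (hs : s ∈ L) (hst : prec s t) :
    ‖x s‖ₑ < ‖x t‖ₑ :=
  (le_iSup₂ (f := fun s (_ : s ∈ {s | s ∈ L ∧ prec s t}) => ‖x s‖ₑ) s ⟨hs, hst⟩).trans_lt ht.2.1

lemma IsAnchor.enorm_le (hprec : InvariantOrder prec) (ht : IsAnchor prec L x t) (hs : s ∈ L) :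
    ‖x s‖ₑ ≤ ‖x t‖ₑ := by
  by_cases hst : prec s t
  · exact (ht.enorm_lt_of_lt hs hst).le
  have hts : s = t ∨ prec t s :=
    or_iff_not_imp_left.2 fun hne => (hprec.total s t hne).resolve_left hst
  exact (le_iSup₂ (f := fun s (_ : s ∈ {s | s ∈ L ∧ (s = t ∨ prec t s)}) => ‖x s‖ₑ) s
    ⟨hs, hts⟩).trans_eq ht.2.2.symm

lemma IsAnchor.iSup_eq (hprec : InvariantOrder prec) (ht : IsAnchor prec L x t) :
    ⨆ s ∈ L, ‖x s‖ₑ = ‖x t‖ₑ :=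
  le_antisymm (iSup₂_le fun _ hs => ht.enorm_le hprec hs)
    (le_iSup₂ (f := fun s (_ : s ∈ L) => ‖x s‖ₑ) t ht.1)

lemma IsAnchor.unique (hprec : InvariantOrder prec) (hs : IsAnchor prec L x s)
    (ht : IsAnchor prec L x t) : s = t := by
  by_contra hne
  rcases hprec.total s t hne with hlt | hlt
  · exact (ht.enorm_lt_of_lt hs.1 hlt).not_ge (hs.enorm_le hprec ht.1)
  · exact (hs.enorm_lt_of_lt ht.1 hlt).not_ge (ht.enorm_le hprec hs.1)

lemma exists_first_maximizer (hprec : InvariantOrder prec) {c : ℝ}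
    (hfin : {t | t ∈ L ∧ c < ‖x t‖}.Finite) (hne : ∃ t ∈ L, c < ‖x t‖) :
    ∃ t ∈ L, c < ‖x t‖ ∧ (∀ s ∈ L, ‖x s‖ ≤ ‖x t‖) ∧ ∀ s ∈ L, prec s t → ‖x s‖ < ‖x t‖ := by
  obtain ⟨m, hm, hmax⟩ := hfin.exists_maximalFor (fun t => ‖x t‖) _ hne
  have hmaxL : ∀ s ∈ L, ‖x s‖ ≤ ‖x m‖ := fun s hs => by
    rcases le_or_gt ‖x s‖ c with hsc | hsc
    · exact hsc.trans hm.2.le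
    · exact (le_total ‖x s‖ ‖x m‖).elim id (hmax ⟨hs, hsc⟩)
  obtain ⟨t, ⟨⟨htL, hct⟩, htm⟩, hfirst⟩ := hprec.exists_first
    (S := {t | (t ∈ L ∧ c < ‖x t‖) ∧ ‖x t‖ = ‖x m‖}) (hfin.subset fun s hs => hs.1) ⟨m, hm, rfl⟩
  refine ⟨t, htL, hct, fun s hs => htm ▸ hmaxL s hs, fun s hs hst => ?_⟩
  refine (htm ▸ hmaxL s hs).lt_of_ne fun hsx => ?_
  rcases hfirst s ⟨⟨hs, hsx ▸ hct⟩, hsx.trans htm⟩ with rfl | hts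
  · exact hprec.irrefl _ hst
  · exact hprec.asymm hst hts

lemma exists_isAnchor (hprec : InvariantOrder prec)
    (hfin : ∀ c : ℝ, 0 < c → {t | t ∈ L ∧ c < ‖x t‖}.Finite) (hne : ∃ t ∈ L, x t ≠ 0) :
    ∃ t, IsAnchor prec L x t := by
  obtain ⟨t₀, ht₀, hx⟩ := hne
  obtain ⟨c, hc0, hc⟩ := exists_between (norm_pos_iff.2 hx)
  obtain ⟨t, htL, hct, hmax, hfirst⟩ := exists_first_maximizer hprec (hfin c hc0) ⟨t₀, ht₀, hc⟩
  have hlt : ∀ {r s : ℝ}, 0 ≤ r → (ENNReal.ofReal r < ENNReal.ofReal s ↔ r < s) :=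
    ENNReal.ofReal_lt_ofReal_iff_of_nonneg
  refine ⟨t, htL, biSup_lt_of_finite (c := ENNReal.ofReal c) ((hfin c hc0).subset ?_) ?_ ?_,
    le_antisymm ?_ (iSup₂_le fun s hs => enorm_le_iff_norm_le.2 (hmax s hs.1))⟩
  · rintro s ⟨⟨hsL, -⟩, hcs⟩
    rw [← ofReal_norm, hlt hc0.le] at hcs
    exact ⟨hsL, hcs⟩
  · rwa [← ofReal_norm, hlt hc0.le]
  · rintro s ⟨hsL, hst⟩
    rw [← ofReal_norm, ← ofReal_norm, hlt (norm_nonneg _)]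
    exact hfirst s hsL hst
  · exact le_iSup₂ (f := fun s (_ : s ∈ {s | s ∈ L ∧ (s = t ∨ prec t s)}) => ‖x s‖ₑ) t
      ⟨htL, Or.inl rfl⟩

end Anchor

/-! ### Mass transport along a lattice -/

section Partition

variable {W ι : Type*} [MeasurableSpace W] [Countable ι] {μ : Measure W} {A : ι → Set W}

lemma lintegral_eq_tsum_of_partition (hA : ∀ i, MeasurableSet (A i))
    (hd : Pairwise (Function.onFun Disjoint A)) (hcov : ∀ᵐ w ∂μ, ∃ i, w ∈ A i) (f : W → ℝ≥0∞) :
    ∫⁻ w, f w ∂μ = ∑' i, ∫⁻ w in A i, f w ∂μ := by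
  rw [← lintegral_iUnion hA hd, ← setLIntegral_univ]
  refine setLIntegral_congr ?_
  filter_upwards [hcov] with w hw
  exact propext ⟨fun _ => Set.mem_iUnion.2 hw, fun _ => trivial⟩

lemma measure_eq_tsum_of_partition (hA : ∀ i, MeasurableSet (A i))
    (hd : Pairwise (Function.onFun Disjoint A)) (hcov : ∀ᵐ w ∂μ, ∃ i, w ∈ A i) {E : Set W}
    (hE : MeasurableSet E) : μ E = ∑' i, μ (E ∩ A i) := by
  have := lintegral_eq_tsum_of_partition hA hd hcov (E.indicator 1)
  simpa only [lintegral_indicator_one hE, Measure.restrict_apply hE] using this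

end Partition

section Selector

variable {k d : ℕ} {α : ℝ} {M : Measure (Site k → Vec d)} {prec : Site k → Site k → Prop}
  {H : AddSubgroup (Site k)} {S S' : (Site k → Vec d) → Site k → Prop}

/-- A translation covariant rule selecting, from almost every configuration, exactly one site of
the lattice `H` at which the norm exceeds `1`; `S x t` says that `t` is selected from `x`. -/
structure IsExceedanceSelector (M : Measure (Site k → Vec d)) (H : AddSubgroup (Site k))
    (S : (Site k → Vec d) → Site k → Prop) : Prop where
  measurableSet : ∀ t, MeasurableSet {x | S x t}
  covariant : ∀ t ∈ H, ∀ s x, S (shiftConf t x) s ↔ S x (s - t)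
  unique : ∀ x s t, S x s → S x t → s = t
  exceeds : ∀ᵐ x ∂M, ∀ t, S x t → 1 < ‖x t‖
  exists_mem : ∀ᵐ x ∂M, ∃ t : H, S x t

lemma IsExceedanceSelector.pairwise_disjoint (hS : IsExceedanceSelector M H S) :
    Pairwise (Function.onFun Disjoint fun t : H => {x | S x t}) := fun _ _ hst =>
  Set.disjoint_left.2 fun x hx hx' => hst (Subtype.ext (hS.unique x _ _ hx hx'))

lemma IsExceedanceSelector.shiftConf_self (hS : IsExceedanceSelector M H S) (t : H)
    (x : Site k → Vec d) : S (shiftConf t x) t ↔ S x 0 := by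
  rw [hS.covariant t t.2, sub_self]

lemma IsExceedanceSelector.shiftConf_zero (hS : IsExceedanceSelector M H S) (t : H)
    (x : Site k → Vec d) : S (shiftConf t x) 0 ↔ S x (-t) := by
  rw [hS.covariant t t.2, zero_sub]

lemma IsTailLaw.ae_of_ae_selected_zero (h : IsTailLaw α M) (hS : IsExceedanceSelector M H S)
    {p : (Site k → Vec d) → Prop} (hp : ∀ t ∈ H, ∀ x, p (shiftConf t x) → p x)
    (hzero : ∀ᵐ x ∂M, S x 0 → p x) : ∀ᵐ x ∂M, p x := by
  have hsite : ∀ᵐ x ∂M, ∀ t : H, S x t → 1 < ‖x t‖ → p x := by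
    refine ae_all_iff.2 fun t => ?_
    filter_upwards [h.ae_shift hzero (-t)] with x hx hxt hexc
    rw [neg_neg] at hx
    refine hp _ (H.neg_mem t.2) x (hx hexc ?_)
    rwa [← NegMemClass.coe_neg, hS.shiftConf_zero, NegMemClass.coe_neg, neg_neg]
  filter_upwards [hsite, hS.exceeds, hS.exists_mem] with x hx hexc ⟨t, ht⟩
  exact hx t ht (hexc t ht)

lemma IsTailLaw.setLIntegral_selected (h : IsTailLaw α M) (hS : IsExceedanceSelector M H S)
    {F : (Site k → Vec d) → ℝ≥0∞} (hF : Measurable F) (t : H) :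
    ∫⁻ x in {x | S x t}, F x ∂M =
      ∫⁻ x in {x | 1 < ‖x (-t)‖}, {x | S x 0}.indicator (fun x => F (shiftConf t x)) x ∂M := by
  have hexc : {x | S x t} =ᵐ[M] ({x | S x t} ∩ {x | 1 < ‖x t‖} : Set (Site k → Vec d)) := by
    filter_upwards [hS.exceeds] with x hx
    exact propext ⟨fun ht => ⟨ht, hx t ht⟩, And.left⟩
  rw [setLIntegral_congr hexc, ← setLIntegral_indicator (hS.measurableSet t),
    h.setLIntegral_shift (hF.indicator (hS.measurableSet t))]
  exact lintegral_congr fun x => indicator_congr_point (hS.shiftConf_self t x) rfl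

lemma IsTailLaw.measure_selected_zero_inter (h : IsTailLaw α M)
    (hS : IsExceedanceSelector M H S) (hS' : IsExceedanceSelector M H S') (t : H) :
    M ({x | S x 0} ∩ {x | S' x t}) = M ({x | S' x 0} ∩ {x | S x (-t : H)}) := by
  have hexc : ∀ᵐ x ∂M, S' x t → 1 < ‖x t‖ := hS'.exceeds.mono fun x hx => hx t
  have hexc_neg : ∀ᵐ x ∂M, S x (-t : H) → 1 < ‖x (-t)‖ := hS.exceeds.mono fun x hx => hx _
  calc M ({x | S x 0} ∩ {x | S' x t}) = M ({x | S x 0} ∩ {x | S' x t} ∩ {x | 1 < ‖x t‖}) :=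
        measure_congr (hexc.mono fun x hx => propext ⟨fun hS => ⟨hS, hx hS.2⟩, And.left⟩)
    _ = M (shiftConf t ⁻¹' ({x | S x 0} ∩ {x | S' x t}) ∩ {x | 1 < ‖x (-t)‖}) :=
        h.measure_shift ((hS.measurableSet 0).inter (hS'.measurableSet t)) t
    _ = M ({x | S' x 0} ∩ {x | S x (-t : H)}) := by
        refine measure_congr (hexc_neg.mono fun x hx => propext ?_)
        have hcov := and_congr (hS.shiftConf_zero t x) (hS'.shiftConf_self t x)
        exact ⟨fun hs => (hcov.1 hs.1).symm, fun hs => ⟨hcov.2 hs.symm, hx hs.2⟩⟩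

lemma IsTailLaw.measure_selected_zero_eq (h : IsTailLaw α M)
    (hS : IsExceedanceSelector M H S) (hS' : IsExceedanceSelector M H S') :
    M {x | S x 0} = M {x | S' x 0} := by
  calc M {x | S x 0} = ∑' t : H, M ({x | S x 0} ∩ {x | S' x t}) :=
        measure_eq_tsum_of_partition (fun t : H => hS'.measurableSet t) hS'.pairwise_disjoint
          hS'.exists_mem (hS.measurableSet 0)
    _ = ∑' t : H, M ({x | S' x 0} ∩ {x | S x (-t : H)}) :=
        tsum_congr (h.measure_selected_zero_inter hS hS')
    _ = ∑' t : H, M ({x | S' x 0} ∩ {x | S x t}) :=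
        (Equiv.neg H).tsum_eq fun t : H => M ({x | S' x 0} ∩ {x | S x t})
    _ = M {x | S' x 0} :=
        (measure_eq_tsum_of_partition (fun t : H => hS.measurableSet t) hS.pairwise_disjoint
          hS.exists_mem (hS'.measurableSet 0)).symm

lemma IsTailLaw.ae_finite_one_lt (h : IsTailLaw α M) (hS : IsExceedanceSelector M H S) :
    ∀ᵐ x ∂M, {t | t ∈ H ∧ 1 < ‖x t‖}.Finite := by
  have := h.prob
  have hsum : ∑' t : H, M ({x | S x 0} ∩ {x | 1 < ‖x t‖}) ≠ ⊤ := by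
    refine ne_top_of_le_ne_top (measure_ne_top M Set.univ) ?_
    calc ∑' t : H, M ({x | S x 0} ∩ {x | 1 < ‖x t‖})
        ≤ ∑' t : H, M {x | S x (-t : H)} := by
          refine ENNReal.tsum_le_tsum fun t => ?_
          rw [h.measure_shift (hS.measurableSet 0)]
          exact measure_mono fun x hx => (hS.shiftConf_zero t x).1 hx.1
      _ = ∑' t : H, M {x | S x t} := (Equiv.neg H).tsum_eq fun t : H => M {x | S x t}
      _ ≤ M Set.univ := tsum_measure_le_measure_univ
          (fun t => (hS.measurableSet t).nullMeasurableSet)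
          fun s t hst => (hS.pairwise_disjoint hst).aedisjoint
  refine h.ae_of_ae_selected_zero hS (fun t ht x hx => ?_) ?_
  · refine (hx.image fun s => s - t).subset fun s hs => ⟨s + t, ⟨H.add_mem hs.1 ht, ?_⟩, by simp⟩
    simpa [shiftConf] using hs.2
  · filter_upwards [ae_finite_setOfPred_mem hsum] with x hx hx0
    exact (hx.image Subtype.val).subset fun t ht => ⟨⟨t, ht.1⟩, ⟨hx0, ht.2⟩, rfl⟩

lemma IsTailLaw.ae_finite_lt (h : IsTailLaw α M) {L : Set (Site k)}
    (hone : ∀ᵐ x ∂M, {t | t ∈ L ∧ 1 < ‖x t‖}.Finite) :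
    ∀ᵐ x ∂M, ∀ c : ℝ, 0 < c → {t | t ∈ L ∧ c < ‖x t‖}.Finite := by
  have hscaled : ∀ᵐ x ∂M, ∀ n : ℕ, {t | t ∈ L ∧ 1 < ‖((n + 1 : ℝ) • x) t‖}.Finite :=
    ae_all_iff.2 fun n => h.ae_scale hone (by simp)
  filter_upwards [hscaled] with x hx c hc
  obtain ⟨n, hn⟩ := exists_nat_one_div_lt hc
  refine (hx n).subset fun t ht => ⟨ht.1, ?_⟩
  have hn0 : (0 : ℝ) < n + 1 := by positivity
  rw [Pi.smul_apply, norm_smul, Real.norm_of_nonneg hn0.le, mul_comm]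
  exact (div_lt_iff₀ hn0).1 (hn.trans ht.2)

lemma IsTailLaw.isExceedanceSelector_isLastExceedance (h : IsTailLaw α M)
    (hprec : InvariantOrder prec)
    (hfin : ∀ᵐ x ∂M, {t | t ∈ upperPart prec H ∧ 1 < ‖x t‖}.Finite) :
    IsExceedanceSelector M H (IsLastExceedance prec H 1) where
  measurableSet := measurableSet_isLastExceedance _ _
  covariant _ ht := isLastExceedance_shiftConf hprec ht 1
  unique _ _ _ := IsLastExceedance.unique hprec
  exceeds := .of_forall fun _ _ ht => ht.2.1
  exists_mem := by
    filter_upwards [hfin, h.ae_one_lt] with x hx hx0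
    obtain ⟨t, ht, hxt, hlast⟩ := exists_isLastExceedance (L := insert 0 (upperPart prec H))
      hprec ((hx.insert 0).subset fun t ht => ht.1.imp id fun h => ⟨h, ht.2⟩)
      ⟨0, Set.mem_insert _ _, hx0⟩
    have htH : t ∈ H := ht.elim (· ▸ H.zero_mem) And.left
    refine ⟨⟨t, htH⟩, htH, hxt, fun s hs hts => hlast s (Or.inr ⟨hs, ?_⟩) hts⟩
    exact ht.elim (· ▸ hts) fun h0t => hprec.trans _ _ _ h0t.2 hts

lemma IsTailLaw.ae_existsUnique_isAnchor (h : IsTailLaw α M) (hprec : InvariantOrder prec)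
    (hfin : ∀ᵐ x ∂M, {t | t ∈ upperPart prec H ∧ 1 < ‖x t‖}.Finite) :
    ∀ᵐ x ∂M, ∃! t, IsAnchor prec H x t := by
  have hlast := h.isExceedanceSelector_isLastExceedance hprec hfin
  filter_upwards [h.ae_finite_lt (h.ae_finite_one_lt hlast), h.ae_one_lt] with x hx hx0
  obtain ⟨t, ht⟩ := exists_isAnchor hprec hx
    ⟨0, H.zero_mem, norm_pos_iff.1 (one_pos.trans hx0)⟩
  exact ⟨t, ht, fun s hs => hs.unique hprec ht⟩

lemma IsTailLaw.isExceedanceSelector_isAnchor (h : IsTailLaw α M) (hprec : InvariantOrder prec)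
    (hfin : ∀ᵐ x ∂M, {t | t ∈ upperPart prec H ∧ 1 < ‖x t‖}.Finite) :
    IsExceedanceSelector M H (IsAnchor prec H) where
  measurableSet := measurableSet_isAnchor _
  covariant _ ht := isAnchor_shiftConf hprec ht
  unique _ _ _ := IsAnchor.unique hprec
  exceeds := by
    filter_upwards [h.ae_one_lt] with x hx t ht
    exact hx.trans_le (enorm_le_iff_norm_le.1 (ht.enorm_le hprec H.zero_mem))
  exists_mem := by
    filter_upwards [h.ae_existsUnique_isAnchor hprec hfin] with x ⟨t, ht, _⟩
    exact ⟨⟨t, ht.1⟩, ht⟩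

lemma IsTailLaw.measure_quiet_upperPart_eq (h : IsTailLaw α M) (hprec : InvariantOrder prec)
    (hfin : ∀ᵐ x ∂M, {t | t ∈ upperPart prec H ∧ 1 < ‖x t‖}.Finite) :
    M {x | ∀ s ∈ upperPart prec H, ‖x s‖ ≤ 1} = M {x | IsAnchor prec H x 0} := by
  rw [← h.measure_selected_zero_eq (h.isExceedanceSelector_isLastExceedance hprec hfin)
    (h.isExceedanceSelector_isAnchor hprec hfin)]
  refine measure_congr ?_
  filter_upwards [h.ae_one_lt] with x hx
  exact propext ⟨fun hq => ⟨H.zero_mem, hx, fun s hs hps => hq s ⟨hs, hps⟩⟩,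
    fun hq s hs => hq.2.2 s hs.1 hs.2⟩

end Selector

section AnchorMass

variable {k d : ℕ} {α : ℝ} {M : Measure (Site k → Vec d)} {prec : Site k → Site k → Prop}
  {H : AddSubgroup (Site k)} {x : Site k → Vec d}

lemma one_lt_enorm_iff {E : Type*} [NormedAddCommGroup E] (v : E) : 1 < ‖v‖ₑ ↔ 1 < ‖v‖ := by
  rw [← ofReal_norm, ENNReal.one_lt_ofReal]

lemma IsTailLaw.ae_ne_zero (h : IsTailLaw α M) : ∀ᵐ x ∂M, x 0 ≠ 0 :=
  h.ae_one_lt.mono fun _ hx => norm_pos_iff.1 (one_pos.trans hx)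

lemma enorm_direction (hx : x 0 ≠ 0) (t : Site k) : ‖direction x t‖ₑ = ‖x t‖ₑ / ‖x 0‖ₑ := by
  rw [direction, Pi.smul_apply, enorm_smul, enorm_inv (norm_ne_zero_iff.2 hx), enorm_norm,
    mul_comm, div_eq_mul_inv]

lemma tsum_enorm_direction_rpow (hα : 0 < α) (hx : x 0 ≠ 0) (L : Set (Site k)) :
    ∑' t : L, ‖direction x t‖ₑ ^ α = (∑' t : L, ‖x t‖ₑ ^ α) / ‖x 0‖ₑ ^ α := by
  simp only [enorm_direction hx, ENNReal.div_rpow_of_nonneg _ _ hα.le]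
  simp only [div_eq_mul_inv, ENNReal.tsum_mul_right]

lemma measurable_tsum_enorm_rpow (L : Set (Site k)) :
    Measurable fun x : Site k → Vec d => ∑' t : L, ‖x t‖ₑ ^ α :=
  Measurable.tsum fun _ => (measurable_enorm_site _).pow_const α

lemma tsum_enorm_rpow_shiftConf {t : Site k} (ht : t ∈ H) (x : Site k → Vec d) :
    ∑' s : H, ‖shiftConf t x s‖ₑ ^ α = ∑' s : H, ‖x s‖ₑ ^ α :=
  (Equiv.subRight (⟨t, ht⟩ : H)).tsum_eq fun s : H => ‖x s‖ₑ ^ α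

lemma iSup_enorm_shiftConf_of_mem {t : Site k} (ht : t ∈ H) (x : Site k → Vec d) :
    ⨆ s ∈ (H : Set (Site k)), ‖shiftConf t x s‖ₑ = ⨆ s ∈ (H : Set (Site k)), ‖x s‖ₑ := by
  rw [iSup_enorm_shiftConf]
  congr! 3 with s
  exact H.add_mem_cancel_right ht

lemma IsAnchor.enorm_direction_le_one (hprec : InvariantOrder prec) {L : Set (Site k)}
    (hx : IsAnchor prec L x 0) {t : Site k} (ht : t ∈ L) : ‖direction x t‖ₑ ≤ 1 := by
  have hx0 : x 0 ≠ 0 := enorm_pos.1 (bot_le.trans_lt hx.2.1)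
  rw [enorm_direction hx0]
  exact ENNReal.div_le_of_le_mul (by simpa using hx.enorm_le hprec ht)

lemma IsTailLaw.setLIntegral_isAnchor (h : IsTailLaw α M) (hα : 0 < α)
    (hprec : InvariantOrder prec)
    (hfin : ∀ᵐ x ∂M, {t | t ∈ upperPart prec H ∧ 1 < ‖x t‖}.Finite)
    {G : (Site k → Vec d) → ℝ≥0∞} (hG : Measurable G)
    (hGs : ∀ c : ℝ, 0 < c → ∀ x, G (c • x) = G x) (hGt : ∀ t ∈ H, ∀ x, G (shiftConf t x) = G x)
    (t : H) :
    ∫⁻ x in {x | IsAnchor prec H x t}, G x ∂M =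
      ∫⁻ x in {x | IsAnchor prec H x 0}, G x * ‖direction x (-t : H)‖ₑ ^ α ∂M := by
  have hAm : MeasurableSet {x : Site k → Vec d | IsAnchor prec H x 0} := measurableSet_isAnchor _ _
  calc ∫⁻ x in {x | IsAnchor prec H x t}, G x ∂M
      = ∫⁻ x in {x | 1 < ‖x (-t : H)‖ₑ}, {x | IsAnchor prec H x 0}.indicator G x ∂M := by
        rw [h.setLIntegral_selected (h.isExceedanceSelector_isAnchor hprec hfin) hG t]
        simp only [hGt t t.2, one_lt_enorm_iff, NegMemClass.coe_neg]
    _ = ∫⁻ x, {x | IsAnchor prec H x 0}.indicator G x *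
          min 1 (‖direction x (-t : H)‖ₑ ^ α) ∂M := by
        refine h.setLIntegral_homogeneous hα (hG.indicator hAm) (measurable_enorm_site _)
          (fun c hc x => indicator_congr_point (isAnchor_smul hc _ 0 x) (hGs c hc x))
          fun c hc x => ?_
        rw [Pi.smul_apply, enorm_smul, Real.enorm_of_nonneg hc.le]
    _ = ∫⁻ x in {x | IsAnchor prec H x 0}, G x * ‖direction x (-t : H)‖ₑ ^ α ∂M := by
        rw [← lintegral_indicator hAm]
        refine lintegral_congr fun x => ?_
        by_cases hx : x ∈ {x | IsAnchor prec H x 0}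
        · rw [Set.indicator_of_mem hx, Set.indicator_of_mem hx, min_eq_right
            (ENNReal.rpow_le_one (hx.out.enorm_direction_le_one hprec (-t).2) hα.le)]
        · rw [Set.indicator_of_notMem hx, Set.indicator_of_notMem hx, zero_mul]

lemma IsTailLaw.lintegral_eq_setLIntegral_isAnchor (h : IsTailLaw α M) (hα : 0 < α)
    (hprec : InvariantOrder prec)
    (hfin : ∀ᵐ x ∂M, {t | t ∈ upperPart prec H ∧ 1 < ‖x t‖}.Finite)
    {G : (Site k → Vec d) → ℝ≥0∞} (hG : Measurable G)
    (hGs : ∀ c : ℝ, 0 < c → ∀ x, G (c • x) = G x)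
    (hGt : ∀ t ∈ H, ∀ x, G (shiftConf t x) = G x) :
    ∫⁻ x, G x ∂M = ∫⁻ x in {x | IsAnchor prec H x 0},
      G x * ∑' t : H, ‖direction x t‖ₑ ^ α ∂M := by
  have hS := h.isExceedanceSelector_isAnchor hprec hfin
  have hterm : ∀ t : H, Measurable fun x : Site k → Vec d => ‖direction x t‖ₑ ^ α := fun t =>
    ((measurable_enorm_site _).comp measurable_direction).pow_const α
  calc ∫⁻ x, G x ∂M = ∑' t : H, ∫⁻ x in {x | IsAnchor prec H x t}, G x ∂M :=
        lintegral_eq_tsum_of_partition (fun t : H => hS.measurableSet t) hS.pairwise_disjoint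
          hS.exists_mem G
    _ = ∑' t : H, ∫⁻ x in {x | IsAnchor prec H x 0}, G x * ‖direction x (-t : H)‖ₑ ^ α ∂M :=
        tsum_congr (h.setLIntegral_isAnchor hα hprec hfin hG hGs hGt)
    _ = ∑' t : H, ∫⁻ x in {x | IsAnchor prec H x 0}, G x * ‖direction x t‖ₑ ^ α ∂M :=
        (Equiv.neg H).tsum_eq fun t : H =>
          ∫⁻ x in {x | IsAnchor prec H x 0}, G x * ‖direction x t‖ₑ ^ α ∂M
    _ = ∫⁻ x in {x | IsAnchor prec H x 0}, G x * ∑' t : H, ‖direction x t‖ₑ ^ α ∂M := by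
        rw [← lintegral_tsum (f := fun (t : H) x => G x * ‖direction x t‖ₑ ^ α)
          fun t => (hG.mul (hterm t)).aemeasurable]
        simp only [ENNReal.tsum_mul_left]

lemma IsTailLaw.ae_tsum_enorm_rpow_lt_top (h : IsTailLaw α M) (hα : 0 < α)
    (hprec : InvariantOrder prec)
    (hfin : ∀ᵐ x ∂M, {t | t ∈ upperPart prec H ∧ 1 < ‖x t‖}.Finite) :
    ∀ᵐ x ∂M, ∑' t : H, ‖x t‖ₑ ^ α < ⊤ := by
  have := h.prob
  have htotal : 1 = ∫⁻ x in {x | IsAnchor prec H x 0}, ∑' t : H, ‖direction x t‖ₑ ^ α ∂M := by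
    simpa using h.lintegral_eq_setLIntegral_isAnchor hα hprec hfin (G := 1) measurable_one
      (fun _ _ _ => rfl) fun _ _ _ => rfl
  have hdirection := (ae_restrict_iff' (measurableSet_isAnchor _ _)).1 (ae_lt_top
    ((measurable_tsum_enorm_rpow (α := α) _).comp measurable_direction)
    (htotal ▸ ENNReal.one_ne_top))
  refine h.ae_of_ae_selected_zero (h.isExceedanceSelector_isAnchor hprec hfin)
    (fun t ht x hx => by rwa [tsum_enorm_rpow_shiftConf ht] at hx) ?_
  filter_upwards [hdirection, h.ae_ne_zero] with x hx hx0 hanchor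
  refine lt_top_iff_ne_top.2 fun htop => (hx hanchor).ne ?_
  refine (tsum_enorm_direction_rpow hα hx0 (H : Set (Site k))).trans ?_
  rw [show ∑' t : (H : Set (Site k)), ‖x t‖ₑ ^ α = ⊤ from htop]
  exact ENNReal.top_div_of_ne_top (ENNReal.rpow_ne_top_of_nonneg hα.le enorm_ne_top)

lemma IsTailLaw.lintegral_sup_div_tsum (h : IsTailLaw α M) (hα : 0 < α)
    (hprec : InvariantOrder prec)
    (hfin : ∀ᵐ x ∂M, {t | t ∈ upperPart prec H ∧ 1 < ‖x t‖}.Finite) :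
    ∫⁻ x, (⨆ t ∈ (H : Set (Site k)), ‖x t‖ₑ) ^ α / ∑' t : H, ‖x t‖ₑ ^ α ∂M =
      M {x | IsAnchor prec H x 0} := by
  rw [h.lintegral_eq_setLIntegral_isAnchor hα hprec hfin, ← setLIntegral_one]
  · refine setLIntegral_congr_fun_ae (measurableSet_isAnchor _ _) ?_
    filter_upwards [h.ae_tsum_enorm_rpow_lt_top hα hprec hfin, h.ae_ne_zero] with x hx hx0 hanchor
    have hpos : ‖x 0‖ₑ ^ α ≠ 0 := by simpa [ENNReal.rpow_eq_zero_iff_of_pos hα] using hx0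
    have htop : ‖x 0‖ₑ ^ α ≠ ⊤ := ENNReal.rpow_ne_top_of_nonneg hα.le enorm_ne_top
    have hsum : ∑' t : H, ‖x t‖ₑ ^ α ≠ 0 := fun hzero => hpos (ENNReal.tsum_eq_zero.1 hzero 0)
    rw [IsAnchor.iSup_eq hprec hanchor]
    refine (congrArg _ (tsum_enorm_direction_rpow hα hx0 (H : Set (Site k)))).trans ?_
    rw [← ENNReal.inv_div (.inl htop) (.inl hpos)]
    exact ENNReal.inv_mul_cancel (ENNReal.div_ne_zero.2 ⟨hsum, htop⟩)
      (ENNReal.div_ne_top hx.ne hpos)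
  · exact ((measurable_biSup_enorm _).pow_const α).div (measurable_tsum_enorm_rpow _)
  · intro c hc x
    have hc0 : ‖c‖ₑ ^ α ≠ 0 := by simpa [ENNReal.rpow_eq_zero_iff_of_pos hα] using hc.ne'
    have hct : ‖c‖ₑ ^ α ≠ ⊤ := ENNReal.rpow_ne_top_of_nonneg hα.le enorm_ne_top
    rw [iSup_enorm_smul, ENNReal.mul_rpow_of_nonneg _ _ hα.le]
    simp only [Pi.smul_apply, enorm_smul, ENNReal.mul_rpow_of_nonneg _ _ hα.le,
      ENNReal.tsum_mul_left]
    exact ENNReal.mul_div_mul_left _ _ hc0 hct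
  · intro t ht x
    rw [iSup_enorm_shiftConf_of_mem ht, tsum_enorm_rpow_shiftConf ht]

end AnchorMass

/-! ### Stabilizers of patterns -/

lemma injOn_add_nsmul {G : Type*} [AddCommGroup G] {S : Finset G} {z g : G} {m : ℕ}
    (hsep : ∀ n, 0 < n → n < m → ∀ t ∈ S, t + n • g ∉ S) :
    Set.InjOn (fun q : G × ℕ => q.1 + (z + q.2 • g)) (S ×ˢ Finset.range m : Finset (G × ℕ)) := by
  have hne : ∀ t ∈ S, ∀ s ∈ S, ∀ i j : ℕ, i < m → j < i → t + (z + i • g) ≠ s + (z + j • g) := by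
    intro t ht s hs i j hi hji heq
    refine hsep (i - j) (by omega) (by omega) t ht ?_
    have : t + (i - j) • g = s := by
      rw [sub_nsmul _ hji.le, ← add_right_cancel_iff (a := z + j • g), ← heq]
      abel
    rwa [this]
  rintro ⟨t, i⟩ hq ⟨s, j⟩ hq' heq
  rw [Finset.mem_coe, Finset.mem_product, Finset.mem_range] at hq hq'
  rcases lt_trichotomy i j with h | rfl | h
  · exact absurd heq.symm (hne s hq'.1 t hq.1 j i hq'.2 h)
  · exact Prod.ext (add_right_cancel heq) rfl
  · exact absurd heq (hne t hq.1 s hq'.1 i j hq.2 h)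

section Stabilizer

variable {k : ℕ} {prec : Site k → Site k → Prop} {D : Set (Site k)}

lemma upperPart_pos (S : Set (Site k)) : ∀ t ∈ upperPart prec S, prec 0 t := fun _ ht => ht.2

lemma InvariantOrder.nsmul_pos (hprec : InvariantOrder prec) {g : Site k} (hg : prec 0 g) {n : ℕ}
    (hn : 0 < n) : prec 0 (n • g) := by
  induction n, hn using Nat.le_induction with
  | base => simpa using hg
  | succ n _ ih => rw [succ_nsmul]; exact hprec.add_pos ih hg

lemma mem_shiftStabilizer_iff {z : Site k} : z ∈ shiftStabilizer prec D ↔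
    z ∈ insert 0 D ∧ ∀ u, (u + z ∈ D ∧ prec 0 u) ↔ u ∈ D :=
  and_congr Iff.rfl Set.ext_iff

lemma zero_mem_shiftStabilizer (hpos : ∀ t ∈ D, prec 0 t) : 0 ∈ shiftStabilizer prec D :=
  mem_shiftStabilizer_iff.2 ⟨Set.mem_insert _ _, fun u => by
    rw [add_zero]; exact ⟨fun h => h.1, fun h => ⟨h, hpos u h⟩⟩⟩

lemma add_mem_shiftStabilizer (hprec : InvariantOrder prec) (hpos : ∀ t ∈ D, prec 0 t)
    {z w : Site k} (hz : z ∈ shiftStabilizer prec D) (hw : w ∈ shiftStabilizer prec D) :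
    z + w ∈ shiftStabilizer prec D := by
  rw [mem_shiftStabilizer_iff] at *
  obtain ⟨hz0, hz⟩ := hz
  obtain ⟨hw0, hw⟩ := hw
  have hadd_pos : ∀ u, prec 0 u → prec 0 (u + w) := fun u hu => by
    rcases hw0 with rfl | hw0
    · rwa [add_zero]
    · exact hprec.add_pos hu (hpos w hw0)
  refine ⟨?_, fun u => ?_⟩
  · rcases hz0 with rfl | hz0
    · rwa [zero_add]
    · exact Or.inr ((hw z).2 hz0).1
  · rw [add_comm z w, ← add_assoc]
    exact ⟨fun h => (hw u).1 ⟨(hz (u + w)).1 ⟨h.1, hadd_pos u h.2⟩, h.2⟩, fun h =>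
      ⟨((hz (u + w)).2 ((hw u).2 h).1).1, ((hw u).2 h).2⟩⟩

lemma nsmul_mem_shiftStabilizer (hprec : InvariantOrder prec) (hpos : ∀ t ∈ D, prec 0 t)
    {z : Site k} (hz : z ∈ shiftStabilizer prec D) (n : ℕ) : n • z ∈ shiftStabilizer prec D := by
  induction n with
  | zero => simpa using zero_mem_shiftStabilizer hpos
  | succ n ih => rw [succ_nsmul]; exact add_mem_shiftStabilizer hprec hpos ih hz

lemma add_nsmul_mem_insert (hprec : InvariantOrder prec) {z g : Site k} (hz : z ∈ insert 0 D)
    (hg : g ∈ shiftStabilizer prec (upperPart prec (shiftBack D z))) (i : ℕ) :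
    z + i • g ∈ insert 0 D := by
  rcases (nsmul_mem_shiftStabilizer hprec (upperPart_pos _) hg i).1 with h | h
  · rwa [h, add_zero]
  · exact Or.inr (by simpa [shiftBack, add_comm] using h.1)

lemma eventually_add_notMem_patternSites (hprec : InvariantOrder prec) (hpos : ∀ t ∈ D, prec 0 t)
    {g : Site k} (hg : prec 0 g) (hgD : g ∉ shiftStabilizer prec D) :
    ∀ᶠ p in atTop, ∀ L : Finset (Site k), ∀ t ∈ patternSites prec L D p,
      t + g ∉ patternSites prec L D p := by
  simp only [mem_patternSites]
  by_cases hmem : g ∈ D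
  · obtain ⟨u, hu⟩ : ∃ u, ¬ ((u + g ∈ D ∧ prec 0 u) ↔ u ∈ D) :=
      not_forall.1 fun h => hgD (mem_shiftStabilizer_iff.2 ⟨Or.inr hmem, h⟩)
    have hu0 : prec 0 u := by
      by_contra hcon
      exact hu ⟨fun h => absurd h.2 hcon, fun h => absurd (hpos u h) hcon⟩
    filter_upwards [eventually_mem_cube u, eventually_mem_cube (u + g)] with p hp hp' L t ht htg
    have hiff : u + g + t ∈ L ↔ u + g ∈ D := by
      simpa [localPattern, upperPart, shiftBack, hp', hprec.add_pos hu0 hg]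
        using Set.ext_iff.1 ht.2 (u + g)
    have hiff' : u + (t + g) ∈ L ↔ u ∈ D := by
      simpa [localPattern, upperPart, shiftBack, hp, hu0] using Set.ext_iff.1 htg.2 u
    rw [add_right_comm, add_assoc, hiff'] at hiff
    exact hu (by simp only [hu0, and_true, hiff])
  · filter_upwards [eventually_mem_cube g] with p hp L t ht htg
    refine hmem ((Set.ext_iff.1 ht.2 g).1 ⟨⟨?_, hp⟩, hg⟩).1
    simpa only [shiftBack, Set.mem_ofPred_eq, Finset.mem_coe, add_comm] using htg.1

lemma mul_patternFrequency_le_one (hprec : InvariantOrder prec) {z g : Site k}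
    (hz : z ∈ insert 0 D) (hg : g ∈ shiftStabilizer prec (upperPart prec (shiftBack D z)))
    {m p : ℕ} (hcube : ∀ i < m, z + i • g ∈ cube k p) {L : Finset (Site k)}
    (hsep : ∀ n, 0 < n → n < m → ∀ t ∈ patternSites prec L D p,
      t + n • g ∉ patternSites prec L D p) : m * patternFrequency prec L D p ≤ 1 := by
  rcases Nat.eq_zero_or_pos L.card with h0 | hL
  · simp [patternFrequency, h0]
  have hle : (patternSites prec L D p ×ˢ Finset.range m).card ≤ L.card := by
    refine Finset.card_le_card_of_injOn _ ?_ (injOn_add_nsmul (z := z) hsep)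
    rintro ⟨t, i⟩ hq
    rw [Finset.mem_coe, Finset.mem_product, Finset.mem_range] at hq
    obtain ⟨htL, hpat⟩ := mem_patternSites.1 hq.1
    rcases add_nsmul_mem_insert hprec hz hg i with h | h
    · simpa only [h, add_zero, Finset.mem_coe] using htL
    · have hmem : z + i • g ∈ localPattern prec L t p := hpat ▸ ⟨h, hcube i hq.2⟩
      simpa [shiftBack, add_comm] using hmem.1.1
  have hle' : L.card * (m * patternFrequency prec L D p) ≤ (L.card : ℝ) := by
    rw [mul_left_comm, ← card_patternSites hL, mul_comm]
    rw [Finset.card_product, Finset.card_range] at hle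
    exact_mod_cast hle
  exact (mul_le_iff_le_one_right (by exact_mod_cast hL)).1 hle'

lemma mem_shiftStabilizer_upperPart (hprec : InvariantOrder prec) (H : AddSubgroup (Site k))
    {z : Site k} : z ∈ shiftStabilizer prec (upperPart prec H) ↔ z ∈ H ∧ (z = 0 ∨ prec 0 z) := by
  rw [mem_shiftStabilizer_iff]
  constructor
  · rintro ⟨rfl | hz, -⟩
    · exact ⟨H.zero_mem, Or.inl rfl⟩
    · exact ⟨hz.1, Or.inr hz.2⟩
  · rintro ⟨hzH, hz⟩
    refine ⟨hz.imp id fun h => ⟨hzH, h⟩, fun u => ?_⟩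
    simp only [upperPart, Set.mem_ofPred_eq, SetLike.mem_coe, H.add_mem_cancel_right hzH]
    refine ⟨fun h => ⟨h.1.1, h.2⟩, fun h => ⟨⟨h.1, ?_⟩, h.2⟩⟩
    rcases hz with rfl | hz
    · rw [add_zero]
      exact h.2
    · exact hprec.add_pos h.2 hz

lemma latticeOf_upperPart (hprec : InvariantOrder prec) (H : AddSubgroup (Site k)) :
    latticeOf prec (upperPart prec H) = H := by
  ext z
  rw [latticeOf, Set.mem_ofPred_eq, mem_shiftStabilizer_upperPart hprec,
    mem_shiftStabilizer_upperPart hprec, H.neg_mem_iff, hprec.neg_pos, ← and_or_left]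
  refine ⟨And.left, fun hz => ⟨hz, ?_⟩⟩
  rcases eq_or_ne z 0 with h0 | h0
  · exact Or.inl (Or.inl h0)
  · exact (hprec.total z 0 h0).elim (fun h => Or.inr (Or.inr h)) fun h => Or.inl (Or.inr h)

lemma subset_fullPattern : D ⊆ fullPattern prec D := fun x hx =>
  ⟨x, Or.inr hx, Or.inl (by rw [sub_self]; exact zero_mem_shiftStabilizer (upperPart_pos _))⟩

end Stabilizer

section PatternLattice

variable {k : ℕ} {prec : Site k → Site k → Prop} {ι : Type*} {Λ : ℕ → Finset (Site k)}
  {D : ι → Set (Site k)} {lam : ι → ℝ}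

lemma PatternCondition.exists_nsmul_mem (hD : PatternCondition prec Λ D lam)
    (hprec : InvariantOrder prec) (j : ι) {z g : Site k} (hz : z ∈ insert 0 (D j))
    (hg : g ∈ shiftStabilizer prec (upperPart prec (shiftBack (D j) z))) (hg0 : prec 0 g) :
    ∃ n : ℕ, 0 < n ∧ n • g ∈ shiftStabilizer prec (D j) := by
  by_contra! hcon
  obtain ⟨lamp, hlamp, hlam⟩ := hD.exists_limits
  -- The sites with pattern `D j` have disjoint translates by `z + i • g`, `i < m`, all inside `Λ`.
  have hbound : ∀ m : ℕ, m * lam j ≤ 1 := by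
    intro m
    have hcube : ∀ᶠ p in atTop, ∀ i ∈ Finset.range m, z + i • g ∈ cube k p :=
      (eventually_all_finset _).2 fun i _ => eventually_mem_cube _
    have hsep : ∀ᶠ p in atTop, ∀ n ∈ Finset.Ioo 0 m, ∀ L : Finset (Site k),
        ∀ t ∈ patternSites prec L (D j) p, t + n • g ∉ patternSites prec L (D j) p :=
      (eventually_all_finset _).2 fun n hn =>
        have hn0 := (Finset.mem_Ioo.1 hn).1
        eventually_add_notMem_patternSites hprec (hD.subset_pos j) (hprec.nsmul_pos hg0 hn0)
          (hcon n hn0)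
    refine le_of_tendsto ((hlam j).const_mul (m : ℝ)) ?_
    filter_upwards [hcube, hsep] with p hcube hsep
    exact le_of_tendsto' ((hlamp j p).const_mul (m : ℝ)) fun n =>
      mul_patternFrequency_le_one hprec hz hg (fun i hi => hcube i (Finset.mem_range.2 hi))
        fun i hi him => hsep i (Finset.mem_Ioo.2 ⟨hi, him⟩) (Λ n)
  obtain ⟨m, hm⟩ := exists_nat_gt (1 / lam j)
  exact (hbound m).not_gt ((div_lt_iff₀ (hD.weight_pos j)).1 hm)

lemma PatternCondition.upperPart_fullPattern (hD : PatternCondition prec Λ D lam)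
    (hprec : InvariantOrder prec) (j : ι) : upperPart prec (fullPattern prec (D j)) = D j := by
  refine Set.Subset.antisymm ?_ fun x hx => ⟨subset_fullPattern hx, hD.subset_pos j x hx⟩
  rintro x ⟨⟨z, hz, hxz⟩, hx0⟩
  have hmem_of_pos : ∀ {y}, y ∈ insert 0 (D j) → prec 0 y → y ∈ D j := fun hy hy0 =>
    hy.resolve_left fun h => hprec.irrefl _ (h ▸ hy0)
  rcases hxz with hg | hg
  · have hmem := add_nsmul_mem_insert hprec hz hg 1
    rw [one_nsmul, add_sub_cancel] at hmem
    exact hmem_of_pos hmem hx0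
  · rw [neg_sub] at hg
    rcases hg.1 with h | h
    · exact hmem_of_pos (sub_eq_zero.1 h ▸ hz) hx0
    · -- Some multiple `n • (z - x)` is a period of `D j`, and it carries `x` into `D j`.
      obtain ⟨n, hn, hnD⟩ := hD.exists_nsmul_mem hprec j hz hg h.2
      have hsum : x + n • (z - x) = z + (n - 1) • (z - x) := by
        obtain ⟨m, rfl⟩ := Nat.exists_eq_succ_of_ne_zero hn.ne'
        rw [Nat.succ_sub_one, succ_nsmul]
        abel
      have hmem : x + n • (z - x) ∈ insert 0 (D j) :=
        hsum ▸ add_nsmul_mem_insert hprec hz hg (n - 1)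
      exact ((mem_shiftStabilizer_iff.1 hnD).2 x).1
        ⟨hmem_of_pos hmem (hprec.add_pos hx0 (hprec.nsmul_pos h.2 hn)), hx0⟩

lemma PatternCondition.exists_lattice (hD : PatternCondition prec Λ D lam)
    (hprec : InvariantOrder prec) (j : ι) (hlat : IsLattice (fullPattern prec (D j))) :
    ∃ H : AddSubgroup (Site k), fullPattern prec (D j) = H ∧ latticeOf prec (D j) = H ∧
      D j = upperPart prec H := by
  obtain ⟨H, hH⟩ := hlat
  have hupper : D j = upperPart prec H := by rw [hH, hD.upperPart_fullPattern hprec]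
  exact ⟨H, hH.symm, hupper ▸ latticeOf_upperPart hprec H, hupper⟩

end PatternLattice

/-! ### Finiteness of exceedances of the tail field -/

section FiniteExceedances

variable {k d : ℕ} {Ω : Type*} [MeasurableSpace Ω] {P : Measure Ω} [IsProbabilityMeasure P]
  {X : Site k → Ω → Vec d} {α : ℝ} {prec : Site k → Site k → Prop} {Λ : ℕ → Finset (Site k)}
  {ι : Type*} {D : ι → Set (Site k)} {lam : ι → ℝ}

lemma tendsto_measureReal_quiet_cube (M : Measure (Site k → Vec d)) [IsFiniteMeasure M]
    (A : Set (Site k)) :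
    Tendsto (fun q => M.real {x | ∀ s ∈ A ∩ cube k q, ‖x s‖ ≤ 1}) atTop
      (𝓝 (M.real {x | ∀ s ∈ A, ‖x s‖ ≤ 1})) := by
  have hset : {x : Site k → Vec d | ∀ s ∈ A, ‖x s‖ ≤ 1} =
      ⋂ q, {x | ∀ s ∈ A ∩ cube k q, ‖x s‖ ≤ 1} := by
    ext x
    simp only [Set.mem_ofPred_eq, Set.mem_iInter]
    refine ⟨fun h q s hs => h s hs.1, fun h s hs => ?_⟩
    obtain ⟨q, hq⟩ := (eventually_mem_cube s).exists
    exact h q s ⟨hs, hq⟩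
  rw [hset]
  refine (ENNReal.tendsto_toReal (measure_ne_top _ _)).comp (tendsto_measure_iInter_atTop
    (fun q => (measurableSet_confQuiet _ 1).nullMeasurableSet) ?_ ⟨0, measure_ne_top _ _⟩)
  exact fun p q hpq x hx s hs => hx s ⟨hs.1, cube_mono hpq hs.2⟩

lemma PatternCondition.eventually_nonempty_patternSites (hD : PatternCondition prec Λ D lam)
    (j : ι) : ∀ᶠ p in atTop, ∀ᶠ n in atTop, (patternSites prec (Λ n) (D j) p).Nonempty := by
  obtain ⟨lamp, hlamp, hlam⟩ := hD.exists_limits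
  filter_upwards [(hlam j).eventually_const_lt (hD.weight_pos j)] with p hp
  filter_upwards [(hlamp j p).eventually_const_lt hp] with n hn
  by_contra hempty
  rw [Finset.not_nonempty_iff_eq_empty] at hempty
  have hset : {t : Site k | t ∈ Λ n ∧ localPattern prec (Λ n) t p = D j ∩ cube k p} = ∅ :=
    Set.eq_empty_of_forall_notMem fun t ht => by simpa [hempty] using mem_patternSites.2 ht
  simp [patternFrequency, hset] at hn

lemma diff_cube_subset_farDifferences {L : Finset (Site k)} {A : Set (Site k)} {p : ℕ}
    (hne : (patternSites prec L A p).Nonempty) (l : ℕ) :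
    (A ∩ cube k p) \ cube k l ⊆ farDifferences prec l L := by
  obtain ⟨t, ht⟩ := hne
  obtain ⟨htL, hpat⟩ := mem_patternSites.1 ht
  rw [← hpat]
  exact (Set.sdiff_subset_sdiff_left (localPattern_subset_upperPart _ _ _)).trans
    (upperPart_diff_cube_subset_farDifferences htL l)

variable {M : Measure (Site k → Vec d)} [IsProbabilityMeasure M]

lemma AntiClustering.eventually_le_measureReal_quiet (hXm : ∀ t, Measurable (X t))
    (hXs : IsStationaryField P X) (hXrv : IsRegularlyVarying P X α) (hα : 0 < α)
    (hΛ : Tendsto (fun n => (Λ n).card) atTop atTop) (hD : PatternCondition prec Λ D lam)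
    {a : ℕ → ℝ} (ha : IsLevel P X Λ 1 a) {r : ℕ → ℕ} (hAC : AntiClustering P X prec Λ a r)
    (hM : ∀ A : Set (Site k), A.Finite →
      Tendsto (fun x => quietProb P X A x / tailProb P X x) atTop
        (𝓝 (M.real {x | ∀ s ∈ A, ‖x s‖ ≤ 1}))) (j : ι) {ε : ℝ} (hε : 0 < ε) :
    ∀ᶠ l in atTop, 1 - ε ≤ M.real {x | ∀ s ∈ D j \ cube k l, ‖x s‖ ≤ 1} := by
  filter_upwards [hAC.eventually_loudProb_le hXm hXs hXrv hα hΛ ha one_pos ha hε] with l hl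
  refine ge_of_tendsto (tendsto_measureReal_quiet_cube M (D j \ cube k l)) ?_
  filter_upwards [hD.eventually_nonempty_patternSites j] with q hq
  refine ge_of_tendsto ((hM _ ((cube_finite k q).inter_of_right _)).comp
    (ha.tendsto_atTop hXm hXrv hΛ)) ?_
  filter_upwards [hl, hAC.tendsto_r.eventually hq] with n hloud hne
  have hsub : (D j \ cube k l) ∩ cube k q ⊆ farDifferences prec l (Λ (r n)) := by
    rw [← Set.inter_sdiff_right_comm]
    exact diff_cube_subset_farDifferences hne l
  rw [Function.comp_apply, le_div_iff₀ (tailProb_pos hXm hXrv (a n))]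
  have hsplit := quietProb_add_loudProb (P := P) hXm ((D j \ cube k l) ∩ cube k q) (a n)
  have hmono := loudProb_mono (P := P) (X := X) hsub (a n)
  linarith

lemma AntiClustering.ae_finite_pattern (hXm : ∀ t, Measurable (X t))
    (hXs : IsStationaryField P X) (hXrv : IsRegularlyVarying P X α) (hα : 0 < α)
    (hΛ : Tendsto (fun n => (Λ n).card) atTop atTop) (hD : PatternCondition prec Λ D lam)
    {a : ℕ → ℝ} (ha : IsLevel P X Λ 1 a) {r : ℕ → ℕ} (hAC : AntiClustering P X prec Λ a r)
    (hM : ∀ A : Set (Site k), A.Finite →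
      Tendsto (fun x => quietProb P X A x / tailProb P X x) atTop
        (𝓝 (M.real {x | ∀ s ∈ A, ‖x s‖ ≤ 1}))) (j : ι) :
    ∀ᵐ x ∂M, {t | t ∈ D j ∧ 1 < ‖x t‖}.Finite := by
  have hinfinite_subset : ∀ l, {x : Site k → Vec d | ¬ {t | t ∈ D j ∧ 1 < ‖x t‖}.Finite} ⊆
      {x | ∀ s ∈ D j \ cube k l, ‖x s‖ ≤ 1}ᶜ := fun l x hx hquiet =>
    hx.out ((cube_finite k l).subset fun t ht => by
      by_contra hcon
      exact (hquiet t ⟨ht.1, hcon⟩).not_gt ht.2)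
  have hle : ∀ ε : ℝ, 0 < ε → M.real {x | ¬ {t | t ∈ D j ∧ 1 < ‖x t‖}.Finite} ≤ ε := by
    intro ε hε
    obtain ⟨l, hl⟩ :=
      (hAC.eventually_le_measureReal_quiet hXm hXs hXrv hα hΛ hD ha hM j hε).exists
    have hcompl := probReal_compl_eq_one_sub (μ := M) (measurableSet_confQuiet (D j \ cube k l) 1)
    exact (measureReal_mono (hinfinite_subset l)).trans (by linarith)
  rw [ae_iff, ← measureReal_eq_zero_iff]
  exact le_antisymm (le_of_forall_pos_le_add fun ε hε => by simpa using hle ε hε) measureReal_nonneg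

end FiniteExceedances

/-! ### Representations by the spectral field -/

section Direction

variable {k d : ℕ} {α : ℝ} {M : Measure (Site k → Vec d)} {prec : Site k → Site k → Prop}
  {x : Site k → Vec d}

lemma iSup_rpow {ι : Type*} (hα : 0 < α) (S : Set ι) (f : ι → ℝ≥0∞) :
    ⨆ t ∈ S, f t ^ α = (⨆ t ∈ S, f t) ^ α :=
  ((ENNReal.orderIsoRpow α hα).map_iSup₂ fun t (_ : t ∈ S) => f t).symm

lemma enorm_direction_zero (hx : x 0 ≠ 0) : ‖direction x 0‖ₑ = 1 := by
  rw [enorm_direction hx, ENNReal.div_self (by simpa using hx) enorm_ne_top]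

lemma iSup_enorm_direction (hx : x 0 ≠ 0) (S : Set (Site k)) :
    ⨆ t ∈ S, ‖direction x t‖ₑ = (⨆ t ∈ S, ‖x t‖ₑ) / ‖x 0‖ₑ := by
  simp only [enorm_direction hx, div_eq_mul_inv, ENNReal.iSup_mul]

lemma iSup_div_tsum_direction (hα : 0 < α) (hx : x 0 ≠ 0) (S : Set (Site k)) :
    (⨆ t ∈ S, ‖direction x t‖ₑ ^ α) / ∑' t : S, ‖direction x t‖ₑ ^ α =
      (⨆ t ∈ S, ‖x t‖ₑ) ^ α / ∑' t : S, ‖x t‖ₑ ^ α := by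
  have h0 : ‖x 0‖ₑ ^ α ≠ 0 := by simpa [ENNReal.rpow_eq_zero_iff_of_pos hα] using hx
  have htop : ‖x 0‖ₑ ^ α ≠ ⊤ := ENNReal.rpow_ne_top_of_nonneg hα.le enorm_ne_top
  rw [iSup_rpow hα, iSup_enorm_direction hx, ENNReal.div_rpow_of_nonneg _ _ hα.le,
    tsum_enorm_direction_rpow hα hx, div_eq_mul_inv, div_eq_mul_inv _ (‖x 0‖ₑ ^ α)]
  exact ENNReal.mul_div_mul_right _ _ (ENNReal.inv_ne_zero.2 htop) (ENNReal.inv_ne_top.2 h0)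

lemma isAnchor_direction_iff (hx : x 0 ≠ 0) (L : Set (Site k)) (t : Site k) :
    IsAnchor prec L (direction x) t ↔ IsAnchor prec L x t :=
  isAnchor_smul (inv_pos.2 (norm_pos_iff.2 hx)) L t x

lemma spectralField_eq_direction {Ω' : Type*} (Y : Site k → Ω' → Vec d) (ω : Ω') :
    spectralField Y ω = direction fun t => Y t ω := rfl

lemma summable_norm_direction {S : Set (Site k)} (hx : ∑' t : S, ‖x t‖ₑ ^ α < ⊤) :
    Summable fun t : S => ‖direction x t‖ ^ α := by
  refine ((ENNReal.summable_toReal hx.ne).mul_left (‖‖x 0‖⁻¹‖ ^ α)).congr fun t => ?_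
  rw [direction, Pi.smul_apply, norm_smul, Real.mul_rpow (norm_nonneg _) (norm_nonneg _),
    ← ENNReal.toReal_rpow, toReal_enorm]

lemma tsum_enorm_rpow_eq_ofReal_tsum {S : Set (Site k)} (hα : 0 < α)
    (hs : Summable fun t : S => ‖x t‖ ^ α) :
    ∑' t : S, ‖x t‖ₑ ^ α = ENNReal.ofReal (∑' t : S, ‖x t‖ ^ α) := by
  rw [ENNReal.ofReal_tsum_of_nonneg (fun t => by positivity) hs]
  exact tsum_congr fun t => by
    rw [← ofReal_norm, ENNReal.ofReal_rpow_of_nonneg (norm_nonneg _) hα.le]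

lemma iSup_enorm_spectralCluster {S : Set (Site k)} (hα : 0 < α) (h0 : 0 ∈ S) (hx : x 0 ≠ 0)
    (hs : Summable fun t : S => ‖x t‖ ^ α) :
    ⨆ t ∈ S, ‖spectralCluster S α x t‖ₑ ^ α =
      (⨆ t ∈ S, ‖x t‖ₑ ^ α) / ∑' t : S, ‖x t‖ₑ ^ α := by
  have hpos : 0 < ∑' t : S, ‖x t‖ ^ α :=
    hs.tsum_pos (fun t => by positivity) ⟨0, h0⟩ (Real.rpow_pos_of_pos (norm_pos_iff.2 hx) _)
  have hc : 0 < clusterNorm S α x := Real.rpow_pos_of_pos hpos _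
  have hscale : ‖(clusterNorm S α x)⁻¹‖ₑ ^ α = (∑' t : S, ‖x t‖ₑ ^ α)⁻¹ := by
    rw [tsum_enorm_rpow_eq_ofReal_tsum hα hs, Real.enorm_of_nonneg (inv_pos.2 hc).le,
      ENNReal.ofReal_inv_of_pos hc, ENNReal.inv_rpow, ENNReal.ofReal_rpow_of_pos hc, clusterNorm,
      ← Real.rpow_mul hpos.le, one_div_mul_cancel hα.ne', Real.rpow_one]
  simp only [spectralCluster, enorm_smul, ENNReal.mul_rpow_of_nonneg _ _ hα.le, hscale]
  rw [div_eq_mul_inv, mul_comm]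
  simp only [ENNReal.mul_iSup]

lemma iSup_enorm_le_one_iff (D : Set (Site k)) (x : Site k → Vec d) :
    ⨆ t ∈ D, ‖x t‖ₑ ≤ 1 ↔ ∀ t ∈ D, ‖x t‖ ≤ 1 := by
  rw [iSup₂_le_iff]
  exact forall₂_congr fun t _ => by rw [← not_lt, one_lt_enorm_iff, not_lt]

lemma IsTailLaw.ae_iSup_direction_lt_top (h : IsTailLaw α M) {D : Set (Site k)}
    (hfin : ∀ᵐ x ∂M, {t | t ∈ D ∧ 1 < ‖x t‖}.Finite) :
    ∀ᵐ x ∂M, ⨆ t ∈ D, ‖direction x t‖ₑ < ⊤ := by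
  filter_upwards [hfin, h.ae_ne_zero] with x hx hx0
  rw [iSup_enorm_direction hx0]
  refine ENNReal.div_lt_top (ne_of_lt ?_) (by simpa using hx0)
  exact biSup_lt_of_finite (c := 1) (by simpa only [one_lt_enorm_iff] using hx) ENNReal.one_lt_top
    fun _ _ => enorm_lt_top

lemma IsTailLaw.lintegral_iSup_sub_iSup (h : IsTailLaw α M) (hα : 0 < α) (D : Set (Site k)) :
    ∫⁻ x, ((⨆ t ∈ insert 0 D, ‖direction x t‖ₑ ^ α) - ⨆ t ∈ D, ‖direction x t‖ₑ ^ α) ∂M =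
      M {x | ∀ t ∈ D, ‖x t‖ ≤ 1} := by
  have := h.prob
  have hV : Measurable fun x : Site k → Vec d => ⨆ t ∈ D, ‖x t‖ₑ := measurable_biSup_enorm D
  have hloud : M {x | 1 < ⨆ t ∈ D, ‖x t‖ₑ} =
      ∫⁻ x, min 1 ((⨆ t ∈ D, ‖direction x t‖ₑ) ^ α) ∂M := by
    simpa using h.setLIntegral_homogeneous hα (F := 1) measurable_one hV (fun _ _ _ => rfl)
      fun c hc x => by rw [iSup_enorm_smul, Real.enorm_of_nonneg hc.le]
  have hquiet : {x : Site k → Vec d | ∀ t ∈ D, ‖x t‖ ≤ 1} = {x | 1 < ⨆ t ∈ D, ‖x t‖ₑ}ᶜ := by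
    ext x
    simp only [Set.mem_ofPred_eq, Set.mem_compl_iff, not_lt, iSup_enorm_le_one_iff]
  have hsub : ∫⁻ x, (1 - min 1 ((⨆ t ∈ D, ‖direction x t‖ₑ) ^ α)) ∂M =
      1 - ∫⁻ x, min 1 ((⨆ t ∈ D, ‖direction x t‖ₑ) ^ α) ∂M := by
    refine (lintegral_sub (measurable_const.min ((hV.comp measurable_direction).pow_const α))
      (hloud ▸ measure_ne_top _ _) (.of_forall fun x => min_le_left _ _)).trans ?_
    rw [lintegral_const, measure_univ, one_mul]
    rfl
  rw [hquiet, prob_compl_eq_one_sub (measurableSet_lt measurable_const hV), hloud, ← hsub]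
  refine lintegral_congr_ae ?_
  filter_upwards [h.ae_ne_zero] with x hx
  rw [iSup_insert, enorm_direction_zero hx, ENNReal.one_rpow, iSup_rpow hα]
  rcases le_total ((⨆ t ∈ D, ‖direction x t‖ₑ) ^ α) 1 with hle | hle
  · rw [sup_eq_left.2 hle, min_eq_right hle]
  · rw [sup_eq_right.2 hle, min_eq_left hle, tsub_self, tsub_self]

end Direction

section TailFieldRepresentations

variable {k d : ℕ} {α : ℝ} {prec : Site k → Site k → Prop} {Ω' : Type*} [MeasurableSpace Ω']
  {P' : Measure Ω'} {Y : Site k → Ω' → Vec d}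

lemma ae_of_ae_fieldLaw (hYm : ∀ t, Measurable (Y t)) {p : (Site k → Vec d) → Prop}
    (hp : ∀ᵐ x ∂(fieldLaw P' Y), p x) : ∀ᵐ ω ∂P', p fun t => Y t ω :=
  ae_of_ae_map (measurable_pi_lambda _ hYm).aemeasurable hp

lemma IsTailLaw.ae_apply_zero_ne_zero (h : IsTailLaw α (fieldLaw P' Y))
    (hYm : ∀ t, Measurable (Y t)) : ∀ᵐ ω ∂P', Y 0 ω ≠ 0 :=
  ae_of_ae_fieldLaw (p := fun x => x 0 ≠ 0) hYm h.ae_ne_zero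

lemma fieldLaw_apply (hYm : ∀ t, Measurable (Y t)) {S : Set (Site k → Vec d)}
    (hS : MeasurableSet S) : fieldLaw P' Y S = P' {ω | (fun t => Y t ω) ∈ S} :=
  Measure.map_apply (measurable_pi_lambda _ hYm) hS

lemma lintegral_fieldLaw (hYm : ∀ t, Measurable (Y t)) {F : (Site k → Vec d) → ℝ≥0∞}
    (hF : Measurable F) : ∫⁻ x, F x ∂(fieldLaw P' Y) = ∫⁻ ω, F (fun t => Y t ω) ∂P' :=
  lintegral_map hF (measurable_pi_lambda _ hYm)

lemma IsTailLaw.ae_iSup_spectralField_lt_top (h : IsTailLaw α (fieldLaw P' Y))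
    (hYm : ∀ t, Measurable (Y t)) {D : Set (Site k)}
    (hfin : ∀ᵐ x ∂(fieldLaw P' Y), {t | t ∈ D ∧ 1 < ‖x t‖}.Finite) :
    ∀ᵐ ω ∂P', ⨆ t ∈ D, ‖spectralField Y ω t‖ₑ < ⊤ :=
  ae_of_ae_fieldLaw (p := fun x => ⨆ t ∈ D, ‖direction x t‖ₑ < ⊤) hYm
    (h.ae_iSup_direction_lt_top hfin)

lemma IsTailLaw.measure_mul_iSup_spectralField_le (h : IsTailLaw α (fieldLaw P' Y))
    (hYm : ∀ t, Measurable (Y t)) (D : Set (Site k)) :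
    P' {ω | ‖Y 0 ω‖ₑ * (⨆ t ∈ D, ‖spectralField Y ω t‖ₑ) ≤ 1} =
      fieldLaw P' Y {x | ∀ t ∈ D, ‖x t‖ ≤ 1} := by
  rw [fieldLaw_apply hYm (measurableSet_confQuiet D 1)]
  refine measure_congr ?_
  filter_upwards [h.ae_apply_zero_ne_zero hYm] with ω hω
  have hcancel : ‖Y 0 ω‖ₑ * (⨆ t ∈ D, ‖spectralField Y ω t‖ₑ) = ⨆ t ∈ D, ‖Y t ω‖ₑ := by
    rw [spectralField_eq_direction, iSup_enorm_direction (x := fun t => Y t ω) hω,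
      ENNReal.mul_div_cancel (by simpa using hω) enorm_ne_top]
  exact propext ((iff_of_eq (congrArg (· ≤ 1) hcancel)).trans
    (iSup_enorm_le_one_iff D fun t => Y t ω))

lemma IsTailLaw.lintegral_iSup_sub_iSup_spectralField (h : IsTailLaw α (fieldLaw P' Y))
    (hYm : ∀ t, Measurable (Y t)) (hα : 0 < α) (D : Set (Site k)) :
    ∫⁻ ω, ((⨆ t ∈ insert 0 D, ‖spectralField Y ω t‖ₑ ^ α) -
      ⨆ t ∈ D, ‖spectralField Y ω t‖ₑ ^ α) ∂P' = fieldLaw P' Y {x | ∀ t ∈ D, ‖x t‖ ≤ 1} := by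
  have hsup : ∀ S : Set (Site k), Measurable fun x : Site k → Vec d =>
      ⨆ t ∈ S, ‖direction x t‖ₑ ^ α := fun S => by
    simp only [iSup_rpow hα]
    exact ((measurable_biSup_enorm S).comp measurable_direction).pow_const α
  exact (lintegral_fieldLaw hYm ((hsup (insert 0 D)).sub (hsup D))).symm.trans
    (h.lintegral_iSup_sub_iSup hα D)

variable {H : AddSubgroup (Site k)}

lemma IsTailLaw.ae_summable_spectralField (h : IsTailLaw α (fieldLaw P' Y))
    (hYm : ∀ t, Measurable (Y t)) (hα : 0 < α) (hprec : InvariantOrder prec)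
    (hfin : ∀ᵐ x ∂(fieldLaw P' Y), {t | t ∈ upperPart prec H ∧ 1 < ‖x t‖}.Finite) :
    ∀ᵐ ω ∂P', Summable fun t : (H : Set (Site k)) => ‖spectralField Y ω t‖ ^ α :=
  ae_of_ae_fieldLaw (p := fun x => Summable fun t : (H : Set (Site k)) => ‖direction x t‖ ^ α) hYm
    ((h.ae_tsum_enorm_rpow_lt_top hα hprec hfin).mono fun _ => summable_norm_direction)

lemma IsTailLaw.ae_existsUnique_isAnchor_spectralField (h : IsTailLaw α (fieldLaw P' Y))
    (hYm : ∀ t, Measurable (Y t)) (hprec : InvariantOrder prec)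
    (hfin : ∀ᵐ x ∂(fieldLaw P' Y), {t | t ∈ upperPart prec H ∧ 1 < ‖x t‖}.Finite) :
    ∀ᵐ ω ∂P', ∃! t, IsAnchor prec H (spectralField Y ω) t := by
  refine ae_of_ae_fieldLaw (p := fun x => ∃! t, IsAnchor prec H (direction x) t) hYm ?_
  filter_upwards [h.ae_existsUnique_isAnchor hprec hfin, h.ae_ne_zero] with x hx hx0
  simpa only [isAnchor_direction_iff hx0] using hx

lemma IsTailLaw.lintegral_iSup_div_tsum_spectralField (h : IsTailLaw α (fieldLaw P' Y))
    (hYm : ∀ t, Measurable (Y t)) (hα : 0 < α) (hprec : InvariantOrder prec)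
    (hfin : ∀ᵐ x ∂(fieldLaw P' Y), {t | t ∈ upperPart prec H ∧ 1 < ‖x t‖}.Finite) :
    ∫⁻ ω, ((⨆ t ∈ (H : Set (Site k)), ‖spectralField Y ω t‖ₑ ^ α) /
      ∑' s : (H : Set (Site k)), ‖spectralField Y ω s‖ₑ ^ α) ∂P' =
      fieldLaw P' Y {x | ∀ t ∈ upperPart prec H, ‖x t‖ ≤ 1} := by
  rw [h.measure_quiet_upperPart_eq hprec hfin, ← h.lintegral_sup_div_tsum hα hprec hfin]
  refine Eq.trans (lintegral_congr_ae ?_) (lintegral_fieldLaw hYm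
    (((measurable_biSup_enorm (H : Set (Site k))).pow_const α).div
      (measurable_tsum_enorm_rpow (H : Set (Site k))))).symm
  filter_upwards [h.ae_apply_zero_ne_zero hYm] with ω hω
  exact iSup_div_tsum_direction (x := fun t => Y t ω) hα hω _

lemma IsTailLaw.lintegral_iSup_spectralCluster (h : IsTailLaw α (fieldLaw P' Y))
    (hYm : ∀ t, Measurable (Y t)) (hα : 0 < α) (hprec : InvariantOrder prec)
    (hfin : ∀ᵐ x ∂(fieldLaw P' Y), {t | t ∈ upperPart prec H ∧ 1 < ‖x t‖}.Finite) :
    ∫⁻ ω, (⨆ t ∈ (H : Set (Site k)), ‖spectralCluster H α (spectralField Y ω) t‖ₑ ^ α) ∂P' =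
      fieldLaw P' Y {x | ∀ t ∈ upperPart prec H, ‖x t‖ ≤ 1} := by
  rw [← h.lintegral_iSup_div_tsum_spectralField hYm hα hprec hfin]
  refine lintegral_congr_ae ?_
  filter_upwards [h.ae_summable_spectralField hYm hα hprec hfin,
    h.ae_apply_zero_ne_zero hYm] with ω hsum hω
  refine iSup_enorm_spectralCluster hα H.zero_mem (enorm_ne_zero.1 ?_) hsum
  rw [spectralField_eq_direction, enorm_direction_zero (x := fun t => Y t ω) hω]
  exact one_ne_zero

lemma IsTailLaw.lintegral_indicator_isAnchor_spectralField (h : IsTailLaw α (fieldLaw P' Y))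
    (hYm : ∀ t, Measurable (Y t)) (hprec : InvariantOrder prec)
    (hfin : ∀ᵐ x ∂(fieldLaw P' Y), {t | t ∈ upperPart prec H ∧ 1 < ‖x t‖}.Finite) :
    ∫⁻ ω, Set.indicator {ω | IsAnchor prec H (spectralField Y ω) 0}
      (fun ω => ‖spectralField Y ω 0‖ₑ ^ α) ω ∂P' =
      fieldLaw P' Y {x | ∀ t ∈ upperPart prec H, ‖x t‖ ≤ 1} := by
  rw [h.measure_quiet_upperPart_eq hprec hfin,
    ← lintegral_indicator_one (measurableSet_isAnchor _ _),
    lintegral_fieldLaw hYm (measurable_one.indicator (measurableSet_isAnchor _ _))]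
  refine lintegral_congr_ae ?_
  filter_upwards [h.ae_apply_zero_ne_zero hYm] with ω hω
  refine indicator_congr_point (isAnchor_direction_iff (x := fun t => Y t ω) hω _ _) ?_
  rw [spectralField_eq_direction, enorm_direction_zero (x := fun t => Y t ω) hω,
    ENNReal.one_rpow, Pi.one_apply]

lemma tsum_ofReal_mul_measure_quiet {ι : Type*} {D : ι → Set (Site k)} {lam π : ι → ℝ} {θ : ℝ}
    {M : Measure (Site k → Vec d)} [IsProbabilityMeasure M] {ρ : Set (Site k) → ℝ}
    (hρ : ∀ A : Set (Site k), A.Finite → ρ A = M.real {x | ∀ s ∈ A, ‖x s‖ ≤ 1})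
    (hlam : ∀ j, 0 ≤ lam j)
    (hπ : ∀ j, Tendsto (fun p => ρ (D j ∩ cube k p)) atTop (𝓝 (π j)))
    (hsum : HasSum (fun j => lam j * π j) θ) :
    ∑' j, ENNReal.ofReal (lam j) * M {x | ∀ t ∈ D j, ‖x t‖ ≤ 1} = ENNReal.ofReal θ := by
  have hπ_eq : ∀ j, π j = M.real {x | ∀ t ∈ D j, ‖x t‖ ≤ 1} := fun j =>
    tendsto_nhds_unique (hπ j) ((tendsto_measureReal_quiet_cube M (D j)).congr fun p =>
      (hρ _ ((cube_finite k p).inter_of_right _)).symm)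
  simp only [hπ_eq] at hsum
  rw [← hsum.tsum_eq, ENNReal.ofReal_tsum_of_nonneg
    (fun j => mul_nonneg (hlam j) measureReal_nonneg) hsum.summable]
  exact tsum_congr fun j => by rw [ENNReal.ofReal_mul (hlam j), ofReal_measureReal]

end TailFieldRepresentations

end ExtremalField

theorem theorem5p1 {k d : ℕ} {Ω : Type*} [MeasurableSpace Ω] (P : Measure Ω)
    [IsProbabilityMeasure P] (X : Site k → Ω → Vec d) (hXm : ∀ t, Measurable (X t))
    (α : ℝ) (hα : 0 < α) (hXs : IsStationaryField P X) (hXrv : IsRegularlyVarying P X α)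
    (prec : Site k → Site k → Prop) (hprec : InvariantOrder prec)
    (Λ : ℕ → Finset (Site k)) (hΛ : Tendsto (fun n => (Λ n).card) atTop atTop)
    {ι : Type*} [Countable ι] (D : ι → Set (Site k)) (lam : ι → ℝ)
    (hD : PatternCondition prec Λ D lam)
    (a : ℕ → ℝ) (ha : IsLevel P X Λ 1 a)
    (r : ℕ → ℕ) (hAC : AntiClustering P X prec Λ a r) :
    ∃ θ : ℝ, 0 < θ ∧ IsBlockExtremalIndex P X Λ r θ ∧
      -- the representations, for the tail field `Y` of `X` and `Θ = Y / |Y_0|`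
      (∀ (Ω' : Type*) [MeasurableSpace Ω'] (P' : Measure Ω') [IsProbabilityMeasure P']
        (Y : Site k → Ω' → Vec d), IsTailField P X α P' Y →
        (∀ j, ∀ᵐ ω ∂P', (⨆ t ∈ D j, ‖spectralField Y ω t‖ₑ) < ⊤) ∧
        ∑' j, ENNReal.ofReal (lam j) *
            P' {ω | ‖Y 0 ω‖ₑ * (⨆ t ∈ D j, ‖spectralField Y ω t‖ₑ) ≤ 1}
          = ENNReal.ofReal θ ∧
        ∑' j, ENNReal.ofReal (lam j) *
            ∫⁻ ω, ((⨆ t ∈ insert 0 (D j), ‖spectralField Y ω t‖ₑ ^ α)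
              - ⨆ t ∈ D j, ‖spectralField Y ω t‖ₑ ^ α) ∂P'
          = ENNReal.ofReal θ ∧
        -- the further representations in the lattice case
        ((∀ j, IsLattice (fullPattern prec (D j))) →
          (∀ j, ∀ᵐ ω ∂P',
            Summable (fun t : fullPattern prec (D j) => ‖spectralField Y ω t‖ ^ α) ∧
            ∃! t, IsAnchor prec (latticeOf prec (D j)) (spectralField Y ω) t) ∧
          ∑' j, ENNReal.ofReal (lam j) *
              ∫⁻ ω, (⨆ t ∈ fullPattern prec (D j),
                ‖spectralCluster (fullPattern prec (D j)) α (spectralField Y ω) t‖ₑ ^ α) ∂P'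
            = ENNReal.ofReal θ ∧
          ∑' j, ENNReal.ofReal (lam j) *
              ∫⁻ ω, ((⨆ t ∈ fullPattern prec (D j), ‖spectralField Y ω t‖ₑ ^ α)
                / ∑' s : fullPattern prec (D j), ‖spectralField Y ω s‖ₑ ^ α) ∂P'
            = ENNReal.ofReal θ ∧
          ∑' j, ENNReal.ofReal (lam j) *
              ∫⁻ ω, Set.indicator
                {ω | IsAnchor prec (latticeOf prec (D j)) (spectralField Y ω) 0}
                (fun ω => ‖spectralField Y ω 0‖ₑ ^ α) ω ∂P'
            = ENNReal.ofReal θ)) ∧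
      -- the extremal index under the mixing condition
      (MaxMixing P X Λ a r → IsExtremalIndex P X Λ θ) := by
  choose! ρ hρ using fun (A : Set (Site k)) (hA : A.Finite) =>
    exists_tendsto_quietProb hXm hXs hXrv hA
  obtain ⟨π, θ, hπ, hsum, hθ0, hθ1, hlim⟩ :=
    exists_blockExtremalIndex hXm hα hXs hXrv hprec hΛ hD ha hAC hρ
  have hlevel := fun τ (hτ : 0 < τ) => exists_isLevel hXm hXs hXrv hα hΛ ha hτ
  refine ⟨θ, hθ0, fun τ hτ => ⟨(hlevel τ hτ).elim fun _ hc => ⟨_, hc.2⟩, hlim τ hτ⟩,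
    fun Ω' _ P' _ Y hY => ?_, fun hmix => hmix.isExtremalIndex hXm hα hXs hXrv hΛ ha
      hAC.tendsto_r hAC.tendsto_blockCount ⟨hθ0.le, hθ1⟩ hlim⟩
  have hYm := hY.measurable
  have hlaw := hY.isTailLaw hXm hXs hXrv
  have := hlaw.prob
  have hquiet := fun (A : Set (Site k)) (hA : A.Finite) =>
    hY.tendsto_quietProb hXm hXrv (fun t => hlaw.measure_norm_eq t one_pos) hA
  have hfin := hAC.ae_finite_pattern hXm hXs hXrv hα hΛ hD ha hquiet
  have htsum := tsum_ofReal_mul_measure_quiet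
    (fun A hA => tendsto_nhds_unique (hρ A hA) (hquiet A hA)) (fun j => (hD.weight_pos j).le)
    hπ hsum
  refine ⟨fun j => hlaw.ae_iSup_spectralField_lt_top hYm (hfin j),
    by simpa only [hlaw.measure_mul_iSup_spectralField_le hYm] using htsum,
    by simpa only [hlaw.lintegral_iSup_sub_iSup_spectralField hYm hα] using htsum, fun hlat => ?_⟩
  choose H hfull hlattice hupper using fun j => hD.exists_lattice hprec j (hlat j)
  simp only [hupper] at hfin htsum
  refine ⟨fun j => ?_, (tsum_congr fun j => ?_).trans htsum, (tsum_congr fun j => ?_).trans htsum,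
    (tsum_congr fun j => ?_).trans htsum⟩
  · rw [hfull j, hlattice j]
    exact (hlaw.ae_summable_spectralField hYm hα hprec (hfin j)).and
      (hlaw.ae_existsUnique_isAnchor_spectralField hYm hprec (hfin j))
  · rw [hfull j, hlaw.lintegral_iSup_spectralCluster hYm hα hprec (hfin j)]
  · rw [hfull j, hlaw.lintegral_iSup_div_tsum_spectralField hYm hα hprec (hfin j)]
  · rw [hlattice j, hlaw.lintegral_indicator_isAnchor_spectralField hYm hprec (hfin j)]
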